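/- **Conventions.** A *stable SUSY graph* $\tau$ consists of finite sets $F_\tau$ (flags) and $V_\tau$ (vertices), a map $\partial_\tau\colon F_\tau\to V_\tau$, an involution $j_\tau$ of $F_\tau$ (fixed points are tails, two-element orbits are edges), a genus $g_\tau\colon V_\tau\to\mathbb Z_{\ge0}$ and a colouring $c_\tau\colon F_\tau\to\{NS,R\}$ with $c_\tau\circ j_\tau=c_\tau$, such that every vertex $v$ carries an even number of flags of colour $R$ and $2g_\tau(v)-2+\#\partial_\tau^{-1}(v)>0$. A *morphism* $h\colon\tau\to\sigma$ consists of an injection $h^F\colon F_\sigma\to F_\tau$, a surjection $h_V\colon V_\tau\to V_\sigma$ and a fixed-point-free involution $j_h$ of $F_\tau\setminus h^F(F_\sigma)$, whose orbits are the contracted pairs, such that: $h_V\partial_\tau h^F=\partial_\sigma$; the two flags of a contracted pair lie at vertices with the same image; every edge of $\tau$ is either a contracted pair or the image of an edge of $\sigma$ under $h^F$ (tails may be grafted to edges, and pairs of tails may be contracted); $h^F$ and $j_h$ preserve colours; any two vertices with the same image are connected by a path of contracted pairs; and $g_\sigma(v)=\sum_{w\in h_V^{-1}(v)}g_\tau(w)+\#\{\text{contracted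 pairs over }v\}-\#h_V^{-1}(v)+1$ for all $v\in V_\sigma$. With disjoint union this is a symmetric monoidal category $\mathbf{SGr^{st}}$. A *grafting* is a morphism that is bijective on vertices and on flags. A *SUSY operad* in a symmetric monoidal category $(\mathbf C,\otimes)$ is a (strong) symmetric monoidal functor $\mathbf O\colon\mathbf{SGr^{st}}\to\mathbf C$ that sends graftings to isomorphisms. A *corolla* is a graph with a single vertex; $F_{\tau,NS}$ and $F_{\tau,R}$ are the sets of flags of the two colours. Unions of label sets are disjoint unions, and sets that agree in the usual notation, such as $(I\setminus\{a,b\})\setminus\{c,d\}$ and $(I\setminus\{c,d\})\setminus\{a,b\}$, are identified (formally: the objects below are identified by the relabelings along the canonical bijections). **Proposition.** Let $(\mathbf C,\otimes)$ be a symmetric monoidal category with symmetry $\beta$, together with * objects $C(g,I_{NS},I_R)$ for all integers $g\ge0$ and finite sets $I_{NS},I_R$ with $\#I_R$ even and $2g-2+\#I_{NS}+\#I_R>0$; * for every pair $s=(s_{NS}\colon I_{NS}\to J_{NS},\ s_R\colon I_R\to J_R)$ of bijections an isomorphism $c_s\colon C(g,I_{NS},I_R)\to C(g,J_{NS},J_R)$;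 * for each colour $x\in\{NS,R\}$ and distinct $i,i'\in I_x$ a morphism $c^l_x(i,i')$ from $C(g,I_{NS},I_R)$ to the object of genus $g+1$ obtained by removing $i,i'$ from $I_x$; * for each colour $x$ and $i\in I_x$, $i'\in I'_x$ a morphism $c_x(i,i')$ from $C(g,I_{NS},I_R)\otimes C(g',I'_{NS},I'_R)$ to the object of genus $g+g'$ obtained by removing $i,i'$ from $I_x\cup I'_x$ in the pair $(I_{NS}\cup I'_{NS},I_R\cup I'_R)$. No relations between these data are assumed. Then there is a SUSY operad $\mathbf O\colon\mathbf{SGr^{st}}\to\mathbf C$ such that * $\mathbf O(\tau)=C(g_\tau(v),F_{\tau,NS},F_{\tau,R})$ for every corolla $\tau$ with vertex $v$; * $\mathbf O(h)=c_{((h^F|_{F_{\sigma,NS}})^{-1},(h^F|_{F_{\sigma,R}})^{-1})}$ for every isomorphism $h\colon\tau\to\sigma$ of corollas; * $\mathbf O(h)$ is the identity for every grafting $h$ such that $h_V$ and $h^F$ are identities; * $\mathbf O(h)$ is $c^l_{c_\tau(f)}(f,f')$ for every contraction $h$ of a loop formed by flags $f,f'$ of a graph $\tau$ with a single vertex (followed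 by the relabeling along $(h^F)^{-1}$, the identity if $h^F$ is an inclusion); * $\mathbf O(h)$ is $c_{c_\tau(f)}(f,f')$ (with the same proviso) for every contraction $h$ of an edge, formed by flags $f\in F_{\tau_1}$ and $f'\in F_{\tau_2}$, of a graph $\tau$ obtained by grafting two corollas $\tau_1,\tau_2$, where $\mathbf O(\tau)$ is identified with $\mathbf O(\tau_1)\otimes\mathbf O(\tau_2)$ by the grafting and the monoidal structure of $\mathbf O$; and such that $\mathbf O$ is unique, in the sense that for every SUSY operad $\mathbf O'$ with these properties there is exactly one monoidal natural isomorphism $\mathbf O\cong\mathbf O'$ which is the identity on all corollas, if and only if the following conditions hold for all label sets, for all relabelings $s,s'$, for all colours $x,y$, and for all elements for which the terms are defined: 1. $c_{s'\circ s}=c_{s'}\circ c_s$. 2. $c^l_x(i,i')=c^l_x(i',i)$ and $c_x(i,i')=c_x(i',i)\circ\beta$. 3. $c_{\bar s}\circ c^l_x(i,i')=c^l_x(s(i),s(i'))\circ c_s$, where $\bar s$ is the restriction of $s$. 4. $c_x(s(i),s'(i'))\circ(c_s\otimes c_{s'})=c_{\overline{s\cup s'}}\circ c_x(i,i')$, where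 $\overline{s\cup s'}$ is the restriction of $s\cup s'$. 5. $c^l_x(i_1,i'_1)\circ c^l_y(i_2,i'_2)=c^l_y(i_2,i'_2)\circ c^l_x(i_1,i'_1)$ if $i_1,i'_1\in I_x$ and $i_2,i'_2\in I_y$ are four distinct elements of $I_{NS}\cup I_R$. 6. $c^l_x(i_1,i'_1)\circ c_y(i_2,i'_2)=c_y(i_2,i'_2)\circ(c^l_x(i_1,i'_1)\otimes\mathrm{id})$ for distinct $i_1,i_1'\in I_x$, $i_2\in I_y$ and for $i'_2\in I'_y$; and $c^l_y(i_2,i'_2)\circ c_x(i_1,i'_1)=c^l_x(i_1,i'_1)\circ c_y(i_2,i'_2)$ for $i_1\in I_x$, $i'_1\in I'_x$, $i_2\in I_y$, $i'_2\in I'_y$ with $i_1\ne i_2$ and $i'_1\neq i'_2$. 7. $c_x(i_1,i'_1)\circ(\mathrm{id}\otimes c_y(i_2,i'_2))=c_y(i_2,i'_2)\circ(c_x(i_1,i'_1)\otimes\mathrm{id})$ for $i_1\in I_x$, $i'_1\in I'_x$, $i_2\in I'_y$, $i'_2\in I''_y$ with $i'_1\ne i_2$ (up to the associativity isomorphism of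 $\otimes$). -/

import Mathlib

open CategoryTheory MonoidalCategory

universe u v w

namespace SUSY

/-! ### Counting lemmas -/

section Counting

open scoped Classical in
theorem natCard_subtype {α : Type*} [Fintype α] (p : α → Prop) :
    Nat.card {a // p a} = ∑ a, if p a then 1 else 0 := by
  rw [Nat.card_eq_fintype_card, Fintype.card_subtype, Finset.card_filter]

open scoped Classical in
theorem finsum_subtype {α : Type*} [Fintype α] (p : α → Prop) (f : α → ℕ) :
    ∑ᶠ a : {a // p a}, f a.1 = ∑ a, if p a then f a else 0 := by
  rw [finsum_eq_sum_of_fintype, ← Finset.sum_filter, ← Finset.sum_subtype_eq_sum_filter]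
  simp

open scoped Classical in
theorem sum_fibre {α β : Type*} [Fintype α] [Fintype β] (f : α → β) (q : β → Prop) (a : α → ℕ) :
    (∑ y, if q y then (∑ x, if f x = y then a x else 0) else 0) =
      ∑ x, if q (f x) then a x else 0 := by
  have h : ∀ y, (if q y then (∑ x, if f x = y then a x else 0) else 0) =
      ∑ x, if f x = y then (if q y then a x else 0) else 0 := by
    intro y
    by_cases hy : q y <;> simp [hy]
  simp_rw [h]
  rw [Finset.sum_comm]
  simp

open scoped Classical in
theorem sum_remove {α : Type*} [Fintype α] {i i' : α} (hne : i ≠ i') (f : α → ℕ) :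
    ∑ a, f a = (∑ a : {a // a ≠ i ∧ a ≠ i'}, f a.1) + f i + f i' := by
  rw [← Finset.add_sum_erase _ _ (Finset.mem_univ i),
    ← Finset.add_sum_erase (Finset.univ.erase i) f (a := i') (by simp [hne.symm])]
  have h : ∑ a : {a // a ≠ i ∧ a ≠ i'}, f a.1 = ∑ a ∈ (Finset.univ.erase i).erase i', f a := by
    symm
    apply Finset.sum_subtype
    intro x
    simp [and_comm]
  rw [h]
  ring

open scoped Classical in
theorem natCard_remove {α : Type*} [Finite α] {i i' : α} (hne : i ≠ i') (p : α → Prop) :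
    Nat.card {a // p a} = Nat.card {a : {a // a ≠ i ∧ a ≠ i'} // p a.1} +
      (if p i then 1 else 0) + (if p i' then 1 else 0) := by
  have := Fintype.ofFinite α
  rw [natCard_subtype, natCard_subtype, sum_remove hne]

theorem natCard_remove' {α : Type*} [Finite α] {i i' : α} (hne : i ≠ i') :
    Nat.card α = Nat.card {a // a ≠ i ∧ a ≠ i'} + 2 := by
  classical
  have := Fintype.ofFinite α
  have h := sum_remove hne (fun _ => 1)
  simp only [Finset.sum_const, smul_eq_mul, mul_one, Finset.card_univ] at h
  rw [Nat.card_eq_fintype_card, Nat.card_eq_fintype_card, h]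

theorem natCard_sum_subtype {α β : Type*} [Finite α] [Finite β] (p : α ⊕ β → Prop) :
    Nat.card {a // p a} = Nat.card {a // p (Sum.inl a)} + Nat.card {b // p (Sum.inr b)} := by
  classical
  have := Fintype.ofFinite α
  have := Fintype.ofFinite β
  rw [natCard_subtype, natCard_subtype, natCard_subtype, Fintype.sum_sum_type]

end Counting

/-! ### Stable SUSY graphs -/

/-- The two colours of flags: Neveu--Schwarz and Ramond. -/
inductive Color
  | NS
  | R

/-- A finite set of vertices with genera and a finite set of coloured flags attached to them, such
that every vertex is stable and carries an even number of Ramond flags. -/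
structure FlagData where
  V : Type u
  F : Type u
  [finV : Finite V]
  [finF : Finite F]
  bd : F → V
  genus : V → ℕ
  color : F → Color
  even : ∀ v, Even (Nat.card {f // bd f = v ∧ color f = Color.R})
  stable : ∀ v, 2 < 2 * genus v + Nat.card {f // bd f = v}

attribute [instance] FlagData.finV FlagData.finF

/-- A stable SUSY graph. Fixed points of the involution `j` are the tails, two-element orbits of
`j` are the edges. -/
structure Graph extends FlagData.{u} where
  j : F → F
  j_j : ∀ f, j (j f) = f
  color_j : ∀ f, color (j f) = color f

/-- Morphisms of SUSY graphs. The involution on the set `τ.F \ onF (σ.F)` of contracted flags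
is recorded as an involution `ghost` of all of `τ.F`, extended by the identity to `onF (σ.F)`; it
has no fixed points among the contracted flags. Its two-element orbits are the contracted edges and
the contracted pairs of tails (virtual contractions). -/
@[ext]
structure Hom (τ σ : Graph.{u}) where
  onV : τ.V → σ.V
  onF : σ.F → τ.F
  ghost : τ.F → τ.F
  onV_surj : Function.Surjective onV
  onF_inj : Function.Injective onF
  ghost_ghost : ∀ f, ghost (ghost f) = f
  ghost_eq_self : ∀ f, ghost f = f ↔ f ∈ Set.range onF
  /-- Flags that are not contracted stay at the image of their vertex. -/
  bd_onF : ∀ f, onV (τ.bd (onF f)) = σ.bd f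
  /-- The two flags of a contracted pair are attached to vertices with the same image. -/
  bd_ghost : ∀ f, onV (τ.bd (ghost f)) = onV (τ.bd f)
  /-- An edge one of whose flags is contracted is contracted as an edge. -/
  ghost_edge : ∀ f, τ.j f ≠ f → f ∉ Set.range onF → ghost f = τ.j f
  /-- An edge which is not contracted stays an edge. -/
  onF_edge : ∀ f, τ.j (onF f) ≠ onF f → onF (σ.j f) = τ.j (onF f)
  color_onF : ∀ f, τ.color (onF f) = σ.color f
  color_ghost : ∀ f, τ.color (ghost f) = τ.color f
  /-- Vertices with the same image are connected by a path of contracted pairs of flags. -/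
  connected : ∀ a b, onV a = onV b →
    Relation.ReflTransGen (fun a b => ∃ f, τ.bd f = a ∧ τ.bd (ghost f) = b) a b
  /-- The genus of a vertex `v` is the sum of the genera of its preimages plus the number
  `#{contracted pairs over v} - #{preimages of v} + 1` of independent contracted loops over `v`.
  The equation is written with everything doubled and without subtraction. -/
  genus_eq : ∀ v, 2 * σ.genus v + 2 * Nat.card {a // onV a = v} =
    2 * (∑ᶠ a : {a // onV a = v}, τ.genus a.1) +
      Nat.card {f // onV (τ.bd f) = v ∧ ghost f ≠ f} + 2

namespace Hom

open scoped Classical in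
theorem genus_eq_iff {τ : Graph.{u}} {V' : Type u} [Fintype τ.V] [Fintype τ.F] (φ : τ.V → V')
    (gh : τ.F → τ.F) (v : V') (n : ℕ) :
    (2 * n + 2 * Nat.card {a // φ a = v} =
      2 * (∑ᶠ a : {a // φ a = v}, τ.genus a.1) +
        Nat.card {f // φ (τ.bd f) = v ∧ gh f ≠ f} + 2) ↔
    (2 * n + 2 * (∑ a, if φ a = v then 1 else 0) =
      2 * (∑ a, if φ a = v then τ.genus a else 0) +
        (∑ f, if φ (τ.bd f) = v ∧ gh f ≠ f then 1 else 0) + 2) := by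
  rw [natCard_subtype, natCard_subtype, finsum_subtype]
  congr!

/-- The morphism given by compatible bijections on vertices and flags, without contractions. -/
def ofEquiv {τ σ : Graph.{u}} (e : τ.V ≃ σ.V) (k : σ.F ≃ τ.F)
    (hbd : ∀ f, e (τ.bd (k f)) = σ.bd f) (hg : ∀ v, σ.genus (e v) = τ.genus v)
    (hc : ∀ f, τ.color (k f) = σ.color f) (hj : ∀ f, k (σ.j f) = τ.j (k f)) : Hom τ σ where
  onV := e
  onF := k
  ghost := id
  onV_surj := e.surjective
  onF_inj := k.injective
  ghost_ghost _ := rfl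
  ghost_eq_self f := by simp
  bd_onF := hbd
  bd_ghost _ := rfl
  ghost_edge f _ h := absurd (k.surjective f) h
  onF_edge f _ := hj f
  color_onF := hc
  color_ghost _ := rfl
  connected a b h := by rw [e.injective h]
  genus_eq v := by
    classical
    have := Fintype.ofFinite τ.V
    have := Fintype.ofFinite τ.F
    rw [genus_eq_iff]
    obtain ⟨a, rfl⟩ := e.surjective v
    simp [hg]

/-- The identity morphism. -/
def id (τ : Graph.{u}) : Hom τ τ :=
  ofEquiv (Equiv.refl _) (Equiv.refl _) (fun _ => rfl) (fun _ => rfl) (fun _ => rfl) (fun _ => rfl)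

section comp

variable {τ σ ρ : Graph.{u}} (h : Hom τ σ) (k : Hom σ ρ)

/-- The contracted pairs of a composition: those contracted by the first morphism, and the
pairs which are contracted by the second morphism. -/
noncomputable def compGhost : τ.F → τ.F :=
  Function.extend h.onF (fun f => h.onF (k.ghost f)) h.ghost

@[simp]
theorem compGhost_onF (f : σ.F) : compGhost h k (h.onF f) = h.onF (k.ghost f) :=
  h.onF_inj.extend_apply _ _ _

theorem compGhost_of_notMem {f : τ.F} (hf : f ∉ Set.range h.onF) :
    compGhost h k f = h.ghost f :=
  Function.extend_apply' _ _ _ hf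

theorem ghost_notMem {f : τ.F} (hf : f ∉ Set.range h.onF) : h.ghost f ∉ Set.range h.onF := by
  rw [← ghost_eq_self, h.ghost_ghost]
  rw [← ghost_eq_self] at hf
  exact fun e => hf e.symm

@[simp]
theorem ghost_onF (f : σ.F) : h.ghost (h.onF f) = h.onF f :=
  (h.ghost_eq_self _).2 ⟨f, rfl⟩

theorem bd_compGhost (f : τ.F) : k.onV (h.onV (τ.bd (compGhost h k f))) =
    k.onV (h.onV (τ.bd f)) := by
  by_cases hf : f ∈ Set.range h.onF
  · obtain ⟨y, rfl⟩ := hf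
    simp [h.bd_onF, k.bd_ghost]
  · rw [compGhost_of_notMem h k hf, h.bd_ghost]

theorem connected_comp (a b : τ.V) (hab : k.onV (h.onV a) = k.onV (h.onV b)) :
    Relation.ReflTransGen (fun a b => ∃ f, τ.bd f = a ∧ τ.bd (compGhost h k f) = b) a b := by
  have key : ∀ a b, h.onV a = h.onV b →
      Relation.ReflTransGen (fun a b => ∃ f, τ.bd f = a ∧ τ.bd (compGhost h k f) = b) a b := by
    intro a b e
    refine (h.connected a b e).lift' _root_.id ?_
    rintro x y ⟨f, rfl, rfl⟩
    by_cases hf : f ∈ Set.range h.onF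
    · rw [(h.ghost_eq_self f).2 hf]
    · exact .single ⟨f, rfl, by rw [compGhost_of_notMem h k hf]; rfl⟩
  have main : ∀ c, Relation.ReflTransGen
      (fun a b => ∃ f, σ.bd f = a ∧ σ.bd (k.ghost f) = b) (h.onV a) c →
      ∀ b, h.onV b = c → Relation.ReflTransGen
        (fun a b => ∃ f, τ.bd f = a ∧ τ.bd (compGhost h k f) = b) a b := by
    intro c hc
    induction hc with
    | refl => exact fun b hb => key _ _ hb.symm
    | tail _ hstep ih =>
      obtain ⟨f, rfl, rfl⟩ := hstep
      intro b hb
      refine ((ih (τ.bd (h.onF f)) (h.bd_onF f)).tail ⟨h.onF f, rfl, rfl⟩).trans (key _ _ ?_)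
      rw [compGhost_onF, h.bd_onF, hb]
  exact main _ (k.connected _ _ hab) b rfl

theorem genus_comp (v : ρ.V) : 2 * ρ.genus v + 2 * Nat.card {a // (k.onV ∘ h.onV) a = v} =
    2 * (∑ᶠ a : {a // (k.onV ∘ h.onV) a = v}, τ.genus a.1) +
      Nat.card {f // (k.onV ∘ h.onV) (τ.bd f) = v ∧ compGhost h k f ≠ f} + 2 := by
  classical
  have := Fintype.ofFinite τ.V
  have := Fintype.ofFinite τ.F
  have := Fintype.ofFinite σ.V
  have := Fintype.ofFinite σ.F
  rw [genus_eq_iff]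
  have hk := (genus_eq_iff _ _ _ _).1 (k.genus_eq v)
  have hh := fun y => (genus_eq_iff _ _ _ _).1 (h.genus_eq y)
  have hsum := Finset.sum_congr (rfl : (Finset.univ : Finset σ.V) = Finset.univ) fun y _ =>
    congrArg (fun n => if k.onV y = v then n else 0) (hh y)
  have split : ∀ (p : Prop) [Decidable p] (a b : ℕ),
      (if p then a + b else 0) = (if p then a else 0) + (if p then b else 0) := by
    intro p _ a b; split_ifs <;> rfl
  have mul : ∀ (p : Prop) [Decidable p] (b : ℕ),
      (if p then 2 * b else 0) = 2 * (if p then b else 0) := by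
    intro p _ b; split_ifs <;> rfl
  have two : ∀ (p : Prop) [Decidable p],
      (if p then 2 else 0) = 2 * (if p then 1 else 0) := by
    intro p _; split_ifs <;> rfl
  have gh : ∀ y, (∑ f, if h.onV (τ.bd f) = y ∧ h.ghost f ≠ f then 1 else 0) =
      ∑ f, if h.onV (τ.bd f) = y then (if h.ghost f ≠ f then 1 else 0) else 0 :=
    fun y => Finset.sum_congr rfl fun f _ => by rw [ite_and]
  simp only [gh, split, mul, Finset.sum_add_distrib, ← Finset.mul_sum] at hsum
  rw [sum_fibre h.onV (fun y => k.onV y = v), sum_fibre h.onV (fun y => k.onV y = v),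
    sum_fibre (fun f => h.onV (τ.bd f)) (fun y => k.onV y = v)] at hsum
  have hg : (∑ f, if (k.onV ∘ h.onV) (τ.bd f) = v ∧ compGhost h k f ≠ f then 1 else 0) =
      (∑ f, if k.onV (h.onV (τ.bd f)) = v then (if h.ghost f ≠ f then 1 else 0) else 0) +
      ∑ f, if k.onV (σ.bd f) = v ∧ k.ghost f ≠ f then 1 else 0 := by
    have e : (∑ f, if k.onV (σ.bd f) = v ∧ k.ghost f ≠ f then 1 else 0) =
        ∑ f, if (∃ y, h.onF y = f ∧ k.onV (σ.bd y) = v ∧ k.ghost y ≠ y) then 1 else 0 := by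
      rw [← Finset.card_filter, ← Finset.card_filter, ← Finset.card_map ⟨h.onF, h.onF_inj⟩]
      congr 1
      ext f
      simp only [Finset.mem_map, Finset.mem_filter, Finset.mem_univ, true_and,
        Function.Embedding.coeFn_mk]
      exact ⟨fun ⟨y, hy, e⟩ => ⟨y, e, hy⟩, fun ⟨y, e, hy⟩ => ⟨y, hy, e⟩⟩
    rw [e, ← Finset.sum_add_distrib]
    refine Finset.sum_congr rfl fun f _ => ?_
    by_cases hf : f ∈ Set.range h.onF
    · obtain ⟨y, rfl⟩ := hf
      simp [h.onF_inj.eq_iff, h.bd_onF]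
    · have : ¬ ∃ y, h.onF y = f ∧ k.onV (σ.bd y) = v ∧ k.ghost y ≠ y :=
        fun ⟨y, hy, _⟩ => hf ⟨y, hy⟩
      rw [if_neg this, compGhost_of_notMem h k hf, ite_and]
      simp
  rw [hg]
  simp only [Function.comp_apply]
  simp only [two, ← Finset.mul_sum] at hsum
  omega

/-- Composition of morphisms. -/
noncomputable def comp : Hom τ ρ where
  onV := k.onV ∘ h.onV
  onF := h.onF ∘ k.onF
  ghost := compGhost h k
  onV_surj := k.onV_surj.comp h.onV_surj
  onF_inj := h.onF_inj.comp k.onF_inj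
  ghost_ghost f := by
    by_cases hf : f ∈ Set.range h.onF
    · obtain ⟨y, rfl⟩ := hf
      simp [k.ghost_ghost]
    · rw [compGhost_of_notMem h k hf, compGhost_of_notMem h k (h.ghost_notMem hf), h.ghost_ghost]
  ghost_eq_self f := by
    by_cases hf : f ∈ Set.range h.onF
    · obtain ⟨y, rfl⟩ := hf
      simp [h.onF_inj.eq_iff, k.ghost_eq_self]
    · rw [compGhost_of_notMem h k hf, h.ghost_eq_self]
      exact ⟨fun e => absurd e hf, fun ⟨y, e⟩ => absurd ⟨k.onF y, e⟩ hf⟩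
  bd_onF f := by simp [h.bd_onF, k.bd_onF]
  bd_ghost := bd_compGhost h k
  ghost_edge f hj hf := by
    by_cases hm : f ∈ Set.range h.onF
    · obtain ⟨y, rfl⟩ := hm
      have e := h.onF_edge y hj
      rw [compGhost_onF, ← e, k.ghost_edge]
      · intro e'
        rw [e'] at e
        exact hj e.symm
      · rintro ⟨z, rfl⟩
        exact hf ⟨z, rfl⟩
    · rw [compGhost_of_notMem h k hm, h.ghost_edge f hj hm]
  onF_edge f hj := by
    have e := h.onF_edge (k.onF f) hj
    simp only [Function.comp_apply]
    rw [k.onF_edge, e]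
    intro e'
    rw [e'] at e
    exact hj e.symm
  color_onF f := by simp [h.color_onF, k.color_onF]
  color_ghost f := by
    by_cases hf : f ∈ Set.range h.onF
    · obtain ⟨y, rfl⟩ := hf
      simp [h.color_onF, k.color_ghost]
    · rw [compGhost_of_notMem h k hf, h.color_ghost]
  connected := connected_comp h k
  genus_eq := genus_comp h k

end comp

end Hom

noncomputable instance : Category Graph.{u} where
  Hom := Hom
  id := Hom.id
  comp := Hom.comp
  id_comp h := by
    refine Hom.ext rfl rfl (funext fun f => ?_)
    exact Hom.compGhost_onF (Hom.id _) h f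
  comp_id h := by
    refine Hom.ext rfl rfl (funext fun f => ?_)
    by_cases hf : f ∈ Set.range h.onF
    · obtain ⟨y, rfl⟩ := hf
      exact (Hom.compGhost_onF h (Hom.id _) y).trans (h.ghost_onF y).symm
    · exact Hom.compGhost_of_notMem h _ hf
  assoc h k l := by
    refine Hom.ext rfl rfl (funext fun f => ?_)
    change Hom.compGhost (h.comp k) l f = Hom.compGhost h (k.comp l) f
    by_cases hf : f ∈ Set.range h.onF
    · obtain ⟨y, rfl⟩ := hf
      rw [Hom.compGhost_onF]
      by_cases hy : y ∈ Set.range k.onF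
      · obtain ⟨z, rfl⟩ := hy
        have e : h.onF (k.onF z) = (h.comp k).onF z := rfl
        rw [e, Hom.compGhost_onF]
        exact congrArg h.onF (Hom.compGhost_onF k l z).symm
      · rw [Hom.compGhost_of_notMem]
        · exact (Hom.compGhost_onF h k y).trans
            (congrArg h.onF (Hom.compGhost_of_notMem k l hy).symm)
        · rintro ⟨z, hz⟩
          exact hy ⟨z, h.onF_inj hz⟩
    · rw [Hom.compGhost_of_notMem _ _ hf, Hom.compGhost_of_notMem]
      · exact Hom.compGhost_of_notMem h k hf
      · rintro ⟨z, hz⟩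
        exact hf ⟨k.onF z, hz⟩

/-! ### Disjoint union -/

/-- Disjoint union of graphs. -/
def Graph.sum (τ σ : Graph.{u}) : Graph.{u} where
  V := τ.V ⊕ σ.V
  F := τ.F ⊕ σ.F
  bd := Sum.map τ.bd σ.bd
  genus := Sum.elim τ.genus σ.genus
  color := Sum.elim τ.color σ.color
  even v := by
    rw [natCard_sum_subtype]
    rcases v with v | v
    · simpa using τ.even v
    · simpa using σ.even v
  stable v := by
    rw [natCard_sum_subtype]
    rcases v with v | v
    · simpa using τ.stable v
    · simpa using σ.stable v
  j := Sum.map τ.j σ.j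
  j_j := by rintro (f | f) <;> simp [τ.j_j, σ.j_j]
  color_j := by rintro (f | f) <;> simp [τ.color_j, σ.color_j]

/-- The graph without vertices. -/
def Graph.empty : Graph.{u} where
  V := PEmpty
  F := PEmpty
  bd := PEmpty.elim
  genus := PEmpty.elim
  color := PEmpty.elim
  even v := v.elim
  stable v := v.elim
  j := PEmpty.elim
  j_j f := f.elim
  color_j f := f.elim

namespace Hom

theorem reflTransGen_sum_inl {τ σ τ' σ' : Graph.{u}} (h : Hom τ τ') (k : Hom σ σ') {a b : τ.V}
    (hab : Relation.ReflTransGen (fun a b => ∃ f, τ.bd f = a ∧ τ.bd (h.ghost f) = b) a b) :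
    Relation.ReflTransGen (fun a b => ∃ f, (τ.sum σ).bd f = a ∧
      (τ.sum σ).bd (Sum.map h.ghost k.ghost f) = b) (Sum.inl a : τ.V ⊕ σ.V) (Sum.inl b) :=
  hab.lift Sum.inl fun _ _ ⟨f, h1, h2⟩ => ⟨Sum.inl f, congrArg Sum.inl h1, congrArg Sum.inl h2⟩

theorem reflTransGen_sum_inr {τ σ τ' σ' : Graph.{u}} (h : Hom τ τ') (k : Hom σ σ') {a b : σ.V}
    (hab : Relation.ReflTransGen (fun a b => ∃ f, σ.bd f = a ∧ σ.bd (k.ghost f) = b) a b) :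
    Relation.ReflTransGen (fun a b => ∃ f, (τ.sum σ).bd f = a ∧
      (τ.sum σ).bd (Sum.map h.ghost k.ghost f) = b) (Sum.inr a : τ.V ⊕ σ.V) (Sum.inr b) :=
  hab.lift Sum.inr fun _ _ ⟨f, h1, h2⟩ => ⟨Sum.inr f, congrArg Sum.inr h1, congrArg Sum.inr h2⟩

/-- Disjoint union of morphisms. -/
def sum {τ σ τ' σ' : Graph.{u}} (h : Hom τ τ') (k : Hom σ σ') :
    Hom (τ.sum σ) (τ'.sum σ') where
  onV := Sum.map h.onV k.onV
  onF := Sum.map h.onF k.onF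
  ghost := Sum.map h.ghost k.ghost
  onV_surj := Sum.map_surjective.2 ⟨h.onV_surj, k.onV_surj⟩
  onF_inj := Sum.map_injective.2 ⟨h.onF_inj, k.onF_inj⟩
  ghost_ghost := by
    rintro (f | f)
    · exact congrArg Sum.inl (h.ghost_ghost f)
    · exact congrArg Sum.inr (k.ghost_ghost f)
  ghost_eq_self := by
    rintro (f | f)
    · refine Sum.inl_injective.eq_iff.trans ((h.ghost_eq_self f).trans ⟨?_, ?_⟩)
      · rintro ⟨y, rfl⟩
        exact ⟨Sum.inl y, rfl⟩
      · rintro ⟨y | y, hy⟩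
        · exact ⟨y, Sum.inl_injective hy⟩
        · cases hy
    · refine Sum.inr_injective.eq_iff.trans ((k.ghost_eq_self f).trans ⟨?_, ?_⟩)
      · rintro ⟨y, rfl⟩
        exact ⟨Sum.inr y, rfl⟩
      · rintro ⟨y | y, hy⟩
        · cases hy
        · exact ⟨y, Sum.inr_injective hy⟩
  bd_onF := by
    rintro (f | f)
    · exact congrArg Sum.inl (h.bd_onF f)
    · exact congrArg Sum.inr (k.bd_onF f)
  bd_ghost := by
    rintro (f | f)
    · exact congrArg Sum.inl (h.bd_ghost f)
    · exact congrArg Sum.inr (k.bd_ghost f)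
  ghost_edge := by
    rintro (f | f) hj hf
    · refine congrArg Sum.inl (h.ghost_edge f (fun e => hj (congrArg Sum.inl e)) ?_)
      rintro ⟨y, rfl⟩
      exact hf ⟨Sum.inl y, rfl⟩
    · refine congrArg Sum.inr (k.ghost_edge f (fun e => hj (congrArg Sum.inr e)) ?_)
      rintro ⟨y, rfl⟩
      exact hf ⟨Sum.inr y, rfl⟩
  onF_edge := by
    rintro (f | f) hj
    · exact congrArg Sum.inl (h.onF_edge f (fun e => hj (congrArg Sum.inl e)))
    · exact congrArg Sum.inr (k.onF_edge f (fun e => hj (congrArg Sum.inr e)))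
  color_onF := by
    rintro (f | f)
    · exact h.color_onF f
    · exact k.color_onF f
  color_ghost := by
    rintro (f | f)
    · exact h.color_ghost f
    · exact k.color_ghost f
  connected := by
    rintro (a | a) (b | b) hab
    · exact reflTransGen_sum_inl h k (h.connected a b (Sum.inl_injective hab))
    · cases hab
    · cases hab
    · exact reflTransGen_sum_inr h k (k.connected a b (Sum.inr_injective hab))
  genus_eq := by
    classical
    have := Fintype.ofFinite τ.V
    have := Fintype.ofFinite σ.V
    rintro (v | v)
    · have e := h.genus_eq v
      have e1 : Nat.card {a // Sum.map h.onV k.onV a = Sum.inl v} =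
          Nat.card {a // h.onV a = v} := by
        rw [natCard_sum_subtype]; simp
      have e2 : ∑ᶠ a : {a // Sum.map h.onV k.onV a = Sum.inl v}, Sum.elim τ.genus σ.genus a.1 =
          ∑ᶠ a : {a // h.onV a = v}, τ.genus a.1 := by
        rw [finsum_subtype, finsum_subtype (fun a => _ = v), Fintype.sum_sum_type]; simp
      have e3 : Nat.card {f // Sum.map h.onV k.onV (Sum.map τ.bd σ.bd f) = Sum.inl v ∧
          Sum.map h.ghost k.ghost f ≠ f} =
          Nat.card {f // h.onV (τ.bd f) = v ∧ h.ghost f ≠ f} := by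
        rw [natCard_sum_subtype]; simp
      rw [← e1, ← e2, ← e3] at e
      exact e
    · have e := k.genus_eq v
      have e1 : Nat.card {a // Sum.map h.onV k.onV a = Sum.inr v} =
          Nat.card {a // k.onV a = v} := by
        rw [natCard_sum_subtype]; simp
      have e2 : ∑ᶠ a : {a // Sum.map h.onV k.onV a = Sum.inr v}, Sum.elim τ.genus σ.genus a.1 =
          ∑ᶠ a : {a // k.onV a = v}, σ.genus a.1 := by
        rw [finsum_subtype, finsum_subtype (fun a => _ = v), Fintype.sum_sum_type]; simp
      have e3 : Nat.card {f // Sum.map h.onV k.onV (Sum.map τ.bd σ.bd f) = Sum.inr v ∧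
          Sum.map h.ghost k.ghost f ≠ f} =
          Nat.card {f // k.onV (σ.bd f) = v ∧ k.ghost f ≠ f} := by
        rw [natCard_sum_subtype]; simp
      rw [← e1, ← e2, ← e3] at e
      exact e

end Hom

theorem hom_ext {τ σ : Graph.{u}} {h k : τ ⟶ σ} (hV : ∀ v, Hom.onV h v = Hom.onV k v)
    (hF : ∀ f, Hom.onF h f = Hom.onF k f) (hg : ∀ f, Hom.ghost h f = Hom.ghost k f) : h = k :=
  Hom.ext (funext hV) (funext hF) (funext hg)

theorem ghost_comp_onF {τ σ ρ : Graph.{u}} (h : τ ⟶ σ) (k : σ ⟶ ρ) (f : σ.F) :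
    Hom.ghost (h ≫ k) (Hom.onF h f) = Hom.onF h (Hom.ghost k f) :=
  Hom.compGhost_onF h k f

theorem ghost_comp_of_notMem {τ σ ρ : Graph.{u}} (h : τ ⟶ σ) (k : σ ⟶ ρ) {f : τ.F}
    (hf : f ∉ Set.range (Hom.onF h)) : Hom.ghost (h ≫ k) f = Hom.ghost h f :=
  Hom.compGhost_of_notMem h k hf

theorem ghost_comp_of_right {τ σ ρ : Graph.{u}} (h : τ ⟶ σ) (k : σ ⟶ ρ)
    (hk : ∀ f, Hom.ghost k f = f) (f : τ.F) : Hom.ghost (h ≫ k) f = Hom.ghost h f := by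
  by_cases hf : f ∈ Set.range (Hom.onF h)
  · obtain ⟨y, rfl⟩ := hf
    rw [ghost_comp_onF, hk, Hom.ghost_onF]
  · exact ghost_comp_of_notMem h k hf

/-- The isomorphism of graphs given by compatible bijections on vertices and flags. -/
def isoOfEquiv {τ σ : Graph.{u}} (e : τ.V ≃ σ.V) (k : σ.F ≃ τ.F)
    (hbd : ∀ f, e (τ.bd (k f)) = σ.bd f) (hg : ∀ v, σ.genus (e v) = τ.genus v)
    (hc : ∀ f, τ.color (k f) = σ.color f) (hj : ∀ f, k (σ.j f) = τ.j (k f)) : τ ≅ σ where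
  hom := Hom.ofEquiv e k hbd hg hc hj
  inv := Hom.ofEquiv e.symm k.symm (fun f => by simp [← hbd])
    (fun v => by simp [← hg]) (fun f => by simp [← hc])
    (fun f => by simp [Equiv.symm_apply_eq, hj])
  hom_inv_id := by
    refine hom_ext (fun v => e.symm_apply_apply v) (fun f => k.apply_symm_apply f) fun f => ?_
    exact ghost_comp_of_right _ _ (fun _ => rfl) f
  inv_hom_id := by
    refine hom_ext (fun v => e.apply_symm_apply v) (fun f => k.symm_apply_apply f) fun f => ?_
    exact ghost_comp_of_right _ _ (fun _ => rfl) f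

namespace Graph

/-- Associativity of the disjoint union. -/
def sumAssoc (τ σ ρ : Graph.{u}) : (τ.sum σ).sum ρ ≅ τ.sum (σ.sum ρ) :=
  isoOfEquiv (Equiv.sumAssoc τ.V σ.V ρ.V) (Equiv.sumAssoc τ.F σ.F ρ.F).symm
    (by rintro (f | f | f) <;> rfl) (by rintro ((v | v) | v) <;> rfl)
    (by rintro (f | f | f) <;> rfl) (by rintro (f | f | f) <;> rfl)

/-- Commutativity of the disjoint union. -/
def sumComm (τ σ : Graph.{u}) : τ.sum σ ≅ σ.sum τ :=
  isoOfEquiv (Equiv.sumComm τ.V σ.V) (Equiv.sumComm σ.F τ.F)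
    (by rintro (f | f) <;> rfl) (by rintro (v | v) <;> rfl)
    (by rintro (f | f) <;> rfl) (by rintro (f | f) <;> rfl)

/-- The empty graph is a left unit. -/
def emptySum (τ : Graph.{u}) : empty.sum τ ≅ τ :=
  isoOfEquiv (Equiv.emptySum PEmpty τ.V) (Equiv.emptySum PEmpty τ.F).symm
    (fun _ => rfl) (by rintro (v | v); exacts [v.elim, rfl]) (fun _ => rfl) (fun _ => rfl)

/-- The empty graph is a right unit. -/
def sumEmpty (τ : Graph.{u}) : τ.sum empty ≅ τ :=
  isoOfEquiv (Equiv.sumEmpty τ.V PEmpty) (Equiv.sumEmpty τ.F PEmpty).symm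
    (fun _ => rfl) (by rintro (v | v); exacts [rfl, v.elim]) (fun _ => rfl) (fun _ => rfl)

end Graph

noncomputable instance : MonoidalCategoryStruct Graph.{u} where
  tensorObj := Graph.sum
  whiskerLeft τ _ _ h := Hom.sum (Hom.id τ) h
  whiskerRight h τ := Hom.sum h (Hom.id τ)
  tensorHom h k := Hom.sum h k
  tensorUnit := Graph.empty
  associator := Graph.sumAssoc
  leftUnitor := Graph.emptySum
  rightUnitor := Graph.sumEmpty

noncomputable instance : MonoidalCategory Graph.{u} :=
  MonoidalCategory.ofTensorHom
    (id_tensorHom_id := fun τ σ => hom_ext (by rintro (v | v) <;> rfl) (by rintro (f | f) <;> rfl)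
      (by rintro (f | f) <;> rfl))
    (id_tensorHom := fun _ _ _ _ => rfl)
    (tensorHom_id := fun _ _ => rfl)
    (tensorHom_comp_tensorHom := fun {X₁ Y₁ Z₁ X₂ Y₂ Z₂} h₁ h₂ k₁ k₂ => by
      refine hom_ext (by rintro (v | v) <;> rfl) (by rintro (f | f) <;> rfl) ?_
      rintro (f | f)
      · by_cases hf : f ∈ Set.range (Hom.onF h₁)
        · obtain ⟨y, rfl⟩ := hf
          exact (ghost_comp_onF (h₁ ⊗ₘ h₂) (k₁ ⊗ₘ k₂) (Sum.inl y)).trans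
            (congrArg Sum.inl (ghost_comp_onF h₁ k₁ y)).symm
        · refine (ghost_comp_of_notMem (h₁ ⊗ₘ h₂) (k₁ ⊗ₘ k₂) ?_).trans
            (congrArg Sum.inl (ghost_comp_of_notMem h₁ k₁ hf)).symm
          rintro ⟨y | y, hy⟩
          · exact hf ⟨y, Sum.inl_injective hy⟩
          · cases hy
      · by_cases hf : f ∈ Set.range (Hom.onF h₂)
        · obtain ⟨y, rfl⟩ := hf
          exact (ghost_comp_onF (h₁ ⊗ₘ h₂) (k₁ ⊗ₘ k₂) (Sum.inr y)).trans
            (congrArg Sum.inr (ghost_comp_onF h₂ k₂ y)).symm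
        · refine (ghost_comp_of_notMem (h₁ ⊗ₘ h₂) (k₁ ⊗ₘ k₂) ?_).trans
            (congrArg Sum.inr (ghost_comp_of_notMem h₂ k₂ hf)).symm
          rintro ⟨y | y, hy⟩
          · cases hy
          · exact hf ⟨y, Sum.inr_injective hy⟩)
    (associator_naturality := fun {X₁ X₂ X₃ Y₁ Y₂ Y₃} h₁ h₂ h₃ => by
      refine hom_ext (by rintro ((v | v) | v) <;> rfl) (by rintro (f | f | f) <;> rfl) fun f => ?_
      refine (ghost_comp_of_right _ _ (fun _ => rfl) f).trans ?_
      obtain ⟨y, rfl⟩ := (Equiv.sumAssoc X₁.F X₂.F X₃.F).symm.surjective f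
      refine Eq.trans ?_ (ghost_comp_onF (Graph.sumAssoc X₁ X₂ X₃).hom _ y).symm
      rcases y with y | y | y <;> rfl)
    (leftUnitor_naturality := fun {X Y} h => by
      refine hom_ext (by rintro (v | v); exacts [v.elim, rfl]) (fun _ => rfl) fun f => ?_
      refine (ghost_comp_of_right _ _ (fun _ => rfl) f).trans ?_
      obtain ⟨y, rfl⟩ := (Equiv.emptySum PEmpty X.F).symm.surjective f
      exact (ghost_comp_onF (Graph.emptySum X).hom h y).symm)
    (rightUnitor_naturality := fun {X Y} h => by
      refine hom_ext (by rintro (v | v); exacts [rfl, v.elim]) (fun _ => rfl) fun f => ?_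
      refine (ghost_comp_of_right _ _ (fun _ => rfl) f).trans ?_
      obtain ⟨y, rfl⟩ := (Equiv.sumEmpty X.F PEmpty).symm.surjective f
      exact (ghost_comp_onF (Graph.sumEmpty X).hom h y).symm)
    (pentagon := fun W X Y Z => by
      refine hom_ext (by rintro (((v | v) | v) | v) <;> rfl)
        (by rintro (f | f | f | f) <;> rfl) fun f => ?_
      rw [ghost_comp_of_right _ _ (fun f => ?_), ghost_comp_of_right _ _ (fun _ => rfl)]
      · rcases f with ((f | f) | f) | f <;> rfl
      · rw [ghost_comp_of_right _ _ (fun f => ?_)]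
        · rfl
        · rcases f with f | (f | f) | f <;> rfl)
    (triangle := fun X Y => by
      refine hom_ext (by rintro ((v | v) | v); exacts [rfl, v.elim, rfl])
        (by rintro (f | f) <;> rfl) fun f => ?_
      rw [ghost_comp_of_right _ _ (fun f => ?_)]
      · rcases f with (f | f) | f
        exacts [rfl, f.elim, rfl]
      · rcases f with f | f | f
        exacts [rfl, f.elim, rfl])

noncomputable instance : SymmetricCategory Graph.{u} where
  braiding := Graph.sumComm
  braiding_naturality_right X Y Z h := by
    refine hom_ext (by rintro (v | v) <;> rfl) (by rintro (f | f) <;> rfl) fun f => ?_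
    refine (ghost_comp_of_right _ _ (fun _ => rfl) f).trans ?_
    obtain ⟨y, rfl⟩ := (Equiv.sumComm Y.F X.F).surjective f
    refine Eq.trans ?_ (ghost_comp_onF (Graph.sumComm X Y).hom _ y).symm
    rcases y with y | y <;> rfl
  braiding_naturality_left {X Y} h Z := by
    refine hom_ext (by rintro (v | v) <;> rfl) (by rintro (f | f) <;> rfl) fun f => ?_
    refine (ghost_comp_of_right _ _ (fun _ => rfl) f).trans ?_
    obtain ⟨y, rfl⟩ := (Equiv.sumComm Z.F X.F).surjective f
    refine Eq.trans ?_ (ghost_comp_onF (Graph.sumComm X Z).hom _ y).symm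
    rcases y with y | y <;> rfl
  hexagon_forward X Y Z := by
    refine hom_ext (by rintro ((v | v) | v) <;> rfl) (by rintro (f | f | f) <;> rfl) fun f => ?_
    rw [ghost_comp_of_right _ _ (fun f => ?_), ghost_comp_of_right _ _ (fun f => ?_)]
    · rcases f with (f | f) | f <;> rfl
    · rw [ghost_comp_of_right _ _ (fun f => ?_)]
      · rfl
      · rcases f with f | f | f <;> rfl
    · exact ghost_comp_of_right _ _ (fun _ => rfl) f
  hexagon_reverse X Y Z := by
    refine hom_ext (by rintro (v | v | v) <;> rfl) (by rintro ((f | f) | f) <;> rfl) fun f => ?_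
    rw [ghost_comp_of_right _ _ (fun f => ?_), ghost_comp_of_right _ _ (fun f => ?_)]
    · rcases f with f | f | f <;> rfl
    · rw [ghost_comp_of_right _ _ (fun f => ?_)]
      · rfl
      · rcases f with (f | f) | f <;> rfl
    · exact ghost_comp_of_right _ _ (fun _ => rfl) f
  symmetry X Y := by
    refine hom_ext (by rintro (v | v) <;> rfl) (by rintro (f | f) <;> rfl) fun f => ?_
    exact ghost_comp_of_right _ _ (fun _ => rfl) f

/-! ### Labels and gluing data -/

/-- A genus `g` together with a pair `(I_NS, I_R)` of disjoint finite sets, such that `#I_R` is even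
and `2 g - 2 + #I_NS + #I_R > 0`. The pair is encoded as the finite set `I = I_NS ∪ I_R` with the
map `color` to the two types. -/
structure Label where
  genus : ℕ
  I : Type u
  [fin : Finite I]
  color : I → Color
  even : Even (Nat.card {i // color i = Color.R})
  stable : 2 < 2 * genus + Nat.card I

attribute [instance] Label.fin

/-- A pair of bijections `(s_NS : I_NS → J_NS, s_R : I_R → J_R)` between the sets of two labels of
the same genus, encoded as a bijection which preserves the types. -/
structure Relabeling (L M : Label.{u}) where
  equiv : L.I ≃ M.I
  genus_eq : L.genus = M.genus
  color_eq : ∀ i, M.color (equiv i) = L.color i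

instance (L M : Label.{u}) : CoeFun (Relabeling L M) fun _ => L.I → M.I :=
  ⟨fun s => s.equiv⟩

/-- Composition of relabelings. -/
def Relabeling.trans {L M N : Label.{u}} (s : Relabeling L M) (t : Relabeling M N) :
    Relabeling L N where
  equiv := s.equiv.trans t.equiv
  genus_eq := s.genus_eq.trans t.genus_eq
  color_eq i := (t.color_eq _).trans (s.color_eq i)

namespace Label

/-- The label `(g + 1, I \ {i, i'})` for distinct `i`, `i'` of the same type. -/
def loop (L : Label.{u}) (i i' : L.I) (hne : i ≠ i') (hc : L.color i = L.color i') :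
    Label.{u} where
  genus := L.genus + 1
  I := {a : L.I // a ≠ i ∧ a ≠ i'}
  color a := L.color a.1
  even := by
    have h := L.even
    rw [natCard_remove hne, ← hc, add_assoc, Nat.even_add] at h
    exact h.2 ⟨_, rfl⟩
  stable := by
    have h := L.stable
    rw [natCard_remove' hne] at h
    omega

/-- The label `(g + g', (I ∪ I') \ {i, i'})` for `i ∈ I` and `i' ∈ I'` of the same type. -/
def edge (L M : Label.{u}) (i : L.I) (i' : M.I) (hc : L.color i = M.color i') :
    Label.{u} where
  genus := L.genus + M.genus
  I := {a : L.I ⊕ M.I // a ≠ Sum.inl i ∧ a ≠ Sum.inr i'}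
  color a := Sum.elim L.color M.color a.1
  even := by
    have h : Even (Nat.card {a // Sum.elim L.color M.color a = Color.R}) := by
      rw [natCard_sum_subtype]
      exact L.even.add M.even
    rw [natCard_remove (Sum.inl_ne_inr (a := i) (b := i')), Sum.elim_inl, Sum.elim_inr, ← hc,
      add_assoc, Nat.even_add] at h
    exact h.2 ⟨_, rfl⟩
  stable := by
    have hL := L.stable
    have hM := M.stable
    have h := natCard_remove' (Sum.inl_ne_inr (a := i) (b := i'))
    rw [Nat.card_sum] at h
    omega

end Label

/-- `(α \ {a, a'}) \ {b, b'} = (α \ {b, b'}) \ {a, a'}`. -/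
def removeSwap {α : Type u} {a a' b b' : α} (hb : b ≠ a ∧ b ≠ a') (hb' : b' ≠ a ∧ b' ≠ a')
    (ha : a ≠ b ∧ a ≠ b') (ha' : a' ≠ b ∧ a' ≠ b') :
    {x : {x : α // x ≠ a ∧ x ≠ a'} // x ≠ ⟨b, hb⟩ ∧ x ≠ ⟨b', hb'⟩} ≃
      {x : {x : α // x ≠ b ∧ x ≠ b'} // x ≠ ⟨a, ha⟩ ∧ x ≠ ⟨a', ha'⟩} where
  toFun x := ⟨⟨x.1.1, fun h => x.2.1 (Subtype.ext h), fun h => x.2.2 (Subtype.ext h)⟩,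
    fun h => x.1.2.1 (congrArg Subtype.val h), fun h => x.1.2.2 (congrArg Subtype.val h)⟩
  invFun x := ⟨⟨x.1.1, fun h => x.2.1 (Subtype.ext h), fun h => x.2.2 (Subtype.ext h)⟩,
    fun h => x.1.2.1 (congrArg Subtype.val h), fun h => x.1.2.2 (congrArg Subtype.val h)⟩
  left_inv _ := rfl
  right_inv _ := rfl

namespace Relabeling

variable {L L' M M' N : Label.{u}}

theorem map_ne (s : Relabeling L L') {i i' : L.I} (hne : i ≠ i') : s i ≠ s i' :=
  fun h => hne (s.equiv.injective h)

theorem map_color (s : Relabeling L L') (t : Relabeling M M') {i : L.I} {i' : M.I}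
    (hc : L.color i = M.color i') : L'.color (s i) = M'.color (t i') := by
  rw [s.color_eq, t.color_eq, hc]

/-- The restriction `I \ {i, i'} → J \ {s i, s i'}` of `s : I → J`. -/
def loop (s : Relabeling L L') (i i' : L.I) (hne : i ≠ i') (hc : L.color i = L.color i') :
    Relabeling (L.loop i i' hne hc) (L'.loop (s i) (s i') (s.map_ne hne) (s.map_color s hc)) where
  equiv := s.equiv.subtypeEquiv fun a => by simp
  genus_eq := congrArg (· + 1) s.genus_eq
  color_eq a := s.color_eq a.1

/-- The restriction `(I ∪ I') \ {i, i'} → (J ∪ J') \ {s i, t i'}` of `s ∪ t`. -/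
def edge (s : Relabeling L L') (t : Relabeling M M') (i : L.I) (i' : M.I)
    (hc : L.color i = M.color i') :
    Relabeling (L.edge M i i' hc) (L'.edge M' (s i) (t i') (s.map_color t hc)) where
  equiv := (Equiv.sumCongr s.equiv t.equiv).subtypeEquiv fun a => by
    rcases a with a | a <;> simp
  genus_eq := congrArg₂ (· + ·) s.genus_eq t.genus_eq
  color_eq := by
    rintro ⟨a | a, ha⟩
    · exact s.color_eq a
    · exact t.color_eq a

/-- `I \ {i, i'} = I \ {i', i}`. -/
def loopSymm (L : Label.{u}) (i i' : L.I) (hne : i ≠ i') (hc : L.color i = L.color i') :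
    Relabeling (L.loop i i' hne hc) (L.loop i' i hne.symm hc.symm) where
  equiv := Equiv.subtypeEquivRight fun _ => and_comm
  genus_eq := rfl
  color_eq _ := rfl

/-- `(I ∪ I') \ {i, i'} = (I' ∪ I) \ {i', i}`. -/
def edgeSymm (L M : Label.{u}) (i : L.I) (i' : M.I) (hc : L.color i = M.color i') :
    Relabeling (L.edge M i i' hc) (M.edge L i' i hc.symm) where
  equiv := (Equiv.sumComm L.I M.I).subtypeEquiv fun a => by rcases a with a | a <;> simp
  genus_eq := add_comm _ _
  color_eq := by rintro ⟨a | a, ha⟩ <;> rfl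

/-- `(I \ {i₂, i₂'}) \ {i₁, i₁'} = (I \ {i₁, i₁'}) \ {i₂, i₂'}`. -/
def loopLoop (L : Label.{u}) (i₁ i₁' i₂ i₂' : L.I) (h₁ : i₁ ≠ i₁') (h₂ : i₂ ≠ i₂')
    (a : i₁ ≠ i₂) (b : i₁ ≠ i₂') (c : i₁' ≠ i₂) (d : i₁' ≠ i₂')
    (hc₁ : L.color i₁ = L.color i₁') (hc₂ : L.color i₂ = L.color i₂') :
    Relabeling
      ((L.loop i₂ i₂' h₂ hc₂).loop ⟨i₁, a, b⟩ ⟨i₁', c, d⟩ (fun e => h₁ (congrArg Subtype.val e)) hc₁)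
      ((L.loop i₁ i₁' h₁ hc₁).loop ⟨i₂, a.symm, c.symm⟩ ⟨i₂', b.symm, d.symm⟩
        (fun e => h₂ (congrArg Subtype.val e)) hc₂) where
  equiv := removeSwap ⟨a, b⟩ ⟨c, d⟩ ⟨a.symm, c.symm⟩ ⟨b.symm, d.symm⟩
  genus_eq := rfl
  color_eq _ := rfl

/-- `((I ∪ I') \ {i₂, i₂'}) \ {i₁, i₁'} = ((I \ {i₁, i₁'}) ∪ I') \ {i₂, i₂'}` for
`i₁, i₁', i₂ ∈ I` and `i₂' ∈ I'`. -/
def loopEdge (L M : Label.{u}) (i₁ i₁' i₂ : L.I) (i₂' : M.I) (h₁ : i₁ ≠ i₁')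
    (a : i₁ ≠ i₂) (c : i₁' ≠ i₂)
    (hc₁ : L.color i₁ = L.color i₁') (hc₂ : L.color i₂ = M.color i₂') :
    Relabeling
      ((L.edge M i₂ i₂' hc₂).loop
        ⟨Sum.inl i₁, fun e => a (Sum.inl_injective e), Sum.inl_ne_inr⟩
        ⟨Sum.inl i₁', fun e => c (Sum.inl_injective e), Sum.inl_ne_inr⟩
        (fun e => h₁ (Sum.inl_injective (congrArg Subtype.val e))) hc₁)
      ((L.loop i₁ i₁' h₁ hc₁).edge M ⟨i₂, a.symm, c.symm⟩ i₂' hc₂) where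
  equiv :=
    { toFun := fun
        | ⟨⟨Sum.inl x, p⟩, q⟩ => ⟨Sum.inl ⟨x, fun e => q.1 (Subtype.ext (congrArg Sum.inl e)),
            fun e => q.2 (Subtype.ext (congrArg Sum.inl e))⟩,
            fun e => p.1 (congrArg Sum.inl (congrArg Subtype.val (Sum.inl_injective e))),
            Sum.inl_ne_inr⟩
        | ⟨⟨Sum.inr x, p⟩, _⟩ => ⟨Sum.inr x, Sum.inr_ne_inl,
            fun e => p.2 (congrArg Sum.inr (Sum.inr_injective e))⟩
      invFun := fun
        | ⟨Sum.inl x, p⟩ => ⟨⟨Sum.inl x.1,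
            fun e => p.1 (congrArg Sum.inl (Subtype.ext (Sum.inl_injective e))), Sum.inl_ne_inr⟩,
            fun e => x.2.1 (Sum.inl_injective (congrArg Subtype.val e)),
            fun e => x.2.2 (Sum.inl_injective (congrArg Subtype.val e))⟩
        | ⟨Sum.inr x, p⟩ => ⟨⟨Sum.inr x, Sum.inr_ne_inl,
            fun e => p.2 (congrArg Sum.inr (Sum.inr_injective e))⟩,
            fun e => Sum.inr_ne_inl (congrArg Subtype.val e),
            fun e => Sum.inr_ne_inl (congrArg Subtype.val e)⟩
      left_inv := by rintro ⟨⟨x | x, p⟩, q⟩ <;> rfl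
      right_inv := by rintro ⟨x | x, p⟩ <;> rfl }
  genus_eq := Nat.add_right_comm _ _ _
  color_eq := by rintro ⟨⟨x | x, p⟩, q⟩ <;> rfl

/-- `((I ∪ I') \ {i₁, i₁'}) \ {i₂, i₂'} = ((I ∪ I') \ {i₂, i₂'}) \ {i₁, i₁'}` for
`i₁, i₂ ∈ I` and `i₁', i₂' ∈ I'`. -/
def edgeLoop (L M : Label.{u}) (i₁ i₂ : L.I) (i₁' i₂' : M.I) (a : i₁ ≠ i₂) (a' : i₁' ≠ i₂')
    (hc₁ : L.color i₁ = M.color i₁') (hc₂ : L.color i₂ = M.color i₂') :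
    Relabeling
      ((L.edge M i₁ i₁' hc₁).loop
        ⟨Sum.inl i₂, fun e => a.symm (Sum.inl_injective e), Sum.inl_ne_inr⟩
        ⟨Sum.inr i₂', Sum.inr_ne_inl, fun e => a'.symm (Sum.inr_injective e)⟩
        (fun e => Sum.inl_ne_inr (congrArg Subtype.val e)) hc₂)
      ((L.edge M i₂ i₂' hc₂).loop
        ⟨Sum.inl i₁, fun e => a (Sum.inl_injective e), Sum.inl_ne_inr⟩
        ⟨Sum.inr i₁', Sum.inr_ne_inl, fun e => a' (Sum.inr_injective e)⟩
        (fun e => Sum.inl_ne_inr (congrArg Subtype.val e)) hc₁) where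
  equiv := removeSwap _ _ _ _
  genus_eq := rfl
  color_eq _ := rfl

/-- `(((I ∪ I') \ {i₁, i₁'}) ∪ I'') \ {i₂, i₂'} = (I ∪ ((I' ∪ I'') \ {i₂, i₂'})) \ {i₁, i₁'}` for
`i₁ ∈ I`, `i₁', i₂ ∈ I'` and `i₂' ∈ I''`. -/
def edgeEdge (L M N : Label.{u}) (i₁ : L.I) (i₁' i₂ : M.I) (i₂' : N.I) (a : i₁' ≠ i₂)
    (hc₁ : L.color i₁ = M.color i₁') (hc₂ : M.color i₂ = N.color i₂') :
    Relabeling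
      ((L.edge M i₁ i₁' hc₁).edge N
        ⟨Sum.inr i₂, Sum.inr_ne_inl, fun e => a.symm (Sum.inr_injective e)⟩ i₂' hc₂)
      (L.edge (M.edge N i₂ i₂' hc₂) i₁
        ⟨Sum.inl i₁', fun e => a (Sum.inl_injective e), Sum.inl_ne_inr⟩ hc₁) where
  equiv :=
    { toFun := fun
        | ⟨Sum.inl ⟨Sum.inl x, p⟩, _⟩ =>
            ⟨Sum.inl x, fun e => p.1 (congrArg Sum.inl (Sum.inl_injective e)), Sum.inl_ne_inr⟩
        | ⟨Sum.inl ⟨Sum.inr x, p⟩, q⟩ =>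
            ⟨Sum.inr ⟨Sum.inl x,
              fun e => q.1 (congrArg Sum.inl (Subtype.ext (congrArg Sum.inr (Sum.inl_injective e)))),
              Sum.inl_ne_inr⟩, Sum.inr_ne_inl,
              fun e => p.2 (congrArg Sum.inr
                (Sum.inl_injective (congrArg Subtype.val (Sum.inr_injective e))))⟩
        | ⟨Sum.inr x, q⟩ =>
            ⟨Sum.inr ⟨Sum.inr x, Sum.inr_ne_inl,
              fun e => q.2 (congrArg Sum.inr (Sum.inr_injective e))⟩, Sum.inr_ne_inl,
              fun e => Sum.inr_ne_inl (congrArg Subtype.val (Sum.inr_injective e))⟩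
      invFun := fun
        | ⟨Sum.inl x, p⟩ =>
            ⟨Sum.inl ⟨Sum.inl x, fun e => p.1 (congrArg Sum.inl (Sum.inl_injective e)),
              Sum.inl_ne_inr⟩,
              fun e => Sum.inl_ne_inr (congrArg Subtype.val (Sum.inl_injective e)),
              Sum.inl_ne_inr⟩
        | ⟨Sum.inr ⟨Sum.inl x, p⟩, q⟩ =>
            ⟨Sum.inl ⟨Sum.inr x, Sum.inr_ne_inl,
              fun e => q.2 (congrArg Sum.inr
                (Subtype.ext (congrArg Sum.inl (Sum.inr_injective e))))⟩,
              fun e => p.1 (congrArg Sum.inl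
                (Sum.inr_injective (congrArg Subtype.val (Sum.inl_injective e)))),
              Sum.inl_ne_inr⟩
        | ⟨Sum.inr ⟨Sum.inr x, p⟩, _⟩ =>
            ⟨Sum.inr x, Sum.inr_ne_inl, fun e => p.2 (congrArg Sum.inr (Sum.inr_injective e))⟩
      left_inv := by rintro ⟨⟨x | x, p⟩ | x, q⟩ <;> rfl
      right_inv := by rintro ⟨x | ⟨x | x, p⟩, q⟩ <;> rfl }
  genus_eq := Nat.add_assoc _ _ _
  color_eq := by rintro ⟨⟨x | x, p⟩ | x, q⟩ <;> rfl

end Relabeling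

variable (C : Type w) [Category.{v} C] [MonoidalCategory C]

/-- Objects `C(g, I_NS, I_R)`, relabeling isomorphisms `c_(s_NS, s_R)`, and gluing maps: `loop`
consists of the maps `c^l_NS(i, i')` and `c^l_R(j, j')`, according to the common type of the two
elements, and `edge` of the maps `c_NS(i, i')` and `c_R(j, j')`. No relations are imposed. -/
structure GluingData where
  obj : Label.{u} → C
  relabel : ∀ {L M : Label.{u}}, Relabeling L M → (obj L ≅ obj M)
  loop : ∀ (L : Label.{u}) (i i' : L.I) (hne : i ≠ i') (hc : L.color i = L.color i'),
    obj L ⟶ obj (L.loop i i' hne hc)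
  edge : ∀ (L M : Label.{u}) (i : L.I) (i' : M.I) (hc : L.color i = M.color i'),
    obj L ⊗ obj M ⟶ obj (L.edge M i i' hc)

variable {C}

/-- The compatibility conditions. Sets which are equal in the usual notation, such as
`(I \ {i₁, i₁'}) \ {i₂, i₂'}` and `(I \ {i₂, i₂'}) \ {i₁, i₁'}`, are identified by the relabelings
along the canonical bijections. Each condition covers all combinations of the types of the
elements. -/
structure GluingData.Compatible [SymmetricCategory C] (D : GluingData.{u} C) : Prop where
  relabel_trans : ∀ {L M N : Label.{u}} (s : Relabeling L M) (t : Relabeling M N),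
    (D.relabel (s.trans t)).hom = (D.relabel s).hom ≫ (D.relabel t).hom
  loop_symm : ∀ (L : Label.{u}) (i i' : L.I) (hne : i ≠ i') (hc : L.color i = L.color i'),
    D.loop L i i' hne hc ≫ (D.relabel (Relabeling.loopSymm L i i' hne hc)).hom =
      D.loop L i' i hne.symm hc.symm
  edge_symm : ∀ (L M : Label.{u}) (i : L.I) (i' : M.I) (hc : L.color i = M.color i'),
    D.edge L M i i' hc ≫ (D.relabel (Relabeling.edgeSymm L M i i' hc)).hom =
      (β_ (D.obj L) (D.obj M)).hom ≫ D.edge M L i' i hc.symm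
  relabel_loop : ∀ {L L' : Label.{u}} (s : Relabeling L L') (i i' : L.I) (hne : i ≠ i')
    (hc : L.color i = L.color i'),
    D.loop L i i' hne hc ≫ (D.relabel (s.loop i i' hne hc)).hom =
      (D.relabel s).hom ≫ D.loop L' (s i) (s i') (s.map_ne hne) (s.map_color s hc)
  relabel_edge : ∀ {L L' M M' : Label.{u}} (s : Relabeling L L') (t : Relabeling M M')
    (i : L.I) (i' : M.I) (hc : L.color i = M.color i'),
    D.edge L M i i' hc ≫ (D.relabel (s.edge t i i' hc)).hom =
      ((D.relabel s).hom ⊗ₘ (D.relabel t).hom) ≫ D.edge L' M' (s i) (t i') (s.map_color t hc)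
  loop_loop : ∀ (L : Label.{u}) (i₁ i₁' i₂ i₂' : L.I) (h₁ : i₁ ≠ i₁') (h₂ : i₂ ≠ i₂')
    (a : i₁ ≠ i₂) (b : i₁ ≠ i₂') (c : i₁' ≠ i₂) (d : i₁' ≠ i₂')
    (hc₁ : L.color i₁ = L.color i₁') (hc₂ : L.color i₂ = L.color i₂'),
    D.loop L i₂ i₂' h₂ hc₂ ≫
        D.loop (L.loop i₂ i₂' h₂ hc₂) ⟨i₁, a, b⟩ ⟨i₁', c, d⟩
          (fun e => h₁ (congrArg Subtype.val e)) hc₁ ≫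
        (D.relabel (Relabeling.loopLoop L i₁ i₁' i₂ i₂' h₁ h₂ a b c d hc₁ hc₂)).hom =
      D.loop L i₁ i₁' h₁ hc₁ ≫
        D.loop (L.loop i₁ i₁' h₁ hc₁) ⟨i₂, a.symm, c.symm⟩ ⟨i₂', b.symm, d.symm⟩
          (fun e => h₂ (congrArg Subtype.val e)) hc₂
  loop_edge : ∀ (L M : Label.{u}) (i₁ i₁' i₂ : L.I) (i₂' : M.I) (h₁ : i₁ ≠ i₁')
    (a : i₁ ≠ i₂) (c : i₁' ≠ i₂)
    (hc₁ : L.color i₁ = L.color i₁') (hc₂ : L.color i₂ = M.color i₂'),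
    D.edge L M i₂ i₂' hc₂ ≫
        D.loop (L.edge M i₂ i₂' hc₂)
          ⟨Sum.inl i₁, fun e => a (Sum.inl_injective e), Sum.inl_ne_inr⟩
          ⟨Sum.inl i₁', fun e => c (Sum.inl_injective e), Sum.inl_ne_inr⟩
          (fun e => h₁ (Sum.inl_injective (congrArg Subtype.val e))) hc₁ ≫
        (D.relabel (Relabeling.loopEdge L M i₁ i₁' i₂ i₂' h₁ a c hc₁ hc₂)).hom =
      (D.loop L i₁ i₁' h₁ hc₁ ⊗ₘ 𝟙 (D.obj M)) ≫
        D.edge (L.loop i₁ i₁' h₁ hc₁) M ⟨i₂, a.symm, c.symm⟩ i₂' hc₂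
  edge_loop : ∀ (L M : Label.{u}) (i₁ i₂ : L.I) (i₁' i₂' : M.I) (a : i₁ ≠ i₂) (a' : i₁' ≠ i₂')
    (hc₁ : L.color i₁ = M.color i₁') (hc₂ : L.color i₂ = M.color i₂'),
    D.edge L M i₁ i₁' hc₁ ≫
        D.loop (L.edge M i₁ i₁' hc₁)
          ⟨Sum.inl i₂, fun e => a.symm (Sum.inl_injective e), Sum.inl_ne_inr⟩
          ⟨Sum.inr i₂', Sum.inr_ne_inl, fun e => a'.symm (Sum.inr_injective e)⟩
          (fun e => Sum.inl_ne_inr (congrArg Subtype.val e)) hc₂ ≫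
        (D.relabel (Relabeling.edgeLoop L M i₁ i₂ i₁' i₂' a a' hc₁ hc₂)).hom =
      D.edge L M i₂ i₂' hc₂ ≫
        D.loop (L.edge M i₂ i₂' hc₂)
          ⟨Sum.inl i₁, fun e => a (Sum.inl_injective e), Sum.inl_ne_inr⟩
          ⟨Sum.inr i₁', Sum.inr_ne_inl, fun e => a' (Sum.inr_injective e)⟩
          (fun e => Sum.inl_ne_inr (congrArg Subtype.val e)) hc₁
  edge_edge : ∀ (L M N : Label.{u}) (i₁ : L.I) (i₁' i₂ : M.I) (i₂' : N.I) (a : i₁' ≠ i₂)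
    (hc₁ : L.color i₁ = M.color i₁') (hc₂ : M.color i₂ = N.color i₂'),
    (D.edge L M i₁ i₁' hc₁ ⊗ₘ 𝟙 (D.obj N)) ≫
        D.edge (L.edge M i₁ i₁' hc₁) N
          ⟨Sum.inr i₂, Sum.inr_ne_inl, fun e => a.symm (Sum.inr_injective e)⟩ i₂' hc₂ ≫
        (D.relabel (Relabeling.edgeEdge L M N i₁ i₁' i₂ i₂' a hc₁ hc₂)).hom =
      (α_ (D.obj L) (D.obj M) (D.obj N)).hom ≫ (𝟙 (D.obj L) ⊗ₘ D.edge M N i₂ i₂' hc₂) ≫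
        D.edge L (M.edge N i₂ i₂' hc₂) i₁
          ⟨Sum.inl i₁', fun e => a (Sum.inl_injective e), Sum.inl_ne_inr⟩ hc₁

/-! ### Operads -/

/-- Graftings: morphisms which are bijective on vertices and on flags. -/
def IsGrafting {τ σ : Graph.{u}} (h : τ ⟶ σ) : Prop :=
  Function.Bijective (Hom.onV h) ∧ Function.Bijective (Hom.onF h)

/-- `h` is the contraction of the single edge of `τ` formed by the flags `f`, `f'`. -/
structure IsContraction {τ σ : Graph.{u}} (h : τ ⟶ σ) (f f' : τ.F) : Prop where
  ne : f ≠ f'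
  j_eq : τ.j f = f'
  mem_range : ∀ x, x ∈ Set.range (Hom.onF h) ↔ x ≠ f ∧ x ≠ f'
  /-- No tails are grafted. -/
  j_onF : ∀ y, Hom.onF h (σ.j y) = τ.j (Hom.onF h y)

theorem IsContraction.color {τ σ : Graph.{u}} {h : τ ⟶ σ} {f f' : τ.F} (hh : IsContraction h f f') :
    τ.color f = τ.color f' := by
  rw [← hh.j_eq, τ.color_j]

/-- The label `(g(v), F_NS, F_R)` of a graph with a single vertex `v`. -/
def Graph.label (τ : Graph.{u}) (v : τ.V) (hv : ∀ x, x = v) : Label.{u} where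
  genus := τ.genus v
  I := τ.F
  color := τ.color
  even := by
    have h := τ.even v
    simpa only [hv (τ.bd _), true_and] using h
  stable := by
    have h := τ.stable v
    rwa [Nat.card_congr (Equiv.subtypeUnivEquiv fun f => hv (τ.bd f))] at h

theorem genus_eq_of_unique {τ σ : Graph.{u}} (h : τ ⟶ σ) (w : σ.V) (hw : ∀ x, x = w) :
    2 * σ.genus w + 2 * Nat.card τ.V =
      2 * (∑ᶠ a, τ.genus a) + Nat.card {f // f ∉ Set.range (Hom.onF h)} + 2 := by
  classical
  have := Fintype.ofFinite τ.V
  have := Fintype.ofFinite τ.F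
  have e := (Hom.genus_eq_iff _ _ _ _).1 (Hom.genus_eq h w)
  rw [finsum_eq_sum_of_fintype, Nat.card_eq_fintype_card, natCard_subtype]
  simp only [hw, if_true, true_and] at e
  simp only [← Hom.ghost_eq_self]
  simpa using e

theorem natCard_pair {α : Type*} {f f' : α} (hne : f ≠ f') (s : Set α)
    (hs : ∀ x, x ∈ s ↔ x ≠ f ∧ x ≠ f') : Nat.card {x // x ∉ s} = 2 := by
  have : {x | x ∉ s} = {f, f'} := by
    ext x
    simp only [Set.mem_ofPred_eq, hs, Set.mem_insert_iff, Set.mem_singleton_iff]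
    tauto
  have h2 : Nat.card {x // x ∉ s} = Set.ncard {x | x ∉ s} := rfl
  rw [h2, this, Set.ncard_pair hne]

/-- The relabelings used for contractions of loops exist. -/
theorem exists_relabeling_loop {τ σ : Graph.{u}} (v : τ.V) (hv : ∀ x, x = v) (w : σ.V)
    (hw : ∀ x, x = w) (h : τ ⟶ σ) (f f' : τ.F) (hh : IsContraction h f f') :
    ∃ s : Relabeling ((τ.label v hv).loop f f' hh.ne hh.color) (σ.label w hw),
      ∀ i : {a : τ.F // a ≠ f ∧ a ≠ f'}, Hom.onF h (s i) = i.1 := by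
  let t : σ.F → {a : τ.F // a ≠ f ∧ a ≠ f'} :=
    fun y => ⟨Hom.onF h y, (hh.mem_range _).1 ⟨y, rfl⟩⟩
  have ht : Function.Bijective t := by
    refine ⟨fun a b e => Hom.onF_inj h (congrArg Subtype.val e), fun a => ?_⟩
    obtain ⟨y, hy⟩ := (hh.mem_range _).2 a.2
    exact ⟨y, Subtype.ext hy⟩
  have key : ∀ i, t ((Equiv.ofBijective t ht).symm i) = i :=
    (Equiv.ofBijective t ht).apply_symm_apply
  refine ⟨⟨(Equiv.ofBijective t ht).symm, ?_, fun i => ?_⟩, fun i => congrArg Subtype.val (key i)⟩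
  · have e := genus_eq_of_unique h w hw
    have : Unique τ.V := ⟨⟨v⟩, hv⟩
    rw [natCard_pair hh.ne _ hh.mem_range, Nat.card_unique, finsum_unique] at e
    have hd : (default : τ.V) = v := hv _
    rw [hd] at e
    change τ.genus v + 1 = σ.genus w
    omega
  · exact (Hom.color_onF h _).symm.trans (congrArg τ.color (congrArg Subtype.val (key i)))

/-- The relabelings used for isomorphisms exist. -/
theorem exists_relabeling_iso {τ σ : Graph.{u}} (v : τ.V) (hv : ∀ x, x = v) (w : σ.V)
    (hw : ∀ x, x = w) (h : τ ≅ σ) :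
    ∃ s : Relabeling (τ.label v hv) (σ.label w hw), ∀ i : τ.F, Hom.onF h.hom (s i) = i := by
  have hF : ∀ x, Hom.onF h.hom (Hom.onF h.inv x) = x :=
    fun x => congrFun (congrArg Hom.onF h.hom_inv_id) x
  have hF' : ∀ x, Hom.onF h.inv (Hom.onF h.hom x) = x :=
    fun x => congrFun (congrArg Hom.onF h.inv_hom_id) x
  refine ⟨⟨⟨Hom.onF h.inv, Hom.onF h.hom, hF, hF'⟩, ?_, fun i => Hom.color_onF h.inv i⟩, hF⟩
  have e := genus_eq_of_unique h.hom w hw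
  have : Unique τ.V := ⟨⟨v⟩, hv⟩
  have : IsEmpty {f // f ∉ Set.range (Hom.onF h.hom)} := ⟨fun x => x.2 ⟨_, hF x.1⟩⟩
  rw [Nat.card_unique, finsum_unique, Nat.card_of_isEmpty] at e
  have hd : (default : τ.V) = v := hv _
  rw [hd] at e
  change τ.genus v = σ.genus w
  omega

/-- The relabelings used for contractions of edges between two corollas exist. -/
theorem exists_relabeling_edge {τ₁ τ₂ τ σ : Graph.{u}} (v₁ : τ₁.V) (hv₁ : ∀ x, x = v₁) (v₂ : τ₂.V)
    (hv₂ : ∀ x, x = v₂) (w : σ.V) (hw : ∀ x, x = w) (gr : τ₁ ⊗ τ₂ ⟶ τ) (hgr : IsGrafting gr)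
    (h : τ ⟶ σ) (x x' : τ.F) (hh : IsContraction h x x') (f : τ₁.F) (f' : τ₂.F)
    (hf : Hom.onF gr x = Sum.inl f) (hf' : Hom.onF gr x' = Sum.inr f')
    (hc : τ₁.color f = τ₂.color f') :
    ∃ s : Relabeling ((τ₁.label v₁ hv₁).edge (τ₂.label v₂ hv₂) f f' hc) (σ.label w hw),
      ∀ i : {a : τ₁.F ⊕ τ₂.F // a ≠ Sum.inl f ∧ a ≠ Sum.inr f'},
        Hom.onF gr (Hom.onF h (s i)) = i.1 := by
  have hr : ∀ a : τ₁.F ⊕ τ₂.F, a ∈ Set.range (fun y => Hom.onF gr (Hom.onF h y)) ↔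
      a ≠ Sum.inl f ∧ a ≠ Sum.inr f' := by
    intro a
    obtain ⟨b, rfl⟩ := hgr.2.2 a
    rw [← hf, ← hf']
    refine Iff.trans ?_ ((hh.mem_range b).trans
      (and_congr hgr.2.1.ne_iff.symm hgr.2.1.ne_iff.symm))
    exact ⟨fun ⟨y, hy⟩ => ⟨y, hgr.2.1 hy⟩, fun ⟨y, hy⟩ => ⟨y, congrArg _ hy⟩⟩
  let t : σ.F → {a : τ₁.F ⊕ τ₂.F // a ≠ Sum.inl f ∧ a ≠ Sum.inr f'} :=
    fun y => ⟨Hom.onF gr (Hom.onF h y), (hr _).1 ⟨y, rfl⟩⟩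
  have ht : Function.Bijective t := by
    refine ⟨fun a b e => Hom.onF_inj h (Hom.onF_inj gr (congrArg Subtype.val e)), fun a => ?_⟩
    obtain ⟨y, hy⟩ := (hr _).2 a.2
    exact ⟨y, Subtype.ext hy⟩
  have key : ∀ i, t ((Equiv.ofBijective t ht).symm i) = i :=
    (Equiv.ofBijective t ht).apply_symm_apply
  refine ⟨⟨(Equiv.ofBijective t ht).symm, ?_, fun i => ?_⟩, fun i => congrArg Subtype.val (key i)⟩
  · have e := genus_eq_of_unique (gr ≫ h) w hw
    have : Unique τ₁.V := ⟨⟨v₁⟩, hv₁⟩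
    have : Unique τ₂.V := ⟨⟨v₂⟩, hv₂⟩
    have e1 : Nat.card (τ₁ ⊗ τ₂).V = 2 := by
      change Nat.card (τ₁.V ⊕ τ₂.V) = 2
      rw [Nat.card_sum, Nat.card_unique, Nat.card_unique]
    have e2 : ∑ᶠ a, (τ₁ ⊗ τ₂).genus a = τ₁.genus v₁ + τ₂.genus v₂ := by
      change ∑ᶠ a : τ₁.V ⊕ τ₂.V, Sum.elim τ₁.genus τ₂.genus a = _
      have := Fintype.ofFinite τ₁.V
      have := Fintype.ofFinite τ₂.V
      rw [finsum_eq_sum_of_fintype, Fintype.sum_sum_type]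
      simp [hv₁ default, hv₂ default]
    have e3 := natCard_pair (Sum.inl_ne_inr (a := f) (b := f'))
      (Set.range (fun y => Hom.onF gr (Hom.onF h y))) hr
    have e4 := e.trans (congrArg₂ (fun a b => 2 * a + b + 2) e2 e3)
    rw [e1] at e4
    change τ₁.genus v₁ + τ₂.genus v₂ = σ.genus w
    omega
  · exact ((Hom.color_onF gr _).trans (Hom.color_onF h _)).symm.trans
      (congrArg (Sum.elim τ₁.color τ₂.color) (congrArg Subtype.val (key i)))

variable (C) in
/-- SUSY operads: symmetric monoidal functors on stable SUSY graphs which send graftings to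
isomorphisms. -/
structure SUSYOperad [SymmetricCategory C] where
  functor : Graph.{u} ⥤ C
  [braided : functor.Braided]
  isIso_map : ∀ {τ σ : Graph.{u}} (h : τ ⟶ σ), IsGrafting h → IsIso (functor.map h)

attribute [instance] SUSYOperad.braided

/-- The operad `O` takes the values prescribed by the gluing data `D`. Here `v`, `hv` and the like
express that a graph has the single vertex `v`. -/
structure SUSYOperad.Extends [SymmetricCategory C] (O : SUSYOperad.{u} C) (D : GluingData.{u} C) :
    Prop where
  obj_corolla : ∀ (τ : Graph.{u}) (v : τ.V) (hv : ∀ x, x = v),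
    O.functor.obj τ = D.obj (τ.label v hv)
  /-- An isomorphism `h` of corollas is sent to the relabeling along `s`, the inverse of the map of
  flags of `h`. -/
  map_iso : ∀ {τ σ : Graph.{u}} (v : τ.V) (hv : ∀ x, x = v) (w : σ.V) (hw : ∀ x, x = w)
    (h : τ ≅ σ) (s : Relabeling (τ.label v hv) (σ.label w hw)),
    (∀ i : τ.F, Hom.onF h.hom (s i) = i) →
    O.functor.map h.hom = eqToHom (obj_corolla τ v hv) ≫ (D.relabel s).hom ≫
      eqToHom (obj_corolla σ w hw).symm
  /-- A morphism which is the identity on vertices and on flags is sent to the identity. -/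
  map_grafting : ∀ (X : FlagData.{u}) (j j' : X.F → X.F) (hj : ∀ f, j (j f) = f)
    (hj' : ∀ f, j' (j' f) = f) (hc : ∀ f, X.color (j f) = X.color f)
    (hc' : ∀ f, X.color (j' f) = X.color f) (h : Graph.mk X j hj hc ⟶ Graph.mk X j' hj' hc'),
    Hom.onV h = id → Hom.onF h = id →
    ∃ e : O.functor.obj (Graph.mk X j hj hc) = O.functor.obj (Graph.mk X j' hj' hc'),
      O.functor.map h = eqToHom e
  /-- The contraction of a loop, formed by `f` and `f'`, of a graph with a single vertex is sent to
  the loop gluing map. The relabeling along `s`, the inverse of the map of flags of `h`, identifies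
  `τ.F \ {f, f'}` with the flags of `σ`. -/
  map_loop : ∀ {τ σ : Graph.{u}} (v : τ.V) (hv : ∀ x, x = v) (w : σ.V) (hw : ∀ x, x = w)
    (h : τ ⟶ σ) (f f' : τ.F) (hh : IsContraction h f f')
    (s : Relabeling ((τ.label v hv).loop f f' hh.ne hh.color) (σ.label w hw)),
    (∀ i : {a : τ.F // a ≠ f ∧ a ≠ f'}, Hom.onF h (s i) = i.1) →
    O.functor.map h = eqToHom (obj_corolla τ v hv) ≫
      D.loop (τ.label v hv) f f' hh.ne hh.color ≫ (D.relabel s).hom ≫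
      eqToHom (obj_corolla σ w hw).symm
  /-- Let `τ` arise from corollas `τ₁` and `τ₂` by the grafting `gr`, such that the flags
  `f` of `τ₁` and `f'` of `τ₂` form an edge of `τ`. The contraction of this edge is sent
  to the edge gluing map. The relabeling along `s`, the inverse of the map of flags, identifies
  `(τ₁.F ∪ τ₂.F) \ {f, f'}` with the flags of `σ`. -/
  map_edge : ∀ {τ₁ τ₂ τ σ : Graph.{u}} (v₁ : τ₁.V) (hv₁ : ∀ x, x = v₁) (v₂ : τ₂.V)
    (hv₂ : ∀ x, x = v₂) (w : σ.V) (hw : ∀ x, x = w) (gr : τ₁ ⊗ τ₂ ⟶ τ) (_ : IsGrafting gr)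
    (h : τ ⟶ σ) (x x' : τ.F) (_ : IsContraction h x x') (f : τ₁.F) (f' : τ₂.F)
    (_ : Hom.onF gr x = Sum.inl f) (_ : Hom.onF gr x' = Sum.inr f')
    (hc : τ₁.color f = τ₂.color f')
    (s : Relabeling ((τ₁.label v₁ hv₁).edge (τ₂.label v₂ hv₂) f f' hc) (σ.label w hw)),
    (∀ i : {a : τ₁.F ⊕ τ₂.F // a ≠ Sum.inl f ∧ a ≠ Sum.inr f'},
      Hom.onF gr (Hom.onF h (s i)) = i.1) →
    Functor.LaxMonoidal.μ O.functor τ₁ τ₂ ≫ O.functor.map gr ≫ O.functor.map h =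
      (eqToHom (obj_corolla τ₁ v₁ hv₁) ⊗ₘ eqToHom (obj_corolla τ₂ v₂ hv₂)) ≫
      D.edge (τ₁.label v₁ hv₁) (τ₂.label v₂ hv₂) f f' hc ≫ (D.relabel s).hom ≫
      eqToHom (obj_corolla σ w hw).symm

end SUSY

namespace SUSY

/-! ### Corollas and the tautological gluing data -/

/-! The gluing data have a universal model. In the category of graphs itself, corollas with
relabelings and virtual contractions of pairs of tails form gluing data `tautological`, and these
satisfy every relation (`tautological_compatible`). An operad extending `D` transports this model
into `C`; conversely, compatible `D` should assign a value in `C` to every morphism of graphs that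
is built from the model. The whole problem is that this value be independent of the way the morphism
is built.

Sufficiency. A disjoint union of corollas is a formal tensor product of labels (`LabelTree`), and
symmetries, associators, unitors and relabelings generate formal `Word`s. Coherence says that every
isomorphism between disjoint unions of corollas comes from a word (`Word.exists_hom_eq`), and that
its value in `C` depends only on the isomorphism (`Word.eval_eq`). An arbitrary morphism between
disjoint unions of corollas is a `Chain` of words and elementary contractions
(`Chain.exists_chain`), because a morphism factors through the contraction of any pair that it
contracts (`exists_factor`). The value of a chain depends only on the graph morphism
(`Chain.unique`), by a diamond argument. A single contraction has a well-defined value by the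
symmetry and relabeling relations (`Chain.one_unique`). Two disjoint pairs of flags can be
contracted in either order (`DisjointPairs.diamond`): according to how the four flags are
distributed over vertices this is one of the four commutation relations, or the interchange law of
the tensor product. Induction on the length of the chain finishes the argument; the length itself is
fixed by the number of flags.

So `value` is functorial and monoidal on disjoint unions of corollas. It extends to all graphs
because each graph receives a grafting from the disjoint union of the corollas of its vertices, and
morphisms out of a graph without edges lift along this grafting (`Presentation.lift_hom`). This
gives `operad`, with the prescribed values by `operad_extends`.

Necessity. If `O` extends `D`, its monoidal structure provides isomorphisms from the value of a
formal tensor product in `C` to the value of `O` on the disjoint union of corollas, and these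
intertwine values of chains with values of `O` (`SUSYOperad.Extends.comparison_chain`). Chains with
the same graph morphism therefore have the same value, so each tautological relation implies the
corresponding relation for `D` (`SUSYOperad.Extends.compatible`).

Uniqueness. The same comparison followed by the image of the grafting, which `O` inverts, is a
monoidal isomorphism from `operad` to any other extension (`SUSYOperad.Extends.operadIso`). It is
the only one, since a monoidal transformation is determined on corollas, then on their disjoint
unions, and then along graftings (`SUSYOperad.Extends.hom_ext_corolla`). -/

/-- The corolla with a given label. -/
abbrev corolla (L : Label.{u}) : Graph.{u} where
  V := PUnit
  F := L.I
  bd _ := PUnit.unit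
  genus _ := L.genus
  color := L.color
  even _ := by simpa using L.even
  stable _ := by
    have h := L.stable
    rwa [← Nat.card_congr (Equiv.subtypeUnivEquiv (p := fun _ : L.I => PUnit.unit = _)
      fun _ => rfl)] at h
  j := id
  j_j _ := rfl
  color_j _ := rfl

theorem finsum_subtype_true {α : Type*} {p : α → Prop} (hp : ∀ a, p a) (f : α → ℕ) :
    ∑ᶠ a : {a // p a}, f a.1 = ∑ᶠ a, f a :=
  finsum_eq_of_bijective (Equiv.subtypeUnivEquiv hp) (Equiv.subtypeUnivEquiv hp).bijective
    fun _ => rfl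

open scoped Classical in
/-- The involution exchanging two elements. -/
noncomputable def pairSwap {α : Type*} (i i' a : α) : α := Equiv.swap i i' a

section pairSwap

variable {α : Type*} {i i' : α}

theorem pairSwap_left (i i' : α) : pairSwap i i' i = i' := by
  classical exact Equiv.swap_apply_left _ _

theorem pairSwap_right (i i' : α) : pairSwap i i' i' = i := by
  classical exact Equiv.swap_apply_right _ _

theorem pairSwap_of_ne {a : α} (h : a ≠ i) (h' : a ≠ i') : pairSwap i i' a = a := by
  classical exact Equiv.swap_apply_of_ne_of_ne h h'

theorem pairSwap_pairSwap (i i' a : α) : pairSwap i i' (pairSwap i i' a) = a := by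
  simp [pairSwap]

theorem apply_pairSwap {β : Type*} (p : α → β) (h : p i = p i') (a : α) :
    p (pairSwap i i' a) = p a := by
  by_cases h1 : a = i
  · rw [h1, pairSwap_left, h]
  by_cases h2 : a = i'
  · rw [h2, pairSwap_right, h]
  rw [pairSwap_of_ne h1 h2]

theorem pairSwap_eq_self_iff (hne : i ≠ i') (a : α) :
    pairSwap i i' a = a ↔ a ≠ i ∧ a ≠ i' := by
  by_cases h1 : a = i
  · rw [h1, pairSwap_left]; simp [hne.symm]
  by_cases h2 : a = i'
  · rw [h2, pairSwap_right]; simp [hne]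
  simp [pairSwap_of_ne h1 h2, h1, h2]

end pairSwap

/-- The morphism to a graph with a single vertex which contracts a single pair of tails. -/
noncomputable def pairHom (τ σ : Graph.{u}) (hτ : ∀ f, τ.j f = f) (w : σ.V)
    (hw : ∀ x, x = w) (i i' : τ.F) (hne : i ≠ i') (hc : τ.color i = τ.color i')
    (hV : ∀ a, a = τ.bd i ∨ a = τ.bd i') (k : σ.F → τ.F) (hk : Function.Injective k)
    (hr : ∀ a, a ∈ Set.range k ↔ a ≠ i ∧ a ≠ i') (hck : ∀ f, τ.color (k f) = σ.color f)
    (hg : σ.genus w + Nat.card τ.V = (∑ᶠ a, τ.genus a) + 2) : τ ⟶ σ :=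
  show Hom τ σ from
  { onV := fun _ => w
    onF := k
    ghost := pairSwap i i'
    onV_surj := fun x => ⟨τ.bd i, (hw x).symm⟩
    onF_inj := hk
    ghost_ghost := pairSwap_pairSwap i i'
    ghost_eq_self := fun f => (pairSwap_eq_self_iff hne f).trans (hr f).symm
    bd_onF := fun _ => (hw _).symm
    bd_ghost := fun _ => rfl
    ghost_edge := fun f h => absurd (hτ f) h
    onF_edge := fun f h => absurd (hτ _) h
    color_onF := hck
    color_ghost := apply_pairSwap τ.color hc
    connected := fun a b _ => by
      -- By `hV` each end of the path is one of the vertices of `i` and `i'`; `key` replaces the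
      -- ends by these, and at most one contracted pair has to be crossed.
      have key : ∀ x y, Relation.ReflTransGen
          (fun a b => ∃ f, τ.bd f = a ∧ τ.bd (pairSwap i i' f) = b) x y →
          a = x → b = y → Relation.ReflTransGen
          (fun a b => ∃ f, τ.bd f = a ∧ τ.bd (pairSwap i i' f) = b) a b := by
        rintro x y h rfl rfl; exact h
      rcases hV a with h | h <;> rcases hV b with h' | h' <;> refine key _ _ ?_ h h'
      · exact .refl
      · exact .single ⟨i, rfl, congrArg τ.bd (pairSwap_left i i')⟩
      · exact .single ⟨i', rfl, congrArg τ.bd (pairSwap_right i i')⟩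
      · exact .refl
    genus_eq := fun v => by
      -- Two moved flags form one contracted pair, and the fibre over the only vertex is everything,
      -- so the doubled genus equation is twice `hg`.
      have e : Nat.card {f // w = v ∧ pairSwap i i' f ≠ f} = 2 := by
        rw [← natCard_pair hne {x | x ≠ i ∧ x ≠ i'} fun x => Iff.rfl]
        refine Nat.card_congr (Equiv.subtypeEquivRight fun x => ?_)
        rw [ne_eq, pairSwap_eq_self_iff hne]
        exact ⟨fun h => h.2, fun h => ⟨(hw v).symm, h⟩⟩
      rw [e, finsum_subtype_true (fun _ => (hw v).symm),
        Nat.card_congr (Equiv.subtypeUnivEquiv fun _ => (hw v).symm), hw v]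
      omega }

/-- The virtual contraction of a pair of tails of a corolla. -/
noncomputable def loopHom (L : Label.{u}) (i i' : L.I) (hne : i ≠ i')
    (hc : L.color i = L.color i') : corolla L ⟶ corolla (L.loop i i' hne hc) :=
  pairHom (corolla L) (corolla (L.loop i i' hne hc)) (fun _ => rfl) PUnit.unit
    (fun _ => rfl) i i' hne hc (fun _ => Or.inl rfl) Subtype.val Subtype.val_injective
    (fun a => ⟨fun ⟨y, hy⟩ => hy ▸ y.2, fun h => ⟨⟨a, h⟩, rfl⟩⟩) (fun _ => rfl) (by
      have e1 : Nat.card (corolla L).V = 1 := Nat.card_unique (α := PUnit.{u + 1})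
      have e2 : ∑ᶠ a, (corolla L).genus a = L.genus := finsum_unique (α := PUnit.{u + 1}) _
      rw [e1, e2]; rfl)

/-- The virtual contraction of a pair of tails of two corollas. -/
noncomputable def edgeHom (L M : Label.{u}) (i : L.I) (i' : M.I) (hc : L.color i = M.color i') :
    corolla L ⊗ corolla M ⟶ corolla (L.edge M i i' hc) :=
  pairHom ((corolla L).sum (corolla M)) (corolla (L.edge M i i' hc))
    (by rintro (f | f) <;> rfl) PUnit.unit
    (fun _ => rfl) (Sum.inl i) (Sum.inr i') Sum.inl_ne_inr hc
    (by rintro (a | a); exacts [Or.inl rfl, Or.inr rfl]) Subtype.val Subtype.val_injective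
    (fun a => ⟨fun ⟨y, hy⟩ => hy ▸ y.2, fun h => ⟨⟨a, h⟩, rfl⟩⟩) (fun _ => rfl) (by
      have e1 : Nat.card ((corolla L).sum (corolla M)).V = 2 := by
        change Nat.card (PUnit ⊕ PUnit) = 2
        rw [Nat.card_sum, Nat.card_unique]
      have e2 : ∑ᶠ a, ((corolla L).sum (corolla M)).genus a = L.genus + M.genus := by
        change ∑ᶠ a : PUnit ⊕ PUnit, Sum.elim (fun _ => L.genus) (fun _ => M.genus) a = _
        rw [finsum_eq_sum_of_fintype, Fintype.sum_sum_type]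
        simp
      rw [e1, e2]; rfl)

/-- The isomorphism of corollas given by a relabeling. -/
def relabelIso {L M : Label.{u}} (s : Relabeling L M) : corolla L ≅ corolla M :=
  isoOfEquiv (Equiv.refl _) s.equiv.symm (fun _ => rfl) (fun _ => s.genus_eq.symm)
    (fun f => (s.color_eq _).symm.trans (congrArg M.color (s.equiv.apply_symm_apply f)))
    (fun _ => rfl)

/-- The tautological gluing data in the category of graphs. -/
noncomputable abbrev tautological : GluingData Graph.{u} where
  obj := corolla
  relabel := relabelIso
  loop := loopHom
  edge := edgeHom

/-- The involution of a morphism is the identity on surviving flags, so only contracted flags need a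
comparison. -/
theorem hom_ext_ghost {τ σ : Graph.{u}} {h k : τ ⟶ σ} (hV : ∀ v, Hom.onV h v = Hom.onV k v)
    (hF : ∀ f, Hom.onF h f = Hom.onF k f)
    (hg : ∀ f, f ∉ Set.range (Hom.onF h) → Hom.ghost h f = Hom.ghost k f) : h = k := by
  refine hom_ext hV hF fun f => ?_
  by_cases hf : f ∈ Set.range (Hom.onF h)
  · obtain ⟨y, rfl⟩ := hf
    rw [Hom.ghost_onF, hF, Hom.ghost_onF]
  · exact hg f hf

theorem ghost_loopHom {L : Label.{u}} {i i' : L.I} (hne : i ≠ i') (hc : L.color i = L.color i') :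
    Hom.ghost (loopHom L i i' hne hc) i = i' ∧ Hom.ghost (loopHom L i i' hne hc) i' = i :=
  ⟨pairSwap_left _ _, pairSwap_right _ _⟩

theorem ghost_edgeHom {L M : Label.{u}} {i : L.I} {i' : M.I} (hc : L.color i = M.color i') :
    Hom.ghost (edgeHom L M i i' hc) (Sum.inl i) = Sum.inr i' ∧
      Hom.ghost (edgeHom L M i i' hc) (Sum.inr i') = Sum.inl i :=
  ⟨pairSwap_left _ _, pairSwap_right _ _⟩

/-- A composition does not change the contractions of the first morphism. -/
theorem ghost_comp_of_ne {τ σ ρ : Graph.{u}} (h : τ ⟶ σ) (k : σ ⟶ ρ) {f f' : τ.F}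
    (hf : Hom.ghost h f = f') (hne : f' ≠ f) : Hom.ghost (h ≫ k) f = f' := by
  rw [ghost_comp_of_notMem, hf]
  rw [← Hom.ghost_eq_self, hf]
  exact hne

/-- Contractions of the second morphism of a composition. -/
theorem ghost_comp_onF' {τ σ ρ : Graph.{u}} (h : τ ⟶ σ) (k : σ ⟶ ρ) {f f' : σ.F} {x x' : τ.F}
    (hf : Hom.ghost k f = f') (hx : Hom.onF h f = x) (hx' : Hom.onF h f' = x') :
    Hom.ghost (h ≫ k) x = x' := by
  rw [← hx, ghost_comp_onF, hf, hx']

theorem ghost_symm {τ σ : Graph.{u}} (h : τ ⟶ σ) {f f' : τ.F} (hf : Hom.ghost h f = f') :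
    Hom.ghost h f' = f := by
  rw [← hf, Hom.ghost_ghost]

theorem corolla_hom_ext {τ : Graph.{u}} {M : Label.{u}} {h k : τ ⟶ corolla M}
    (hF : ∀ f, Hom.onF h f = Hom.onF k f)
    (hg : ∀ f, f ∉ Set.range (Hom.onF h) → Hom.ghost h f = Hom.ghost k f) : h = k :=
  hom_ext_ghost (fun _ => rfl) hF hg

/-- Involutions that agree at one flag of a pair agree at the other. -/
theorem ghost_eq_of_pair {τ σ σ' : Graph.{u}} {h : τ ⟶ σ} {k : τ ⟶ σ'} {x x' f : τ.F}
    (e : Hom.ghost h x = x') (e' : Hom.ghost k x = x') (hf : f = x ∨ f = x') :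
    Hom.ghost h f = Hom.ghost k f := by
  rcases hf with rfl | rfl
  · rw [e, e']
  · rw [ghost_symm h e, ghost_symm k e']

theorem ghost_tensor_inl {τ τ' σ σ' : Graph.{u}} (h : τ ⟶ τ') (k : σ ⟶ σ') {f f' : τ.F}
    (e : Hom.ghost h f = f') : Hom.ghost (h ⊗ₘ k) (Sum.inl f) = Sum.inl f' :=
  congrArg Sum.inl e

theorem ghost_tensor_inr {τ τ' σ σ' : Graph.{u}} (h : τ ⟶ τ') (k : σ ⟶ σ') {f f' : σ.F}
    (e : Hom.ghost k f = f') : Hom.ghost (h ⊗ₘ k) (Sum.inr f) = Sum.inr f' :=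
  congrArg Sum.inr e

/-- A morphism to a corolla is determined by its injection of flags and its contracted pairs. In
each relation the injections agree along the canonical bijection, and both sides contract the same
pairs, only in a different order. These identities are used in both directions: to recognise equal
graph morphisms when building the operad, and as the source of the relations for gluing data that
come from an operad. -/
theorem tautological_compatible : tautological.{u}.Compatible where
  relabel_trans s t := corolla_hom_ext (fun _ => rfl) fun f hf =>
    absurd ⟨_, (s.trans t).equiv.symm_apply_apply f⟩ hf
  loop_symm L i i' hne hc := by
    refine corolla_hom_ext (fun _ => rfl) fun f hf => ?_
    refine ghost_eq_of_pair (x := i) (x' := i')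
      ?_ (ghost_loopHom hne.symm hc.symm).2 ?_
    · exact ghost_comp_of_ne _ _ (ghost_loopHom hne hc).1 hne.symm
    by_contra! hn
    exact hf ⟨⟨f, hn.2, hn.1⟩, rfl⟩
  edge_symm L M i i' hc := by
    refine corolla_hom_ext ?_ fun f hf => ?_
    · rintro ⟨f | f, hf⟩ <;> rfl
    refine ghost_eq_of_pair (x := Sum.inl i) (x' := Sum.inr i')
      ?_ (ghost_comp_onF' _ _ (ghost_edgeHom hc.symm).2 rfl rfl) ?_
    · exact ghost_comp_of_ne _ _ (ghost_edgeHom hc).1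
        Sum.inr_ne_inl
    by_contra! hn
    exact hf ⟨(Relabeling.edgeSymm L M i i' hc).equiv ⟨f, hn⟩, congrArg Subtype.val
      ((Relabeling.edgeSymm L M i i' hc).equiv.symm_apply_apply _)⟩
  relabel_loop {L L'} s i i' hne hc := by
    refine corolla_hom_ext (fun _ => rfl) fun f hf => ?_
    refine ghost_eq_of_pair (x := i) (x' := i')
      ?_ ?_ ?_
    · exact ghost_comp_of_ne _ _ (ghost_loopHom hne hc).1 hne.symm
    · exact ghost_comp_onF' _ _
        (ghost_loopHom (s.map_ne hne) (s.map_color s hc)).1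
        (s.equiv.symm_apply_apply i) (s.equiv.symm_apply_apply i')
    by_contra! hn
    exact hf ⟨(s.loop i i' hne hc).equiv ⟨f, hn⟩,
      congrArg Subtype.val ((s.loop i i' hne hc).equiv.symm_apply_apply _)⟩
  relabel_edge {L L' M M'} s t i i' hc := by
    refine corolla_hom_ext ?_ fun f hf => ?_
    · rintro ⟨f | f, hf⟩ <;> rfl
    refine ghost_eq_of_pair (x := Sum.inl i) (x' := Sum.inr i')
      ?_ ?_ ?_
    · exact ghost_comp_of_ne _ _ (ghost_edgeHom hc).1
        Sum.inr_ne_inl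
    · exact ghost_comp_onF' _ _
        (ghost_edgeHom (s.map_color t hc)).1
        (congrArg Sum.inl (s.equiv.symm_apply_apply i))
        (congrArg Sum.inr (t.equiv.symm_apply_apply i'))
    by_contra! hn
    exact hf ⟨(s.edge t i i' hc).equiv ⟨f, hn⟩,
      congrArg Subtype.val ((s.edge t i i' hc).equiv.symm_apply_apply _)⟩
  loop_loop L i₁ i₁' i₂ i₂' h₁ h₂ a b c d hc₁ hc₂ := by
    refine corolla_hom_ext (fun _ => rfl) fun f hf => ?_
    -- This pair is contracted by the second gluing on the left and by the first one on the right;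
    -- for the other pair it is the reverse.
    by_cases hf₁ : f = i₁ ∨ f = i₁'
    · refine ghost_eq_of_pair (ghost_comp_onF' _ _ (ghost_comp_of_ne _ _ (ghost_loopHom _ _).1 ?_)
        rfl rfl) (ghost_comp_of_ne _ _ (ghost_loopHom h₁ hc₁).1 h₁.symm) hf₁
      exact fun e => h₁.symm (congrArg Subtype.val e)
    refine ghost_eq_of_pair (ghost_comp_of_ne _ _ (ghost_loopHom h₂ hc₂).1 h₂.symm)
      (ghost_comp_onF' _ _ (ghost_loopHom _ _).1 rfl rfl) ?_
    by_contra! hn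
    push Not at hf₁
    exact hf ⟨⟨⟨f, hf₁⟩, fun e => hn.1 (congrArg Subtype.val e),
      fun e => hn.2 (congrArg Subtype.val e)⟩, rfl⟩
  loop_edge L M i₁ i₁' i₂ i₂' h₁ a c hc₁ hc₂ := by
    refine corolla_hom_ext ?_ fun f hf => ?_
    · rintro ⟨f | f, hf⟩ <;> rfl
    by_cases hf₁ : f = Sum.inl i₁ ∨ f = Sum.inl i₁'
    · refine ghost_eq_of_pair (ghost_comp_onF' _ _ (ghost_comp_of_ne _ _ (ghost_loopHom _ _).1 ?_)
        rfl rfl) (ghost_comp_of_ne _ _ (ghost_tensor_inl _ _ (ghost_loopHom h₁ hc₁).1) ?_) hf₁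
      · exact fun e => h₁.symm (Sum.inl_injective (congrArg Subtype.val e))
      · exact fun e => h₁.symm (Sum.inl_injective e)
    refine ghost_eq_of_pair (ghost_comp_of_ne _ _ (ghost_edgeHom hc₂).1 Sum.inr_ne_inl)
      (ghost_comp_onF' _ _ (ghost_edgeHom _).1 rfl rfl) ?_
    by_contra! hn
    push Not at hf₁
    exact hf ⟨(Relabeling.loopEdge L M i₁ i₁' i₂ i₂' h₁ a c hc₁ hc₂).equiv
      ⟨⟨f, hn⟩, fun e => hf₁.1 (congrArg Subtype.val e), fun e => hf₁.2 (congrArg Subtype.val e)⟩,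
      congrArg (fun x => x.1.1) ((Relabeling.loopEdge L M i₁ i₁' i₂ i₂' h₁ a c hc₁
        hc₂).equiv.symm_apply_apply _)⟩
  edge_loop L M i₁ i₂ i₁' i₂' a a' hc₁ hc₂ := by
    refine corolla_hom_ext (fun _ => rfl) fun f hf => ?_
    by_cases hf₁ : f = Sum.inl i₁ ∨ f = Sum.inr i₁'
    · exact ghost_eq_of_pair (ghost_comp_of_ne _ _ (ghost_edgeHom hc₁).1 Sum.inr_ne_inl)
        (ghost_comp_onF' _ _ (ghost_loopHom _ _).1 rfl rfl) hf₁
    refine ghost_eq_of_pair (ghost_comp_onF' _ _ (ghost_comp_of_ne _ _ (ghost_loopHom _ _).1 ?_)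
        rfl rfl) (ghost_comp_of_ne _ _ (ghost_edgeHom hc₂).1 Sum.inr_ne_inl) ?_
    · exact fun e => Sum.inr_ne_inl (congrArg Subtype.val e)
    by_contra! hn
    push Not at hf₁
    exact hf ⟨⟨⟨f, hn⟩, fun e => hf₁.1 (congrArg Subtype.val e),
      fun e => hf₁.2 (congrArg Subtype.val e)⟩, rfl⟩
  edge_edge L M N i₁ i₁' i₂ i₂' a hc₁ hc₂ := by
    refine corolla_hom_ext ?_ fun f hf => ?_
    · rintro ⟨f | f, hf⟩
      · rfl
      · rcases f with ⟨f | f, hf⟩ <;> rfl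
    by_cases hf₁ : f = Sum.inl (Sum.inl i₁) ∨ f = Sum.inl (Sum.inr i₁')
    · refine ghost_eq_of_pair
        (ghost_comp_of_ne _ _ (ghost_tensor_inl _ _ (ghost_edgeHom hc₁).1) ?_)
        (ghost_comp_onF' _ _ (ghost_comp_onF' _ _ (ghost_edgeHom _).1 rfl rfl) rfl rfl) hf₁
      exact fun e => Sum.inr_ne_inl (Sum.inl_injective e)
    refine ghost_eq_of_pair (x := Sum.inl (Sum.inr i₂)) (x' := Sum.inr i₂')
      (ghost_comp_onF' _ _ (ghost_comp_of_ne _ _ (ghost_edgeHom _).1 ?_) rfl rfl)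
      (ghost_comp_onF' _ _ (ghost_comp_of_ne _ _
        (ghost_tensor_inr _ _ (ghost_edgeHom hc₂).1) ?_)
        rfl rfl) ?_
    · exact Sum.inr_ne_inl
    · exact fun e => Sum.inr_ne_inl (Sum.inr_injective e)
    by_contra! hn
    push Not at hf₁
    -- A preimage of `f` is built summand by summand, because only the left summand carries an inner
    -- subtype.
    have key : ∃ y : ((L.edge M i₁ i₁' hc₁).edge N
        ⟨Sum.inr i₂, Sum.inr_ne_inl, fun e => a.symm (Sum.inr_injective e)⟩ i₂' hc₂).I,
        Sum.map Subtype.val id y.1 = f := by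
      rcases f with f | f
      · exact ⟨⟨Sum.inl ⟨f, fun e => hf₁.1 (congrArg Sum.inl e),
          fun e => hf₁.2 (congrArg Sum.inl e)⟩,
          fun e => hn.1 (congrArg (Sum.map Subtype.val id) e), Sum.inl_ne_inr⟩, rfl⟩
      · exact ⟨⟨Sum.inr f, Sum.inr_ne_inl,
          fun e => hn.2 (congrArg (Sum.map Subtype.val id) e)⟩, rfl⟩
    obtain ⟨y, hy⟩ := key
    exact hf ⟨(Relabeling.edgeEdge L M N i₁ i₁' i₂ i₂' a hc₁ hc₂).equiv y,
      (congrArg (fun x => Sum.map Subtype.val id (Subtype.val x)) ((Relabeling.edgeEdge L M N i₁ i₁' i₂ i₂' a hc₁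
        hc₂).equiv.symm_apply_apply y)).trans hy⟩

/-! ### Trees of labels and structural words -/

/-- Identity relabeling. -/
def Relabeling.refl (L : Label.{u}) : Relabeling L L := ⟨Equiv.refl _, rfl, fun _ => rfl⟩

/-- Inverse relabeling. -/
def Relabeling.symm {L M : Label.{u}} (s : Relabeling L M) : Relabeling M L :=
  ⟨s.equiv.symm, s.genus_eq.symm, fun i => by
    rw [← s.color_eq, Equiv.apply_symm_apply]⟩

theorem Relabeling.ext {L M : Label.{u}} {s t : Relabeling L M} (h : ∀ i, s i = t i) : s = t := by
  obtain ⟨s, _, _⟩ := s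
  obtain ⟨t, _, _⟩ := t
  obtain rfl : s = t := Equiv.ext h
  rfl

theorem Relabeling.trans_symm {L M : Label.{u}} (s : Relabeling L M) :
    s.trans s.symm = Relabeling.refl L :=
  Relabeling.ext fun i => s.equiv.symm_apply_apply i

theorem Relabeling.symm_trans {L M : Label.{u}} (s : Relabeling L M) :
    s.symm.trans s = Relabeling.refl M :=
  Relabeling.ext fun i => s.equiv.apply_symm_apply i

/-- Formal tensor products of labels. -/
inductive LabelTree : Type (u + 1)
  | unit : LabelTree
  | leaf (L : Label.{u}) : LabelTree
  | node (s t : LabelTree) : LabelTree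

/-- Formal structural morphisms between formal tensor products. -/
inductive Word : LabelTree.{u} → LabelTree.{u} → Type (u + 1)
  | id (s : LabelTree.{u}) : Word s s
  | comp {s t r : LabelTree.{u}} (f : Word s t) (g : Word t r) : Word s r
  | tensor {s t s' t' : LabelTree.{u}} (f : Word s t) (g : Word s' t') : Word (s.node s') (t.node t')
  | assoc (s t r : LabelTree.{u}) : Word ((s.node t).node r) (s.node (t.node r))
  | assocInv (s t r : LabelTree.{u}) : Word (s.node (t.node r)) ((s.node t).node r)
  | leftUnitor (s : LabelTree.{u}) : Word (LabelTree.unit.node s) s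
  | leftUnitorInv (s : LabelTree.{u}) : Word s (LabelTree.unit.node s)
  | rightUnitor (s : LabelTree.{u}) : Word (s.node LabelTree.unit) s
  | rightUnitorInv (s : LabelTree.{u}) : Word s (s.node LabelTree.unit)
  | braid (s t : LabelTree.{u}) : Word (s.node t) (t.node s)
  | relabel {L M : Label.{u}} (s : Relabeling L M) : Word (.leaf L) (.leaf M)

section eval

variable {C : Type w} [Category.{v} C] [MonoidalCategory C]

/-- The value of a formal tensor product for given gluing data. -/
def LabelTree.eval (D : GluingData.{u} C) : LabelTree.{u} → C
  | unit => 𝟙_ C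
  | leaf L => D.obj L
  | node s t => s.eval D ⊗ t.eval D

/-- The disjoint union of corollas given by a formal tensor product of labels. -/
noncomputable abbrev LabelTree.graph (s : LabelTree.{u}) : Graph.{u} := s.eval tautological

variable [SymmetricCategory C]

/-- The value of a structural word. -/
def Word.eval (D : GluingData.{u} C) : {s t : LabelTree.{u}} → Word s t → (s.eval D ⟶ t.eval D)
  | _, _, id s => 𝟙 (s.eval D)
  | _, _, comp f g => f.eval D ≫ g.eval D
  | _, _, tensor f g => f.eval D ⊗ₘ g.eval D
  | _, _, assoc s t r => (α_ (s.eval D) (t.eval D) (r.eval D)).hom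
  | _, _, assocInv s t r => (α_ (s.eval D) (t.eval D) (r.eval D)).inv
  | _, _, leftUnitor s => (λ_ (s.eval D)).hom
  | _, _, leftUnitorInv s => (λ_ (s.eval D)).inv
  | _, _, rightUnitor s => (ρ_ (s.eval D)).hom
  | _, _, rightUnitorInv s => (ρ_ (s.eval D)).inv
  | _, _, braid s t => (β_ (s.eval D) (t.eval D)).hom
  | _, _, relabel s => (D.relabel s).hom

/-- The morphism of graphs given by a structural word. -/
noncomputable abbrev Word.hom {s t : LabelTree.{u}} (f : Word s t) : s.graph ⟶ t.graph :=
  f.eval tautological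

/-- The inverse of a structural word. -/
def Word.inv : {s t : LabelTree.{u}} → Word s t → Word t s
  | _, _, id s => id s
  | _, _, comp f g => comp g.inv f.inv
  | _, _, tensor f g => tensor f.inv g.inv
  | _, _, assoc s t r => assocInv s t r
  | _, _, assocInv s t r => assoc s t r
  | _, _, leftUnitor s => leftUnitorInv s
  | _, _, leftUnitorInv s => leftUnitor s
  | _, _, rightUnitor s => rightUnitorInv s
  | _, _, rightUnitorInv s => rightUnitor s
  | _, _, braid s t => braid t s
  | _, _, relabel s => relabel s.symm

variable {D : GluingData.{u} C}

/-- No unit axiom is part of compatibility: the value on the identity relabeling is an idempotent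
isomorphism, hence the identity. -/
theorem GluingData.Compatible.relabel_refl (hD : D.Compatible) (L : Label.{u}) :
    (D.relabel (Relabeling.refl L)).hom = 𝟙 (D.obj L) := by
  have h := hD.relabel_trans (Relabeling.refl L) (Relabeling.refl L)
  have e : (Relabeling.refl L).trans (Relabeling.refl L) = Relabeling.refl L := rfl
  rw [e] at h
  rwa [← cancel_epi (D.relabel (Relabeling.refl L)).hom, Category.comp_id, eq_comm]

theorem Word.eval_comp_inv (hD : D.Compatible) {s t : LabelTree.{u}} (f : Word s t) :
    f.eval D ≫ f.inv.eval D = 𝟙 _ := by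
  induction f with
  | comp f g hf hg => simp [eval, inv, reassoc_of% hg, hf]
  | tensor f g hf hg => simp [eval, inv, tensorHom_comp_tensorHom, hf, hg, LabelTree.eval]
  | relabel s =>
    change (D.relabel s).hom ≫ (D.relabel s.symm).hom = _
    rw [← hD.relabel_trans, s.trans_symm, hD.relabel_refl]; rfl
  | _ => simp [eval, inv, LabelTree.eval]

theorem Word.eval_inv_comp (hD : D.Compatible) {s t : LabelTree.{u}} (f : Word s t) :
    f.inv.eval D ≫ f.eval D = 𝟙 _ := by
  induction f with
  | comp f g hf hg => simp [eval, inv, reassoc_of% hf, hg]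
  | tensor f g hf hg => simp [eval, inv, tensorHom_comp_tensorHom, hf, hg, LabelTree.eval]
  | relabel s =>
    change (D.relabel s.symm).hom ≫ (D.relabel s).hom = _
    rw [← hD.relabel_trans, s.symm_trans, hD.relabel_refl]; rfl
  | _ => simp [eval, inv, LabelTree.eval]

/-- The isomorphism given by a structural word. -/
def Word.iso (hD : D.Compatible) {s t : LabelTree.{u}} (f : Word s t) : s.eval D ≅ t.eval D where
  hom := f.eval D
  inv := f.inv.eval D
  hom_inv_id := f.eval_comp_inv hD
  inv_hom_id := f.eval_inv_comp hD

theorem Word.isIso_eval (hD : D.Compatible) {s t : LabelTree.{u}} (f : Word s t) :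
    IsIso (f.eval D) :=
  (f.iso hD).isIso_hom

end eval

namespace LabelTree

/-- The label of a vertex. -/
noncomputable def lab : (s : LabelTree.{u}) → s.graph.V → Label.{u}
  | unit => fun v => PEmpty.elim v
  | leaf L => fun _ => L
  | node s t => Sum.elim s.lab t.lab

/-- The result of replacing a vertex by the unit. -/
noncomputable def rem : (s : LabelTree.{u}) → s.graph.V → LabelTree.{u}
  | unit => fun v => PEmpty.elim v
  | leaf _ => fun _ => unit
  | node s t => Sum.elim (fun v => (s.rem v).node t) (fun v => s.node (t.rem v))

/-- The word which moves a vertex to the front. -/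
noncomputable def extract : (s : LabelTree.{u}) → (v : s.graph.V) →
    Word s ((leaf (s.lab v)).node (s.rem v))
  | unit => fun v => PEmpty.elim v
  | leaf L => fun _ => .rightUnitorInv (leaf L)
  | node s t => Sum.rec
      (fun v => .comp (.tensor (s.extract v) (.id t)) (.assoc (leaf (s.lab v)) (s.rem v) t))
      (fun v => .comp (.tensor (.id s) (t.extract v))
        (.comp (.assocInv s (leaf (t.lab v)) (t.rem v))
        (.comp (.tensor (.braid s (leaf (t.lab v))) (.id (t.rem v)))
          (.assoc (leaf (t.lab v)) s (t.rem v)))))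

theorem onV_extract : (s : LabelTree.{u}) → (v : s.graph.V) →
    Hom.onV (s.extract v).hom v = Sum.inl PUnit.unit
  | unit, v => PEmpty.elim v
  | leaf _, _ => rfl
  | node s t, Sum.inl v =>
    congrArg (fun x => Hom.onV (α_ (leaf (s.lab v)).graph (s.rem v).graph t.graph).hom (Sum.inl x))
      (s.onV_extract v)
  | node s t, Sum.inr v =>
    congrArg (fun x => Hom.onV ((Word.comp (.assocInv s (leaf (t.lab v)) (t.rem v))
        (.comp (.tensor (.braid s (leaf (t.lab v))) (.id (t.rem v)))
          (.assoc (leaf (t.lab v)) s (t.rem v)))).hom) (Sum.inr x))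
      (t.onV_extract v)

end LabelTree

/-! ### Moving one tensor factor to the front -/

section extraction

variable {C : Type w} [Category.{v} C] [MonoidalCategory C]

/-- Model for the lemmas of this part: a structural morphism commutes with moving the factor `L` to
the front, acting on `L` by `r` and on the remaining factors by a structural morphism of the same
kind. The map `r` with a proof that it is the identity appears instead of `𝟙 L`, because in the
application `r` is the value of the identity relabeling, which is the identity only by
`relabel_refl`. -/
theorem extraction_assoc_first {X L X' Y Z : C} {r : L ⟶ L} (hr : r = 𝟙 L) (e : X ⟶ L ⊗ X') :
    (α_ X Y Z).hom ≫ (e ⊗ₘ 𝟙 (Y ⊗ Z)) ≫ (α_ L X' (Y ⊗ Z)).hom =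
      ((((e ⊗ₘ 𝟙 Y) ≫ (α_ L X' Y).hom) ⊗ₘ 𝟙 Z) ≫ (α_ L (X' ⊗ Y) Z).hom) ≫
        (r ⊗ₘ (α_ X' Y Z).hom) := by
  subst hr
  simp only [tensorHom_id, id_tensorHom]
  monoidal

theorem extraction_assoc_first_inv {X L X' Y Z : C} {r : L ⟶ L} (hr : r = 𝟙 L) (e : X ⟶ L ⊗ X') :
    (α_ X Y Z).inv ≫ ((((e ⊗ₘ 𝟙 Y) ≫ (α_ L X' Y).hom) ⊗ₘ 𝟙 Z) ≫ (α_ L (X' ⊗ Y) Z).hom) =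
      ((e ⊗ₘ 𝟙 (Y ⊗ Z)) ≫ (α_ L X' (Y ⊗ Z)).hom) ≫ (r ⊗ₘ (α_ X' Y Z).inv) := by
  subst hr
  simp only [tensorHom_id, id_tensorHom]
  monoidal

theorem extraction_left_unitor {X L X' : C} {r : L ⟶ L} (hr : r = 𝟙 L) (e : X ⟶ L ⊗ X') :
    (ρ_ X).hom ≫ e = ((e ⊗ₘ 𝟙 (𝟙_ C)) ≫ (α_ L X' (𝟙_ C)).hom) ≫ (r ⊗ₘ (ρ_ X').hom) := by
  subst hr
  simp only [tensorHom_id, id_tensorHom]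
  monoidal

theorem extraction_left_unitor_inv {X L X' : C} {r : L ⟶ L} (hr : r = 𝟙 L) (e : X ⟶ L ⊗ X') :
    (ρ_ X).inv ≫ ((e ⊗ₘ 𝟙 (𝟙_ C)) ≫ (α_ L X' (𝟙_ C)).hom) = e ≫ (r ⊗ₘ (ρ_ X').inv) := by
  subst hr
  simp only [tensorHom_id, id_tensorHom]
  monoidal

theorem extraction_tensor_left {X L X' Y X₂ L₂ X₂' Y₂ : C} {e : X ⟶ L ⊗ X'}
    {e₂ : X₂ ⟶ L₂ ⊗ X₂'} {f : X ⟶ X₂} {r : L ⟶ L₂} {f' : X' ⟶ X₂'} (g : Y ⟶ Y₂)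
    (h : f ≫ e₂ = e ≫ (r ⊗ₘ f')) :
    (f ⊗ₘ g) ≫ ((e₂ ⊗ₘ 𝟙 Y₂) ≫ (α_ L₂ X₂' Y₂).hom) =
      ((e ⊗ₘ 𝟙 Y) ≫ (α_ L X' Y).hom) ≫ (r ⊗ₘ (f' ⊗ₘ g)) := by
  rw [Category.assoc, ← associator_naturality, tensorHom_comp_tensorHom_assoc,
    tensorHom_comp_tensorHom_assoc, h]
  simp

variable [SymmetricCategory C]

/-- Moving an object past another one. -/
abbrev shiftLeft (Y L X' : C) : Y ⊗ (L ⊗ X') ⟶ L ⊗ (Y ⊗ X') :=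
  (α_ Y L X').inv ≫ ((β_ Y L).hom ⊗ₘ 𝟙 X') ≫ (α_ L Y X').hom

theorem shiftLeft_naturality {Y L X' Y₂ L₂ X₂' : C} (g : Y ⟶ Y₂) (r : L ⟶ L₂) (f : X' ⟶ X₂') :
    (g ⊗ₘ (r ⊗ₘ f)) ≫ shiftLeft Y₂ L₂ X₂' = shiftLeft Y L X' ≫ (r ⊗ₘ (g ⊗ₘ f)) := by
  simp only [shiftLeft, Category.assoc]
  rw [associator_inv_naturality_assoc, tensorHom_comp_tensorHom_assoc,
    BraidedCategory.braiding_naturality, ← associator_naturality, tensorHom_comp_tensorHom_assoc]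
  simp

theorem extraction_tensor_right {X L X' Y X₂ L₂ X₂' Y₂ : C} {e : X ⟶ L ⊗ X'}
    {e₂ : X₂ ⟶ L₂ ⊗ X₂'} {f : X ⟶ X₂} {r : L ⟶ L₂} {f' : X' ⟶ X₂'} (g : Y ⟶ Y₂)
    (h : f ≫ e₂ = e ≫ (r ⊗ₘ f')) :
    (g ⊗ₘ f) ≫ ((𝟙 Y₂ ⊗ₘ e₂) ≫ shiftLeft Y₂ L₂ X₂') =
      ((𝟙 Y ⊗ₘ e) ≫ shiftLeft Y L X') ≫ (r ⊗ₘ (g ⊗ₘ f')) := by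
  rw [Category.assoc, ← shiftLeft_naturality, tensorHom_comp_tensorHom_assoc,
    tensorHom_comp_tensorHom_assoc, h]
  simp

theorem extraction_assoc_second {X L X' Y Z : C} {r : L ⟶ L} (hr : r = 𝟙 L) (e : X ⟶ L ⊗ X') :
    (α_ Y X Z).hom ≫ (𝟙 Y ⊗ₘ ((e ⊗ₘ 𝟙 Z) ≫ (α_ L X' Z).hom)) ≫ shiftLeft Y L (X' ⊗ Z) =
      ((((𝟙 Y ⊗ₘ e) ≫ shiftLeft Y L X') ⊗ₘ 𝟙 Z) ≫ (α_ L (Y ⊗ X') Z).hom) ≫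
        (r ⊗ₘ (α_ Y X' Z).hom) := by
  subst hr
  simp only [tensorHom_id, id_tensorHom, shiftLeft]
  monoidal

theorem extraction_assoc_second_inv {X L X' Y Z : C} {r : L ⟶ L} (hr : r = 𝟙 L)
    (e : X ⟶ L ⊗ X') :
    (α_ Y X Z).inv ≫ ((((𝟙 Y ⊗ₘ e) ≫ shiftLeft Y L X') ⊗ₘ 𝟙 Z) ≫ (α_ L (Y ⊗ X') Z).hom) =
      ((𝟙 Y ⊗ₘ ((e ⊗ₘ 𝟙 Z) ≫ (α_ L X' Z).hom)) ≫ shiftLeft Y L (X' ⊗ Z)) ≫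
        (r ⊗ₘ (α_ Y X' Z).inv) := by
  subst hr
  simp only [tensorHom_id, id_tensorHom, shiftLeft]
  monoidal

/-- The hexagon identity: passing a tensor product is passing its factors one after the other. -/
theorem shiftLeft_tensor (Y Z L X' : C) :
    (α_ Y Z (L ⊗ X')).hom ≫ (𝟙 Y ⊗ₘ shiftLeft Z L X') ≫ shiftLeft Y L (Z ⊗ X') =
      shiftLeft (Y ⊗ Z) L X' ≫ (𝟙 L ⊗ₘ (α_ Y Z X').hom) := by
  simp only [tensorHom_id, id_tensorHom, shiftLeft, BraidedCategory.braiding_tensor_left_hom]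
  monoidal

theorem extraction_assoc_third {X L X' Y Z : C} {r : L ⟶ L} (hr : r = 𝟙 L) (e : X ⟶ L ⊗ X') :
    (α_ Y Z X).hom ≫ (𝟙 Y ⊗ₘ ((𝟙 Z ⊗ₘ e) ≫ shiftLeft Z L X')) ≫ shiftLeft Y L (Z ⊗ X') =
      ((𝟙 (Y ⊗ Z) ⊗ₘ e) ≫ shiftLeft (Y ⊗ Z) L X') ≫ (r ⊗ₘ (α_ Y Z X').hom) := by
  subst hr
  rw [Category.assoc, ← shiftLeft_tensor]
  simp

theorem extraction_assoc_third_inv {X L X' Y Z : C} {r : L ⟶ L} (hr : r = 𝟙 L) (e : X ⟶ L ⊗ X') :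
    (α_ Y Z X).inv ≫ ((𝟙 (Y ⊗ Z) ⊗ₘ e) ≫ shiftLeft (Y ⊗ Z) L X') =
      ((𝟙 Y ⊗ₘ ((𝟙 Z ⊗ₘ e) ≫ shiftLeft Z L X')) ≫ shiftLeft Y L (Z ⊗ X')) ≫
        (r ⊗ₘ (α_ Y Z X').inv) := by
  subst hr
  rw [Iso.inv_comp_eq, ← Category.assoc (α_ Y Z X).hom, extraction_assoc_third rfl e, Category.assoc,
    tensorHom_comp_tensorHom]
  simp

theorem extraction_right_unitor {X L X' : C} {r : L ⟶ L} (hr : r = 𝟙 L) (e : X ⟶ L ⊗ X') :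
    (λ_ X).hom ≫ e =
      ((𝟙 (𝟙_ C) ⊗ₘ e) ≫ shiftLeft (𝟙_ C) L X') ≫ (r ⊗ₘ (λ_ X').hom) := by
  subst hr
  simp only [tensorHom_id, id_tensorHom, shiftLeft, braiding_tensorUnit_left]
  monoidal

theorem extraction_right_unitor_inv {X L X' : C} {r : L ⟶ L} (hr : r = 𝟙 L) (e : X ⟶ L ⊗ X') :
    (λ_ X).inv ≫ ((𝟙 (𝟙_ C) ⊗ₘ e) ≫ shiftLeft (𝟙_ C) L X') = e ≫ (r ⊗ₘ (λ_ X').inv) := by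
  subst hr
  simp only [tensorHom_id, id_tensorHom, shiftLeft, braiding_tensorUnit_left]
  monoidal

/-- Here `L` crosses `Y` with the braiding of `X` and is then moved back, so the symmetry of the
braiding is needed; the other extraction identities hold for any braiding. -/
theorem extraction_braid_left {X L X' Y : C} {r : L ⟶ L} (hr : r = 𝟙 L) (e : X ⟶ L ⊗ X') :
    (β_ X Y).hom ≫ ((𝟙 Y ⊗ₘ e) ≫ shiftLeft Y L X') =
      ((e ⊗ₘ 𝟙 Y) ≫ (α_ L X' Y).hom) ≫ (r ⊗ₘ (β_ X' Y).hom) := by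
  subst hr
  rw [← BraidedCategory.braiding_naturality_assoc, BraidedCategory.braiding_tensor_left_hom]
  simp only [tensorHom_id, id_tensorHom, shiftLeft, Category.assoc, Iso.hom_inv_id_assoc,
    ← comp_whiskerRight_assoc, SymmetricCategory.symmetry]
  simp

theorem extraction_braid_right {X L X' Y : C} {r : L ⟶ L} (hr : r = 𝟙 L) (e : X ⟶ L ⊗ X') :
    (β_ Y X).hom ≫ ((e ⊗ₘ 𝟙 Y) ≫ (α_ L X' Y).hom) =
      ((𝟙 Y ⊗ₘ e) ≫ shiftLeft Y L X') ≫ (r ⊗ₘ (β_ Y X').hom) := by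
  subst hr
  rw [← BraidedCategory.braiding_naturality_assoc, BraidedCategory.braiding_tensor_right_hom]
  simp only [tensorHom_id, id_tensorHom, shiftLeft, Category.assoc, Iso.inv_hom_id, Category.comp_id]

end extraction

theorem extraction_comp {C : Type w} [Category.{v} C] [MonoidalCategory C]
    {X X₂ X₃ L L₂ L₃ X' X₂' X₃' : C} {e : X ⟶ L ⊗ X'} {e₂ : X₂ ⟶ L₂ ⊗ X₂'} {e₃ : X₃ ⟶ L₃ ⊗ X₃'}
    {f : X ⟶ X₂} {g : X₂ ⟶ X₃} {r : L ⟶ L₂} {r' : L₂ ⟶ L₃} {f' : X' ⟶ X₂'} {g' : X₂' ⟶ X₃'}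
    {r'' : L ⟶ L₃} (hr : r'' = r ≫ r') (h : f ≫ e₂ = e ≫ (r ⊗ₘ f'))
    (k : g ≫ e₃ = e₂ ≫ (r' ⊗ₘ g')) : (f ≫ g) ≫ e₃ = e ≫ (r'' ⊗ₘ (f' ≫ g')) := by
  rw [hr, ← tensorHom_comp_tensorHom, ← reassoc_of% h, ← k, Category.assoc]

theorem id_comp_comm {C : Type w} [Category.{v} C] [MonoidalCategory C] {X L X' : C} {r : L ⟶ L}
    (hr : r = 𝟙 L) (e : X ⟶ L ⊗ X') : 𝟙 X ≫ e = e ≫ (r ⊗ₘ 𝟙 X') := by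
  subst hr
  simp

namespace Word

variable {C : Type w} [Category.{v} C] [MonoidalCategory C] [SymmetricCategory C]

/-- A structural word `f` restricts to the complement of a vertex as `f'`. -/
def Restricts (D : GluingData.{u} C) {s t : LabelTree.{u}} (f : Word s t) (v : s.graph.V)
    (σ : Relabeling (s.lab v) (t.lab (Hom.onV f.hom v)))
    (f' : Word (s.rem v) (t.rem (Hom.onV f.hom v))) : Prop :=
  f.eval D ≫ (t.extract _).eval D = (s.extract v).eval D ≫ ((D.relabel σ).hom ⊗ₘ f'.eval D)

theorem Restricts.comp {D : GluingData.{u} C} (hD : D.Compatible) {s t r : LabelTree.{u}}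
    {f : Word s t} {g : Word t r} {v : s.graph.V} {σ τ f' g'} (h : Restricts D f v σ f')
    (k : Restricts D g (Hom.onV f.hom v) τ g') :
    Restricts D (f.comp g) v (σ.trans τ) (f'.comp g') := by
  exact extraction_comp (hD.relabel_trans σ τ) h k

/-- The same relabeling and the same restricted word serve for graphs and for `C`, since each
extraction identity holds in every symmetric monoidal category. This simultaneity lets information
about graphs control values in `C`. -/
theorem exists_restricts {D : GluingData.{u} C} (hD : D.Compatible) {s t : LabelTree.{u}}
    (f : Word s t) (v : s.graph.V) :
    ∃ σ f', Restricts tautological f v σ f' ∧ Restricts D f v σ f' := by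
  have hG := tautological_compatible.{u}
  induction f with
  | id s =>
    exact ⟨.refl _, .id _, id_comp_comm (hG.relabel_refl _) _, id_comp_comm (hD.relabel_refl _) _⟩
  | comp f g hf hg =>
    obtain ⟨σ, f', h1, h2⟩ := hf v
    obtain ⟨τ, g', h3, h4⟩ := hg (Hom.onV f.hom v)
    exact ⟨σ.trans τ, f'.comp g', h1.comp hG h3, h2.comp hD h4⟩
  | tensor f g hf hg =>
    rcases v with v | v
    · obtain ⟨σ, f', h1, h2⟩ := hf v
      exact ⟨σ, f'.tensor g, extraction_tensor_left _ h1, extraction_tensor_left _ h2⟩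
    · obtain ⟨σ, f', h1, h2⟩ := hg v
      exact ⟨σ, f.tensor f', extraction_tensor_right _ h1, extraction_tensor_right _ h2⟩
  | assoc s t r =>
    rcases v with (v | v) | v
    · exact ⟨.refl _, .assoc _ _ _, extraction_assoc_first (hG.relabel_refl _) _,
        extraction_assoc_first (hD.relabel_refl _) _⟩
    · exact ⟨.refl _, .assoc _ _ _, extraction_assoc_second (hG.relabel_refl _) _,
        extraction_assoc_second (hD.relabel_refl _) _⟩
    · exact ⟨.refl _, .assoc _ _ _, extraction_assoc_third (hG.relabel_refl _) _,
        extraction_assoc_third (hD.relabel_refl _) _⟩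
  | assocInv s t r =>
    rcases v with v | v | v
    · exact ⟨.refl _, .assocInv _ _ _, extraction_assoc_first_inv (hG.relabel_refl _) _,
        extraction_assoc_first_inv (hD.relabel_refl _) _⟩
    · exact ⟨.refl _, .assocInv _ _ _, extraction_assoc_second_inv (hG.relabel_refl _) _,
        extraction_assoc_second_inv (hD.relabel_refl _) _⟩
    · exact ⟨.refl _, .assocInv _ _ _, extraction_assoc_third_inv (hG.relabel_refl _) _,
        extraction_assoc_third_inv (hD.relabel_refl _) _⟩
  | leftUnitor s =>
    rcases v with v | v
    · exact PEmpty.elim v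
    · exact ⟨.refl _, .leftUnitor _, extraction_right_unitor (hG.relabel_refl _) _,
        extraction_right_unitor (hD.relabel_refl _) _⟩
  | leftUnitorInv s =>
    exact ⟨.refl _, .leftUnitorInv _, extraction_right_unitor_inv (hG.relabel_refl _) _,
        extraction_right_unitor_inv (hD.relabel_refl _) _⟩
  | rightUnitor s =>
    rcases v with v | v
    · exact ⟨.refl _, .rightUnitor _, extraction_left_unitor (hG.relabel_refl _) _,
        extraction_left_unitor (hD.relabel_refl _) _⟩
    · exact PEmpty.elim v
  | rightUnitorInv s =>
    exact ⟨.refl _, .rightUnitorInv _, extraction_left_unitor_inv (hG.relabel_refl _) _,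
        extraction_left_unitor_inv (hD.relabel_refl _) _⟩
  | braid s t =>
    rcases v with v | v
    · exact ⟨.refl _, .braid _ _, extraction_braid_left (hG.relabel_refl _) _,
        extraction_braid_left (hD.relabel_refl _) _⟩
    · exact ⟨.refl _, .braid _ _, extraction_braid_right (hG.relabel_refl _) _,
        extraction_braid_right (hD.relabel_refl _) _⟩
  | relabel s =>
    exact ⟨s, .id _, (rightUnitor_inv_naturality _).trans (by rw [← tensorHom_id]; rfl),
      (rightUnitor_inv_naturality _).trans (by rw [← tensorHom_id]; rfl)⟩

end Word

/-! ### Isomorphisms of graphs -/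

section iso

variable {τ σ : Graph.{u}}

theorem onF_onF_inv (h : τ ≅ σ) (x : τ.F) : Hom.onF h.hom (Hom.onF h.inv x) = x :=
  congrFun (congrArg Hom.onF h.hom_inv_id) x

theorem onF_inv_onF (h : τ ≅ σ) (x : σ.F) : Hom.onF h.inv (Hom.onF h.hom x) = x :=
  congrFun (congrArg Hom.onF h.inv_hom_id) x

theorem onV_inv_onV (h : τ ≅ σ) (x : τ.V) : Hom.onV h.inv (Hom.onV h.hom x) = x :=
  congrFun (congrArg Hom.onV h.hom_inv_id) x

theorem onV_onV_inv (h : τ ≅ σ) (x : σ.V) : Hom.onV h.hom (Hom.onV h.inv x) = x :=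
  congrFun (congrArg Hom.onV h.inv_hom_id) x

theorem bijective_onV (h : τ ≅ σ) : Function.Bijective (Hom.onV h.hom) :=
  Function.bijective_iff_has_inverse.2 ⟨_, onV_inv_onV h, onV_onV_inv h⟩

theorem bijective_onF (h : τ ≅ σ) : Function.Bijective (Hom.onF h.hom) :=
  Function.bijective_iff_has_inverse.2 ⟨_, onF_inv_onF h, onF_onF_inv h⟩

theorem ghost_iso (h : τ ≅ σ) (f : τ.F) : Hom.ghost h.hom f = f :=
  (Hom.ghost_eq_self h.hom f).2 ⟨_, onF_onF_inv h f⟩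

/-- The axiom `onF_edge` allows tails to be grafted; applied to the inverse as well, it excludes
this for isomorphisms. -/
theorem j_iso (h : τ ≅ σ) (f : σ.F) : Hom.onF h.hom (σ.j f) = τ.j (Hom.onF h.hom f) := by
  by_cases e : τ.j (Hom.onF h.hom f) = Hom.onF h.hom f
  · by_cases e' : σ.j f = f
    · rw [e', e]
    · have k := Hom.onF_edge h.inv (Hom.onF h.hom f)
      rw [onF_inv_onF] at k
      rw [← k e', onF_onF_inv]
  · exact Hom.onF_edge h.hom f e

theorem genus_of_bijective (h : τ ⟶ σ) (hV : Function.Bijective (Hom.onV h))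
    (hF : ∀ f, Hom.ghost h f = f) (a : τ.V) : σ.genus (Hom.onV h a) = τ.genus a := by
  have e := Hom.genus_eq h (Hom.onV h a)
  have : Unique {b // Hom.onV h b = Hom.onV h a} :=
    ⟨⟨⟨a, rfl⟩⟩, fun b => Subtype.ext (hV.1 b.2)⟩
  have : IsEmpty {f // Hom.onV h (τ.bd f) = Hom.onV h a ∧ Hom.ghost h f ≠ f} :=
    ⟨fun f => f.2.2 (hF _)⟩
  rw [Nat.card_unique, finsum_unique, Nat.card_of_isEmpty] at e
  have hd : (default : {b // Hom.onV h b = Hom.onV h a}).1 = a := hV.1 (default : {b // Hom.onV h b = Hom.onV h a}).2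
  rw [hd] at e
  omega

theorem isIso_of_bijective (h : τ ⟶ σ) (hV : Function.Bijective (Hom.onV h))
    (hF : Function.Bijective (Hom.onF h))
    (hj : ∀ f, Hom.onF h (σ.j f) = τ.j (Hom.onF h f)) : IsIso h := by
  have hg : ∀ f, Hom.ghost h f = f := fun f => (Hom.ghost_eq_self h f).2 (hF.2 f)
  have : h = (isoOfEquiv (.ofBijective _ hV) (.ofBijective _ hF) (Hom.bd_onF h)
      (genus_of_bijective h hV hg) (Hom.color_onF h) hj).hom :=
    hom_ext (fun _ => rfl) (fun _ => rfl) hg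
  rw [this]
  infer_instance

/-- Without contracted pairs every connecting path is constant, so the map of vertices is injective,
and every flag survives. With tails only, the involutions impose no condition. -/
theorem isIso_of_ghost (h : τ ⟶ σ) (hg : ∀ f, Hom.ghost h f = f) (hτ : ∀ f, τ.j f = f)
    (hσ : ∀ f, σ.j f = f) : IsIso h := by
  refine isIso_of_bijective h ⟨fun a b hab => ?_, Hom.onV_surj h⟩
    ⟨Hom.onF_inj h, fun f => (Hom.ghost_eq_self h f).1 (hg f)⟩ fun f => by rw [hτ, hσ]
  have := Hom.connected h a b hab
  induction this with
  | refl => rfl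
  | tail h1 h2 ih =>
    obtain ⟨f, rfl, rfl⟩ := h2
    rw [hg]
    exact ih (hab.trans (Hom.bd_ghost h f))

theorem hom_eq_of_isEmpty (hτ : IsEmpty τ.V) (h k : τ ⟶ σ) : h = k :=
  hom_ext (fun v => hτ.elim v) (fun f => hτ.elim (τ.bd (Hom.onF h f))) fun f => hτ.elim (τ.bd f)

/-- A property of graphs that fails in a general `C`. It is the reason why decompositions are
compared in graphs first and evaluated afterwards. -/
theorem tensor_injective {τ' σ' : Graph.{u}} {h k : τ ⟶ τ'} {h' k' : σ ⟶ σ'}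
    (e : h ⊗ₘ h' = k ⊗ₘ k') : h = k ∧ h' = k' := by
  have eV : ∀ v, Hom.onV (h ⊗ₘ h') v = Hom.onV (k ⊗ₘ k') v := fun v => by rw [e]
  have eF : ∀ v, Hom.onF (h ⊗ₘ h') v = Hom.onF (k ⊗ₘ k') v := fun v => by rw [e]
  have eg : ∀ v, Hom.ghost (h ⊗ₘ h') v = Hom.ghost (k ⊗ₘ k') v := fun v => by rw [e]
  exact ⟨hom_ext (fun v => Sum.inl_injective (eV (Sum.inl v)))
    (fun v => Sum.inl_injective (eF (Sum.inl v))) (fun v => Sum.inl_injective (eg (Sum.inl v))),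
    hom_ext (fun v => Sum.inr_injective (eV (Sum.inr v)))
    (fun v => Sum.inr_injective (eF (Sum.inr v))) (fun v => Sum.inr_injective (eg (Sum.inr v)))⟩

/-- Flags follow the vertices that carry them, so an isomorphism which respects a decomposition of
the vertices also respects the decomposition of the flags. -/
theorem exists_iso_inl {τ' σ' : Graph.{u}} (i : τ ⊗ σ ≅ τ' ⊗ σ')
    (hl : ∀ a, ∃ b, Hom.onV i.hom (Sum.inl a) = Sum.inl b)
    (hr : ∀ a, ∃ b, Hom.onV i.hom (Sum.inr a) = Sum.inr b) :
    ∃ h : τ ≅ τ', (∀ a, Hom.onV i.hom (Sum.inl a) = Sum.inl (Hom.onV h.hom a)) ∧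
      ∀ f, Hom.onF i.hom (Sum.inl f) = Sum.inl (Hom.onF h.hom f) := by
  have hF : ∀ f : τ'.F, ∃ x, Hom.onF i.hom (Sum.inl f) = Sum.inl x := by
    intro f
    have hb := Hom.bd_onF i.hom (Sum.inl f)
    rcases hx : Hom.onF i.hom (Sum.inl f) with x | x
    · exact ⟨x, rfl⟩
    · rw [hx] at hb
      obtain ⟨b, e⟩ := hr (σ.bd x)
      exact absurd (e.symm.trans hb) Sum.inr_ne_inl
  have hF' : ∀ f : σ'.F, ∃ x, Hom.onF i.hom (Sum.inr f) = Sum.inr x := by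
    intro f
    have hb := Hom.bd_onF i.hom (Sum.inr f)
    rcases hx : Hom.onF i.hom (Sum.inr f) with x | x
    · rw [hx] at hb
      obtain ⟨b, e⟩ := hl (τ.bd x)
      exact absurd (e.symm.trans hb) Sum.inl_ne_inr
    · exact ⟨x, rfl⟩
  choose e he using hl
  choose k hk using hF
  have heb : Function.Bijective e := by
    refine ⟨fun a b h => ?_, fun b => ?_⟩
    · exact Sum.inl_injective ((bijective_onV i).1 ((he a).trans ((congrArg _ h).trans (he b).symm)))
    · obtain ⟨a | a, ha⟩ := (bijective_onV i).2 (Sum.inl b)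
      · exact ⟨a, Sum.inl_injective ((he a).symm.trans ha)⟩
      · obtain ⟨c, hc⟩ := hr a
        exact absurd (hc.symm.trans ha) Sum.inr_ne_inl
  have hkb : Function.Bijective k := by
    refine ⟨fun a b h => ?_, fun b => ?_⟩
    · exact Sum.inl_injective ((bijective_onF i).1 ((hk a).trans ((congrArg _ h).trans (hk b).symm)))
    · obtain ⟨a | a, ha⟩ := (bijective_onF i).2 (Sum.inl b)
      · exact ⟨a, Sum.inl_injective ((hk a).symm.trans ha)⟩
      · obtain ⟨c, hc⟩ := hF' a
        exact absurd (hc.symm.trans ha) Sum.inr_ne_inl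
  refine ⟨isoOfEquiv (.ofBijective e heb) (.ofBijective k hkb) (fun f => ?_) (fun v => ?_)
    (fun f => ?_) (fun f => ?_), he, hk⟩
  · have hb := Hom.bd_onF i.hom (Sum.inl f)
    rw [hk] at hb
    exact Sum.inl_injective ((he _).symm.trans hb)
  · have := genus_of_bijective i.hom (bijective_onV i) (ghost_iso i) (Sum.inl v)
    rw [he] at this
    exact this
  · have := Hom.color_onF i.hom (Sum.inl f)
    rw [hk] at this
    exact this
  · have := j_iso i (Sum.inl f)
    rw [hk] at this
    exact Sum.inl_injective ((hk _).symm.trans this)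

/-- An isomorphism of disjoint unions which respects the summands is a disjoint union. -/
theorem exists_eq_tensor {τ' σ' : Graph.{u}} (i : τ ⊗ σ ≅ τ' ⊗ σ')
    (hl : ∀ a, ∃ b, Hom.onV i.hom (Sum.inl a) = Sum.inl b)
    (hr : ∀ a, ∃ b, Hom.onV i.hom (Sum.inr a) = Sum.inr b) :
    ∃ (h : τ ≅ τ') (k : σ ≅ σ'), i.hom = h.hom ⊗ₘ k.hom := by
  obtain ⟨h, h1, h2⟩ := exists_iso_inl i hl hr
  -- The right component is the left component after conjugation with the braidings.
  obtain ⟨k, k1, k2⟩ := exists_iso_inl (β_ σ τ ≪≫ i ≪≫ β_ τ' σ')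
    (fun a => by
      obtain ⟨b, hb⟩ := hr a
      exact ⟨b, congrArg (Hom.onV (β_ τ' σ').hom) hb⟩)
    (fun a => by
      obtain ⟨b, hb⟩ := hl a
      exact ⟨b, congrArg (Hom.onV (β_ τ' σ').hom) hb⟩)
  refine ⟨h, k, hom_ext ?_ ?_ fun f => ?_⟩
  · rintro (a | a)
    · exact h1 a
    · exact congrArg (Hom.onV (β_ σ' τ').hom) (k1 a) |> fun e =>
        (congrFun (congrArg Hom.onV (SymmetricCategory.symmetry τ' σ')) _).symm.trans e
  · rintro (a | a)
    · exact h2 a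
    · exact congrArg (Hom.onF (β_ τ σ).hom) (k2 a) |> fun e =>
        (congrFun (congrArg Hom.onF (SymmetricCategory.symmetry τ σ)) _).symm.trans e
  · exact (ghost_iso i f).trans (ghost_iso (tensorIso h k) f).symm

theorem relabelIso_injective {L M : Label.{u}} {s t : Relabeling L M}
    (h : (relabelIso s).hom = (relabelIso t).hom) : s = t := by
  refine Relabeling.ext fun i => ?_
  have e : ∀ f, s.equiv.symm f = t.equiv.symm f := fun f => congrFun (congrArg Hom.onF h) f
  exact t.equiv.symm_apply_eq.1 ((e _).symm.trans (s.equiv.symm_apply_apply i))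

theorem exists_eq_relabelIso {L M : Label.{u}} (i : corolla L ≅ corolla M) :
    ∃ s : Relabeling L M, i.hom = (relabelIso s).hom := by
  obtain ⟨s, hs⟩ := exists_relabeling_iso (τ := corolla L) (σ := corolla M) PUnit.unit
    (fun _ => rfl) PUnit.unit (fun _ => rfl) i
  refine ⟨s, hom_ext (fun _ => rfl) (fun f => ?_)
    fun f => (ghost_iso i f).trans (ghost_iso (relabelIso s) f).symm⟩
  exact (congrArg (Hom.onF i.hom) (s.equiv.apply_symm_apply f)).symm.trans (hs _)

end iso

theorem LabelTree.j_graph : (s : LabelTree.{u}) → (f : s.graph.F) → s.graph.j f = f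
  | unit, f => PEmpty.elim f
  | leaf _, _ => rfl
  | node s _, Sum.inl f => congrArg Sum.inl (s.j_graph f)
  | node _ t, Sum.inr f => congrArg Sum.inr (t.j_graph f)

/-! ### Coherence for structural words -/

section coherence

variable {C : Type w} [Category.{v} C] [MonoidalCategory C]

/-! ### Structural morphisms over the unit object -/

section collapse

theorem collapse_tensor {X Y X' Y' : C} {f : X ⟶ Y} {f' : X' ⟶ Y'} {c : Y ⟶ 𝟙_ C} {c' : Y' ⟶ 𝟙_ C}
    {d : X ⟶ 𝟙_ C} {d' : X' ⟶ 𝟙_ C} (h : f ≫ c = d) (h' : f' ≫ c' = d') :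
    (f ⊗ₘ f') ≫ (c ⊗ₘ c') ≫ (λ_ (𝟙_ C)).hom = (d ⊗ₘ d') ≫ (λ_ (𝟙_ C)).hom := by
  rw [tensorHom_comp_tensorHom_assoc, h, h']

theorem collapse_assoc {X Y Z : C} (c : X ⟶ 𝟙_ C) (d : Y ⟶ 𝟙_ C) (e : Z ⟶ 𝟙_ C) :
    (α_ X Y Z).hom ≫ (c ⊗ₘ ((d ⊗ₘ e) ≫ (λ_ (𝟙_ C)).hom)) ≫ (λ_ (𝟙_ C)).hom =
      (((c ⊗ₘ d) ≫ (λ_ (𝟙_ C)).hom) ⊗ₘ e) ≫ (λ_ (𝟙_ C)).hom := by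
  simp only [MonoidalCategory.tensorHom_def]
  monoidal

theorem collapse_leftUnitor {X : C} (c : X ⟶ 𝟙_ C) :
    (λ_ X).hom ≫ c = (𝟙 (𝟙_ C) ⊗ₘ c) ≫ (λ_ (𝟙_ C)).hom := by
  simp

theorem collapse_rightUnitor {X : C} (c : X ⟶ 𝟙_ C) :
    (ρ_ X).hom ≫ c = (c ⊗ₘ 𝟙 (𝟙_ C)) ≫ (λ_ (𝟙_ C)).hom := by
  simp [unitors_equal]

variable [SymmetricCategory C]

theorem collapse_braid {X Y : C} (c : X ⟶ 𝟙_ C) (d : Y ⟶ 𝟙_ C) :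
    (β_ X Y).hom ≫ (d ⊗ₘ c) ≫ (λ_ (𝟙_ C)).hom = (c ⊗ₘ d) ≫ (λ_ (𝟙_ C)).hom := by
  rw [← BraidedCategory.braiding_naturality_assoc, braiding_leftUnitor, unitors_equal]

end collapse

namespace Word

variable [SymmetricCategory C]

/-- Words without labels can be collapsed. -/
noncomputable def collapse : (s : LabelTree.{u}) → IsEmpty s.graph.V → Word s .unit
  | .unit => fun _ => .id _
  | .leaf _ => fun h => (h.false PUnit.unit).elim
  | .node s t => fun h => .comp
      (.tensor (collapse s ⟨fun v => h.false (Sum.inl v)⟩) (collapse t ⟨fun v => h.false (Sum.inr v)⟩))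
      (.leftUnitor _)

theorem isEmpty_of_word {s t : LabelTree.{u}} (f : Word s t) (hs : IsEmpty s.graph.V) :
    IsEmpty t.graph.V :=
  ⟨fun v => by
    obtain ⟨a, _⟩ := Hom.onV_surj f.hom v
    exact hs.false a⟩

/-- Over an empty set of vertices every constructor except relabeling commutes with the collapse to
the unit object, and a relabeling would need a vertex. This is coherence for units alone, the start
of the induction in `eval_eq_of_card`. -/
theorem eval_collapse (D : GluingData.{u} C) {s t : LabelTree.{u}} (f : Word s t)
    (hs : IsEmpty s.graph.V) (ht : IsEmpty t.graph.V) :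
    f.eval D ≫ (collapse t ht).eval D = (collapse s hs).eval D := by
  induction f with
  | id s => exact Category.id_comp _
  | comp f g hf hg =>
    have := f.isEmpty_of_word hs
    exact (Category.assoc _ _ _).trans ((congrArg (_ ≫ ·) (hg this ht)).trans (hf hs this))
  | tensor f g hf hg =>
    exact collapse_tensor (hf ⟨fun v => hs.false (Sum.inl v)⟩ ⟨fun v => ht.false (Sum.inl v)⟩)
      (hg ⟨fun v => hs.false (Sum.inr v)⟩ ⟨fun v => ht.false (Sum.inr v)⟩)
  | assoc s t r => exact collapse_assoc _ _ _
  | assocInv s t r => exact (Iso.inv_comp_eq _).2 (collapse_assoc _ _ _).symm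
  | leftUnitor s => exact collapse_leftUnitor _
  | leftUnitorInv s => exact (Iso.inv_comp_eq _).2 (collapse_leftUnitor _).symm
  | rightUnitor s => exact collapse_rightUnitor _
  | rightUnitorInv s => exact (Iso.inv_comp_eq _).2 (collapse_rightUnitor _).symm
  | braid s t => exact collapse_braid _ _
  | relabel s => exact (hs.false PUnit.unit).elim

theorem card_rem (s : LabelTree.{u}) (v : s.graph.V) :
    Nat.card s.graph.V = Nat.card (s.rem v).graph.V + 1 := by
  have e := Nat.card_congr (Equiv.ofBijective _
    (bijective_onV ((s.extract v).iso tautological_compatible)))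
  rw [e]
  change Nat.card (PUnit ⊕ (s.rem v).graph.V) = _
  rw [Nat.card_sum, Nat.card_unique, add_comm]

/-- Induction on the number of vertices. After moving a vertex and its image to the front, each word
becomes a relabeling of this vertex next to a word on the remaining ones. Equality of the graph
morphisms forces equal relabelings and equal remaining graph morphisms; the induction hypothesis
then gives equal values of the remaining words. -/
theorem eval_eq_of_card {D : GluingData.{u} C} (hD : D.Compatible) (n : ℕ) :
    ∀ {s t : LabelTree.{u}} (f g : Word s t), Nat.card s.graph.V = n → f.hom = g.hom →
      f.eval D = g.eval D := by
  induction n with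
  | zero =>
    intro s t f g hs h
    have hs' : IsEmpty s.graph.V := Finite.card_eq_zero_iff.1 hs
    have ht := f.isEmpty_of_word hs'
    have := (collapse t ht).isIso_eval hD
    rw [← cancel_mono ((collapse t ht).eval D), eval_collapse D f hs', eval_collapse D g hs']
  | succ n ih =>
    intro s t f g hs h
    have hv : Nonempty s.graph.V := (Finite.card_pos_iff (α := s.graph.V)).1 (by omega)
    obtain ⟨v⟩ := hv
    -- The types depend on the image of `v`, which is the same for `f` and `g` only up to a proof,
    -- so the statement is made for a variable image.
    have key : ∀ w : t.graph.V, Hom.onV f.hom v = w → ∃ (σ : Relabeling (s.lab v) (t.lab w))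
        (f' : Word (s.rem v) (t.rem w)),
        f.hom ≫ (t.extract w).hom = (s.extract v).hom ≫ ((relabelIso σ).hom ⊗ₘ f'.hom) ∧
        f.eval D ≫ (t.extract w).eval D =
          (s.extract v).eval D ≫ ((D.relabel σ).hom ⊗ₘ f'.eval D) := by
      rintro w rfl
      exact exists_restricts hD f v
    obtain ⟨σ, f', h1, h2⟩ := key (Hom.onV g.hom v) (by rw [h])
    obtain ⟨τ, g', h3, h4⟩ := exists_restricts hD g v
    have e : (relabelIso σ).hom ⊗ₘ f'.hom = (relabelIso τ).hom ⊗ₘ g'.hom := by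
      have := (s.extract v).isIso_eval tautological_compatible
      exact (cancel_epi (s.extract v).hom).1 (h1.symm.trans ((congrArg (· ≫ _) h).trans h3))
    obtain ⟨e1, e2⟩ := tensor_injective e
    obtain rfl := relabelIso_injective e1
    have e3 := ih f' g' (by rw [card_rem s v] at hs; omega) e2
    have := (t.extract (Hom.onV g.hom v)).isIso_eval hD
    rw [← cancel_mono ((t.extract (Hom.onV g.hom v)).eval D), h2, e3]
    exact h4.symm

/-- Structural words which give the same morphism of graphs have the same value. -/
theorem eval_eq {D : GluingData.{u} C} (hD : D.Compatible) {s t : LabelTree.{u}} {f g : Word s t}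
    (h : f.hom = g.hom) : f.eval D = g.eval D :=
  eval_eq_of_card hD _ f g rfl h

/-- Conjugated with the extractions of a vertex and of its image, the isomorphism preserves the
first factor and hence is a disjoint union. The first component is a relabeling and the second is a
word by induction. -/
theorem exists_hom_eq_of_card (n : ℕ) : ∀ {s t : LabelTree.{u}} (i : s.graph ≅ t.graph),
    Nat.card s.graph.V = n → ∃ f : Word s t, f.hom = i.hom := by
  induction n with
  | zero =>
    intro s t i hs
    have hs' : IsEmpty s.graph.V := Finite.card_eq_zero_iff.1 hs
    have ht : IsEmpty t.graph.V := ⟨fun v => hs'.false (Hom.onV i.inv v)⟩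
    exact ⟨.comp (collapse s hs') (collapse t ht).inv, hom_eq_of_isEmpty hs' _ _⟩
  | succ n ih =>
    intro s t i hs
    have hv : Nonempty s.graph.V := (Finite.card_pos_iff (α := s.graph.V)).1 (by omega)
    obtain ⟨v⟩ := hv
    let a := (s.extract v).iso tautological_compatible
    let b := (t.extract (Hom.onV i.hom v)).iso tautological_compatible
    have e : Hom.onV (a.symm ≪≫ i ≪≫ b).hom (Sum.inl PUnit.unit) = Sum.inl PUnit.unit := by
      have e1 : Hom.onV a.inv (Sum.inl PUnit.unit) = v :=
        (congrArg (Hom.onV a.inv) (s.onV_extract v).symm).trans (onV_inv_onV a v)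
      exact (congrArg (fun x => Hom.onV b.hom (Hom.onV i.hom x)) e1).trans (t.onV_extract _)
    obtain ⟨h, k, hk⟩ := exists_eq_tensor (τ := corolla (s.lab v)) (σ := (s.rem v).graph)
      (τ' := corolla (t.lab (Hom.onV i.hom v))) (σ' := (t.rem (Hom.onV i.hom v)).graph)
      (a.symm ≪≫ i ≪≫ b) (fun _ => ⟨_, e⟩) (fun x => by
        rcases hx : Hom.onV (a.symm ≪≫ i ≪≫ b).hom (Sum.inr x) with y | y
        · exact absurd ((bijective_onV (a.symm ≪≫ i ≪≫ b)).1 (hx.trans e.symm)) Sum.inr_ne_inl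
        · exact ⟨y, hx⟩)
    obtain ⟨σ, hσ⟩ := exists_eq_relabelIso h
    obtain ⟨f', hf'⟩ := ih k (by rw [card_rem s v] at hs; omega)
    refine ⟨.comp (s.extract v) (.comp (.tensor (.relabel σ) f') (t.extract _).inv), ?_⟩
    have e2 : (Word.tensor (.relabel σ) f').hom = a.inv ≫ i.hom ≫ b.hom :=
      (congrArg₂ (fun x y => x ⊗ₘ y) hσ.symm hf').trans hk.symm
    change a.hom ≫ (Word.tensor (.relabel σ) f').hom ≫ b.inv = _
    rw [e2]
    simp

/-- Isomorphisms between disjoint unions of corollas are given by structural words. -/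
theorem exists_hom_eq {s t : LabelTree.{u}} (i : s.graph ≅ t.graph) :
    ∃ f : Word s t, f.hom = i.hom :=
  exists_hom_eq_of_card _ i rfl

end Word

end coherence

/-! ### Factorization of morphisms -/

section factor

variable {τ σ ρ : Graph.{u}}

/-- The genus equation of a quotient, by subtraction: the equations of `h` are summed over the
vertices of `σ` above `v` and subtracted from the equation of `c` at `v`. This works because the
flags contracted by `c` are those contracted by `h` together with the images of those moved by `gh`.
-/
theorem genus_factor (h : Hom τ σ) (c : Hom τ ρ) (φ : σ.V → ρ.V) (gh : σ.F → σ.F)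
    (hφ : ∀ a, c.onV a = φ (h.onV a)) (hgh : ∀ f, c.ghost (h.onF f) = h.onF (gh f))
    (hc : ∀ f, f ∉ Set.range h.onF → c.ghost f = h.ghost f) (v : ρ.V) :
    2 * ρ.genus v + 2 * Nat.card {a // φ a = v} =
      2 * (∑ᶠ a : {a // φ a = v}, σ.genus a.1) +
        Nat.card {f // φ (σ.bd f) = v ∧ gh f ≠ f} + 2 := by
  classical
  have := Fintype.ofFinite τ.V
  have := Fintype.ofFinite τ.F
  have := Fintype.ofFinite σ.V
  have := Fintype.ofFinite σ.F
  rw [Hom.genus_eq_iff]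
  have hk := (Hom.genus_eq_iff _ _ _ _).1 (c.genus_eq v)
  have hh := fun y => (Hom.genus_eq_iff _ _ _ _).1 (h.genus_eq y)
  have hsum := Finset.sum_congr (rfl : (Finset.univ : Finset σ.V) = Finset.univ) fun y _ =>
    congrArg (fun n => if φ y = v then n else 0) (hh y)
  have split : ∀ (p : Prop) [Decidable p] (a b : ℕ),
      (if p then a + b else 0) = (if p then a else 0) + (if p then b else 0) := by
    intro p _ a b; split_ifs <;> rfl
  have mul : ∀ (p : Prop) [Decidable p] (b : ℕ),
      (if p then 2 * b else 0) = 2 * (if p then b else 0) := by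
    intro p _ b; split_ifs <;> rfl
  have two : ∀ (p : Prop) [Decidable p],
      (if p then 2 else 0) = 2 * (if p then 1 else 0) := by
    intro p _; split_ifs <;> rfl
  have gh' : ∀ y, (∑ f, if h.onV (τ.bd f) = y ∧ h.ghost f ≠ f then 1 else 0) =
      ∑ f, if h.onV (τ.bd f) = y then (if h.ghost f ≠ f then 1 else 0) else 0 :=
    fun y => Finset.sum_congr rfl fun f _ => by rw [ite_and]
  simp only [gh', split, mul, Finset.sum_add_distrib, ← Finset.mul_sum] at hsum
  rw [sum_fibre h.onV (fun y => φ y = v), sum_fibre h.onV (fun y => φ y = v),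
    sum_fibre (fun f => h.onV (τ.bd f)) (fun y => φ y = v)] at hsum
  have hg : (∑ f, if c.onV (τ.bd f) = v ∧ c.ghost f ≠ f then 1 else 0) =
      (∑ f, if φ (h.onV (τ.bd f)) = v then (if h.ghost f ≠ f then 1 else 0) else 0) +
      ∑ f, if φ (σ.bd f) = v ∧ gh f ≠ f then 1 else 0 := by
    have e : (∑ f, if φ (σ.bd f) = v ∧ gh f ≠ f then 1 else 0) =
        ∑ f, if (∃ y, h.onF y = f ∧ φ (σ.bd y) = v ∧ gh y ≠ y) then 1 else 0 := by
      rw [← Finset.card_filter, ← Finset.card_filter, ← Finset.card_map ⟨h.onF, h.onF_inj⟩]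
      congr 1
      ext f
      simp only [Finset.mem_map, Finset.mem_filter, Finset.mem_univ, true_and,
        Function.Embedding.coeFn_mk]
      exact ⟨fun ⟨y, hy, e⟩ => ⟨y, e, hy⟩, fun ⟨y, e, hy⟩ => ⟨y, hy, e⟩⟩
    rw [e, ← Finset.sum_add_distrib]
    refine Finset.sum_congr rfl fun f _ => ?_
    by_cases hf : f ∈ Set.range h.onF
    · obtain ⟨y, rfl⟩ := hf
      simp [h.onF_inj.eq_iff, h.bd_onF, hgh, hφ]
    · have : ¬ ∃ y, h.onF y = f ∧ φ (σ.bd y) = v ∧ gh y ≠ y :=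
        fun ⟨y, hy, _⟩ => hf ⟨y, hy⟩
      rw [if_neg this, hc f hf, hφ, ite_and]
      simp
  rw [hg] at hk
  simp only [hφ] at hk
  simp only [two, ← Finset.mul_sum] at hsum
  omega

/-- A morphism factors through the contraction of some of its contracted pairs. -/
theorem exists_factor (hσ : ∀ f, σ.j f = f) (c : τ ⟶ ρ) (h : τ ⟶ σ)
    (hg : ∀ f, Hom.ghost h f ≠ f → Hom.ghost c f = Hom.ghost h f) :
    ∃ k : σ ⟶ ρ, h ≫ k = c := by
  -- A path of pairs contracted by `h` consists of pairs contracted by `c`.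
  have hV : ∀ a b, Hom.onV h a = Hom.onV h b → Hom.onV c a = Hom.onV c b := by
    intro a b hab
    have := Hom.connected h a b hab
    clear hab
    induction this with
    | refl => rfl
    | tail _ h2 ih =>
      obtain ⟨f, rfl, rfl⟩ := h2
      rw [ih]
      by_cases hf : Hom.ghost h f = f
      · rw [hf]
      · rw [← hg f hf, Hom.bd_ghost c]
  obtain ⟨s, hs⟩ := (Hom.onV_surj h).hasRightInverse
  have hφ : ∀ a, Hom.onV c a = Hom.onV c (s (Hom.onV h a)) := fun a => hV _ _ (hs _).symm
  have hmem : ∀ f, f ∉ Set.range (Hom.onF h) → Hom.ghost c f = Hom.ghost h f :=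
    fun f hf => hg f fun e => hf ((Hom.ghost_eq_self h f).1 e)
  -- What survives `c` survives `h`. Since `h` is injective on flags, this determines the flag map
  -- of the quotient; its involution `gh` is found in the same way.
  have hF : ∀ f, ∃ y, Hom.onF h y = Hom.onF c f := by
    intro f
    by_contra hn
    have e := hmem _ hn
    rw [Hom.ghost_onF] at e
    exact hn ((Hom.ghost_eq_self h _).1 e.symm)
  choose k hk using hF
  have hgh : ∀ f, ∃ y, Hom.onF h y = Hom.ghost c (Hom.onF h f) := by
    intro f
    by_contra hn
    have e := hmem _ hn
    rw [Hom.ghost_ghost] at e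
    exact Hom.ghost_notMem h hn (e ▸ ⟨f, rfl⟩)
  choose gh hgh using hgh
  have hghost : ∀ f, gh f = f ↔ f ∈ Set.range k := by
    intro f
    rw [← (Hom.onF_inj h).eq_iff, hgh, Hom.ghost_eq_self]
    constructor
    · rintro ⟨y, hy⟩
      exact ⟨y, Hom.onF_inj h ((hk y).trans hy)⟩
    · rintro ⟨y, rfl⟩
      exact ⟨y, (hk y).symm⟩
  let m : Hom σ ρ :=
    { onV := fun a => Hom.onV c (s a)
      onF := k
      ghost := gh
      onV_surj := fun v => by
        obtain ⟨a, rfl⟩ := Hom.onV_surj c v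
        exact ⟨Hom.onV h a, (hφ a).symm⟩
      onF_inj := fun a b e => Hom.onF_inj c (by rw [← hk, ← hk, e])
      ghost_ghost := fun f => Hom.onF_inj h (by rw [hgh, hgh, Hom.ghost_ghost])
      ghost_eq_self := hghost
      bd_onF := fun f => by rw [← Hom.bd_onF h, ← hφ, hk, Hom.bd_onF c]
      bd_ghost := fun f => by
        rw [← Hom.bd_onF h, ← hφ, hgh, Hom.bd_ghost c, ← Hom.bd_onF h, ← hφ]
      ghost_edge := fun f hf => absurd (hσ f) hf
      onF_edge := fun f hf => absurd (hσ _) hf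
      color_onF := fun f => by rw [← Hom.color_onF h, hk, Hom.color_onF c]
      color_ghost := fun f => by
        rw [← Hom.color_onF h, hgh, Hom.color_ghost c, Hom.color_onF h]
      connected := fun a b hab => by
        -- A path for `c` maps to a path for the quotient: pairs already contracted by `h` become
        -- constant, the others remain contracted pairs.
        have key : ∀ x y, Relation.ReflTransGen
            (fun a b => ∃ f, τ.bd f = a ∧ τ.bd (Hom.ghost c f) = b) x y →
            Relation.ReflTransGen (fun a b => ∃ f, σ.bd f = a ∧ σ.bd (gh f) = b)
              (Hom.onV h x) (Hom.onV h y) := by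
          intro x y hxy
          refine hxy.lift' (Hom.onV h) ?_
          rintro _ _ ⟨f, rfl, rfl⟩
          by_cases hf : f ∈ Set.range (Hom.onF h)
          · obtain ⟨y, rfl⟩ := hf
            exact .single ⟨y, (Hom.bd_onF h y).symm, by rw [← hgh, Hom.bd_onF h]⟩
          · change Relation.ReflTransGen _ (Hom.onV h _) (Hom.onV h _)
            rw [hmem f hf, Hom.bd_ghost h]
        have := key _ _ (Hom.connected c _ _ hab)
        rwa [hs, hs] at this
      genus_eq := genus_factor h c _ gh hφ (fun f => (hgh f).symm) hmem }
  refine ⟨m, hom_ext (fun a => (hφ a).symm) hk fun f => ?_⟩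
  by_cases hf : f ∈ Set.range (Hom.onF h)
  · obtain ⟨y, rfl⟩ := hf
    exact (ghost_comp_onF h m y).trans (hgh y)
  · exact (ghost_comp_of_notMem h m hf).trans (hmem f hf).symm

/-- Vertices map surjectively and flags pull back injectively, so everything about the second
morphism is visible in the composite. Relabelings and remainders after a contraction are therefore
forced. -/
instance (h : τ ⟶ σ) : Epi h where
  left_cancellation {ρ} k l e := by
    refine hom_ext (fun v => ?_) (fun f => ?_) fun f => ?_
    · obtain ⟨a, rfl⟩ := Hom.onV_surj h v
      exact congrFun (congrArg Hom.onV e) a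
    · exact Hom.onF_inj h (congrFun (congrArg Hom.onF e) f)
    · refine Hom.onF_inj h ?_
      rw [← ghost_comp_onF, ← ghost_comp_onF, e]

end factor

/-! ### Chains of contractions -/

section contracts

variable {τ σ ρ : Graph.{u}}

/-- `h` contracts the pair `p`, `p'` and nothing else. -/
structure Contracts (h : τ ⟶ σ) (p p' : τ.F) : Prop where
  ne : p ≠ p'
  ghost_eq : Hom.ghost h p = p'
  eq_or : ∀ f, Hom.ghost h f ≠ f → f = p ∨ f = p'

namespace Contracts

theorem symm {h : τ ⟶ σ} {p p' : τ.F} (c : Contracts h p p') : Contracts h p' p :=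
  ⟨c.ne.symm, ghost_symm h c.ghost_eq, fun f hf => (c.eq_or f hf).symm⟩

theorem iso_comp (i : τ ≅ σ) {h : σ ⟶ ρ} {p p' : σ.F} (c : Contracts h p p') :
    Contracts (i.hom ≫ h) (Hom.onF i.hom p) (Hom.onF i.hom p') where
  ne := (Hom.onF_inj i.hom).ne c.ne
  ghost_eq := by rw [ghost_comp_onF, c.ghost_eq]
  eq_or f hf := by
    obtain ⟨y, rfl⟩ := (bijective_onF i).2 f
    rw [ghost_comp_onF, (Hom.onF_inj i.hom).ne_iff] at hf
    rcases c.eq_or y hf with rfl | rfl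
    · exact .inl rfl
    · exact .inr rfl

theorem comp_iso {h : τ ⟶ σ} (i : σ ≅ ρ) {p p' : τ.F} (c : Contracts h p p') :
    Contracts (h ≫ i.hom) p p' := by
  have e : ∀ f, Hom.ghost (h ≫ i.hom) f = Hom.ghost h f := ghost_comp_of_right h i.hom (ghost_iso i)
  exact ⟨c.ne, (e p).trans c.ghost_eq, fun f hf => c.eq_or f (by rwa [e] at hf)⟩

theorem tensor_left {h : τ ⟶ σ} {p p' : τ.F} (c : Contracts h p p') (ρ : Graph.{u}) :
    Contracts (h ⊗ₘ 𝟙 ρ) (Sum.inl p) (Sum.inl p') where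
  ne := Sum.inl_injective.ne c.ne
  ghost_eq := congrArg Sum.inl c.ghost_eq
  eq_or := by
    rintro (f | f) hf
    · rcases c.eq_or f (fun e => hf (congrArg Sum.inl e)) with rfl | rfl
      · exact .inl rfl
      · exact .inr rfl
    · exact absurd rfl hf

theorem tensor_right {h : τ ⟶ σ} {p p' : τ.F} (c : Contracts h p p') (ρ : Graph.{u}) :
    Contracts (𝟙 ρ ⊗ₘ h) (Sum.inr p) (Sum.inr p') where
  ne := Sum.inr_injective.ne c.ne
  ghost_eq := congrArg Sum.inr c.ghost_eq
  eq_or := by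
    rintro (f | f) hf
    · exact absurd rfl hf
    · rcases c.eq_or f (fun e => hf (congrArg Sum.inr e)) with rfl | rfl
      · exact .inl rfl
      · exact .inr rfl

theorem ghost_eq_of_ne {h : τ ⟶ σ} {k : τ ⟶ ρ} {p p' : τ.F} (c : Contracts h p p')
    (hk : Hom.ghost k p = p') (f : τ.F) (hf : Hom.ghost h f ≠ f) :
    Hom.ghost k f = Hom.ghost h f :=
  (ghost_eq_of_pair c.ghost_eq hk (c.eq_or f hf)).symm

/-- Two contractions of the same pair differ by an isomorphism. -/
theorem exists_iso {h : τ ⟶ σ} {k : τ ⟶ ρ} {p p' : τ.F} (c : Contracts h p p')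
    (d : Contracts k p p') (hσ : ∀ f, σ.j f = f) (hρ : ∀ f, ρ.j f = f) :
    ∃ i : σ ≅ ρ, k = h ≫ i.hom := by
  obtain ⟨m, hm⟩ := exists_factor hσ k h (c.ghost_eq_of_ne d.ghost_eq)
  obtain ⟨m', hm'⟩ := exists_factor hρ h k (d.ghost_eq_of_ne c.ghost_eq)
  refine ⟨⟨m, m', ?_, ?_⟩, hm.symm⟩
  · rw [← cancel_epi h, reassoc_of% hm, hm', Category.comp_id]
  · rw [← cancel_epi k, reassoc_of% hm', hm, Category.comp_id]

end Contracts

theorem contracts_loopHom {L : Label.{u}} {i i' : L.I} (hne : i ≠ i')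
    (hc : L.color i = L.color i') : Contracts (loopHom L i i' hne hc) i i' where
  ne := hne
  ghost_eq := (ghost_loopHom hne hc).1
  eq_or f hf := by
    by_contra! hn
    exact hf (pairSwap_of_ne hn.1 hn.2)

theorem contracts_edgeHom {L M : Label.{u}} {i : L.I} {i' : M.I} (hc : L.color i = M.color i') :
    Contracts (edgeHom L M i i' hc) (Sum.inl i) (Sum.inr i') where
  ne := Sum.inl_ne_inr
  ghost_eq := (ghost_edgeHom hc).1
  eq_or f hf := by
    by_contra! hn
    exact hf (pairSwap_of_ne hn.1 hn.2)

end contracts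

/-! ### Contractions next to further tensor factors -/

section categorical

variable {C : Type w} [Category.{v} C] [MonoidalCategory C]

theorem step_tensor_id {X A B R R' Y : C} (e : X ⟶ A ⊗ R) (g : A ⟶ B) (φ : B ⊗ R ⟶ Y) :
    ((e ≫ (g ⊗ₘ 𝟙 R) ≫ φ) ⊗ₘ 𝟙 R') =
      ((e ⊗ₘ 𝟙 R') ≫ (α_ A R R').hom) ≫ (g ⊗ₘ 𝟙 (R ⊗ R')) ≫ (α_ B R R').inv ≫ (φ ⊗ₘ 𝟙 R') := by
  simp only [tensorHom_id]
  monoidal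

theorem tensor_eq_comp {X Y X' Y' : C} (f : X ⟶ Y) (g : X' ⟶ Y') :
    f ⊗ₘ g = (f ⊗ₘ 𝟙 X') ≫ (𝟙 Y ⊗ₘ g) := by
  rw [tensorHom_comp_tensorHom, Category.comp_id, Category.id_comp]

theorem eq_unitor_step {A B : C} (g : A ⟶ B) :
    g = ((ρ_ A).inv ≫ (g ⊗ₘ 𝟙 (𝟙_ C)) ≫ 𝟙 (B ⊗ 𝟙_ C)) ≫ (ρ_ B).hom := by
  simp

theorem id_tensor_eq_braid [SymmetricCategory C] {X Y Z : C} (f : X ⟶ Y) :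
    𝟙 Z ⊗ₘ f = (β_ Z X).hom ≫ (f ⊗ₘ 𝟙 Z) ≫ (β_ Y Z).hom := by
  rw [BraidedCategory.braiding_naturality, SymmetricCategory.symmetry_assoc]

end categorical

/-- The elementary contractions. -/
inductive Atom : LabelTree.{u} → LabelTree.{u} → Type (u + 1)
  | loop (L : Label.{u}) (i i' : L.I) (hne : i ≠ i') (hc : L.color i = L.color i') :
      Atom (.leaf L) (.leaf (L.loop i i' hne hc))
  | edge (L M : Label.{u}) (i : L.I) (i' : M.I) (hc : L.color i = M.color i') :
      Atom (.node (.leaf L) (.leaf M)) (.leaf (L.edge M i i' hc))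

section chain

variable {C : Type w} [Category.{v} C] [MonoidalCategory C]

/-- The value of an elementary contraction. -/
def Atom.eval (D : GluingData.{u} C) : {a b : LabelTree.{u}} → Atom a b → (a.eval D ⟶ b.eval D)
  | _, _, loop L i i' hne hc => D.loop L i i' hne hc
  | _, _, edge L M i i' hc => D.edge L M i i' hc

/-- The value of an elementary contraction in the presence of further vertices. -/
def Atom.step (D : GluingData.{u} C) {a b : LabelTree.{u}} (g : Atom a b) (r : LabelTree.{u}) :
    (a.node r).eval D ⟶ (b.node r).eval D :=
  g.eval D ⊗ₘ 𝟙 (r.eval D)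

variable [SymmetricCategory C]

/-- `Chain D n s t h φ` means that `h` is a composition of structural words and `n` elementary
contractions, and that `φ` is the composition of their values. -/
inductive Chain (D : GluingData.{u} C) : ℕ → (s t : LabelTree.{u}) → (s.graph ⟶ t.graph) →
    (s.eval D ⟶ t.eval D) → Prop
  | word {s t : LabelTree.{u}} (f : Word s t) : Chain D 0 s t f.hom (f.eval D)
  | step {n : ℕ} {s a b r t : LabelTree.{u}} {h : (b.node r).graph ⟶ t.graph}
      {φ : (b.node r).eval D ⟶ t.eval D} (e : Word s (a.node r)) (g : Atom a b)
      (c : Chain D n (b.node r) t h φ) :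
      Chain D (n + 1) s t (e.hom ≫ g.step tautological r ≫ h) (e.eval D ≫ g.step D r ≫ φ)

namespace Chain

variable {D : GluingData.{u} C} {n m : ℕ} {s t r : LabelTree.{u}}

theorem of_eq {h h' : s.graph ⟶ t.graph} {φ φ' : s.eval D ⟶ t.eval D} (c : Chain D n s t h φ)
    (e : h' = h) (e' : φ' = φ) : Chain D n s t h' φ' := by
  rw [e, e']
  exact c

theorem word_comp (f : Word s t) {h : t.graph ⟶ r.graph} {φ : t.eval D ⟶ r.eval D}
    (c : Chain D n t r h φ) : Chain D n s r (f.hom ≫ h) (f.eval D ≫ φ) := by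
  cases c with
  | word g => exact word (f.comp g)
  | step e g c =>
    exact (step (f.comp e) g c).of_eq (Category.assoc _ _ _).symm (Category.assoc _ _ _).symm

theorem comp {h : s.graph ⟶ t.graph} {φ : s.eval D ⟶ t.eval D} (c : Chain D n s t h φ)
    {k : t.graph ⟶ r.graph} {ψ : t.eval D ⟶ r.eval D} (d : Chain D m t r k ψ) :
    Chain D (n + m) s r (h ≫ k) (φ ≫ ψ) := by
  induction c with
  | word f => rw [Nat.zero_add]; exact d.word_comp f
  | step e g c ih =>
    rw [Nat.add_right_comm]
    exact (step e g (ih d)).of_eq (by simp only [Category.assoc]) (by simp only [Category.assoc])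

/-- In a step the additional factor must be absorbed into the remaining tree, so each elementary
contraction is surrounded by reassociations. -/
theorem tensor_id {h : s.graph ⟶ t.graph} {φ : s.eval D ⟶ t.eval D} (c : Chain D n s t h φ)
    (r : LabelTree.{u}) : Chain D n (s.node r) (t.node r) (h ⊗ₘ 𝟙 r.graph) (φ ⊗ₘ 𝟙 (r.eval D)) := by
  induction c with
  | word f => exact word (f.tensor (.id r))
  | step e g c ih =>
    exact (step ((e.tensor (.id r)).comp (.assoc _ _ _)) g (ih.word_comp (.assocInv _ _ _))).of_eq
      (step_tensor_id _ _ _) (step_tensor_id _ _ _)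

theorem id_tensor {h : s.graph ⟶ t.graph} {φ : s.eval D ⟶ t.eval D} (c : Chain D n s t h φ)
    (r : LabelTree.{u}) : Chain D n (r.node s) (r.node t) (𝟙 r.graph ⊗ₘ h) (𝟙 (r.eval D) ⊗ₘ φ) :=
  (((c.tensor_id r).comp (word (.braid t r))).word_comp (.braid r s)).of_eq
    (id_tensor_eq_braid _) (id_tensor_eq_braid _)

theorem tensor {h : s.graph ⟶ t.graph} {φ : s.eval D ⟶ t.eval D} (c : Chain D n s t h φ)
    {s' t' : LabelTree.{u}} {k : s'.graph ⟶ t'.graph} {ψ : s'.eval D ⟶ t'.eval D}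
    (d : Chain D m s' t' k ψ) :
    Chain D (n + m) (s.node s') (t.node t') (h ⊗ₘ k) (φ ⊗ₘ ψ) :=
  ((c.tensor_id s').comp (d.id_tensor t)).of_eq (tensor_eq_comp _ _) (tensor_eq_comp _ _)

theorem atom {a b : LabelTree.{u}} (g : Atom a b) :
    Chain D 1 a b (g.eval tautological) (g.eval D) :=
  ((step (.rightUnitorInv a) g (word (.id _))).comp (word (.rightUnitor b))).of_eq
    (eq_unitor_step _) (eq_unitor_step _)

theorem card_atom {a b : LabelTree.{u}} (g : Atom a b) :
    Nat.card a.graph.F = Nat.card b.graph.F + 2 := by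
  cases g with
  | loop L i i' hne hc => exact natCard_remove' hne
  | edge L M i i' hc => exact natCard_remove' (Sum.inl_ne_inr (a := i) (b := i'))

/-- Words preserve flags and each elementary contraction removes two. The length of a chain is thus
an invariant of its ends, which makes induction on the length possible. -/
theorem card_eq {h : s.graph ⟶ t.graph} {φ : s.eval D ⟶ t.eval D} (c : Chain D n s t h φ) :
    Nat.card s.graph.F = Nat.card t.graph.F + 2 * n := by
  have card_word : ∀ {s t : LabelTree.{u}} (f : Word s t),
      Nat.card s.graph.F = Nat.card t.graph.F := fun f =>
    (Nat.card_congr (Equiv.ofBijective _ (bijective_onF (f.iso tautological_compatible)))).symm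
  induction c with
  | word f => exact card_word f
  | @step n s a b r t _ _ e g c ih =>
    have e1 : Nat.card (a.node r).graph.F = Nat.card a.graph.F + Nat.card r.graph.F := Nat.card_sum
    have e2 : Nat.card (b.node r).graph.F = Nat.card b.graph.F + Nat.card r.graph.F := Nat.card_sum
    rw [card_word e, e1, card_atom g]
    omega

end Chain

end chain

/-! ### Uniqueness of the value of an elementary contraction -/

section atom

theorem Contracts.eq_or_swap {τ σ : Graph.{u}} {h : τ ⟶ σ} {p p' q q' : τ.F}
    (c : Contracts h p p') (d : Contracts h q q') : (q = p ∧ q' = p') ∨ (q = p' ∧ q' = p) := by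
  rcases c.eq_or q (by rw [d.ghost_eq]; exact d.ne.symm) with rfl | rfl
  · exact .inl ⟨rfl, d.ghost_eq.symm.trans c.ghost_eq⟩
  · exact .inr ⟨rfl, d.ghost_eq.symm.trans c.symm.ghost_eq⟩

variable {C : Type w} [Category.{v} C] [MonoidalCategory C] [SymmetricCategory C]
  {D : GluingData.{u} C}

theorem eq_comp_braiding {X Y Z : C} {f : X ⟶ Y ⊗ Z} {g : X ⟶ Z ⊗ Y} (h : f ≫ (β_ Y Z).hom = g) :
    f = g ≫ (β_ Z Y).hom := by
  rw [← h, Category.assoc, SymmetricCategory.symmetry, Category.comp_id]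

/-- Equivariance combined with symmetry, for a relabeling that matches the two flags in the opposite
order. -/
theorem relabel_comp_loop (hD : D.Compatible) {L L' : Label.{u}} (s : Relabeling L L') (i i' : L.I)
    (hne : i ≠ i') (hc : L.color i = L.color i') :
    (D.relabel s).hom ≫ D.loop L' (s i') (s i) (s.map_ne hne.symm) (s.map_color s hc.symm) =
      D.loop L i i' hne hc ≫
        (D.relabel ((Relabeling.loopSymm L i i' hne hc).trans (s.loop i' i hne.symm hc.symm))).hom := by
  rw [hD.relabel_trans, ← Category.assoc, hD.loop_symm, hD.relabel_loop]

theorem braid_comp_edge (hD : D.Compatible) {L L' M M' : Label.{u}} (s : Relabeling L L')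
    (t : Relabeling M M') (i : L.I) (i' : M.I) (hc : L.color i = M.color i') :
    (((D.relabel s).hom ⊗ₘ (D.relabel t).hom) ≫ (β_ (D.obj L') (D.obj M')).hom) ≫
        D.edge M' L' (t i') (s i) (s.map_color t hc).symm =
      D.edge L M i i' hc ≫
        (D.relabel ((s.edge t i i' hc).trans (Relabeling.edgeSymm L' M' _ _ (s.map_color t hc)))).hom := by
  rw [hD.relabel_trans, ← Category.assoc, hD.relabel_edge, Category.assoc, Category.assoc,
    ← hD.edge_symm]

/-- A word between two leaves may pass through larger trees with additional units. Coherence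
replaces it by a single relabeling, because every isomorphism of corollas is one. -/
theorem eval_eq_relabel (hD : D.Compatible) {L M : Label.{u}} (x : Word (.leaf L) (.leaf M)) :
    ∃ s : Relabeling L M, x.hom = (relabelIso s).hom ∧ x.eval D = (D.relabel s).hom := by
  obtain ⟨s, hs⟩ := exists_eq_relabelIso (x.iso tautological_compatible)
  exact ⟨s, hs, Word.eval_eq hD (g := .relabel s) hs⟩

theorem eval_eq_tensor (hD : D.Compatible) {s t s' t' : LabelTree.{u}}
    (x : Word (s.node s') (t.node t'))
    (hl : ∀ a, ∃ b, Hom.onV x.hom (Sum.inl a) = Sum.inl b)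
    (hr : ∀ a, ∃ b, Hom.onV x.hom (Sum.inr a) = Sum.inr b) :
    ∃ (f : Word s t) (g : Word s' t'), x.hom = (f.tensor g).hom ∧
      x.eval D = (f.tensor g).eval D := by
  obtain ⟨h, k, e⟩ := exists_eq_tensor (x.iso tautological_compatible) hl hr
  obtain ⟨f, hf⟩ := Word.exists_hom_eq h
  obtain ⟨g, hg⟩ := Word.exists_hom_eq k
  have e' : x.hom = (f.tensor g).hom := e.trans (congrArg₂ (fun x y => x ⊗ₘ y) hf.symm hg.symm)
  exact ⟨f, g, e', Word.eval_eq hD e'⟩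

/-- Comparing contracted pairs in graphs shows that `s` matches the two pairs, in one of the two
orders. In either case `t` is forced because contractions are epimorphisms, and the relations for
`D` give the claim. -/
theorem loop_naturality (hD : D.Compatible) {L L' : Label.{u}} {i i' : L.I} {hne : i ≠ i'}
    {hc : L.color i = L.color i'} {j j' : L'.I} {hne' : j ≠ j'} {hc' : L'.color j = L'.color j'}
    (s : Relabeling L L') (t : Relabeling (L.loop i i' hne hc) (L'.loop j j' hne' hc'))
    (h : loopHom L i i' hne hc ≫ (relabelIso t).hom =
      (relabelIso s).hom ≫ loopHom L' j j' hne' hc') :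
    D.loop L i i' hne hc ≫ (D.relabel t).hom = (D.relabel s).hom ≫ D.loop L' j j' hne' hc' := by
  have hG := tautological_compatible.{u}
  have c := (contracts_loopHom hne' hc').iso_comp (relabelIso s)
  rw [← h] at c
  have e : ∀ {x y}, x = Hom.onF (relabelIso s).hom y → s x = y := by
    rintro _ y rfl
    exact s.equiv.apply_symm_apply y
  rcases c.eq_or_swap ((contracts_loopHom hne hc).comp_iso (relabelIso t)) with ⟨hi, hi'⟩ | ⟨hi, hi'⟩
  · obtain rfl := e hi
    obtain rfl := e hi'
    have : t = s.loop i i' hne hc := relabelIso_injective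
      ((cancel_epi (loopHom L i i' hne hc)).1 (h.trans (hG.relabel_loop s i i' hne hc).symm))
    rw [this, hD.relabel_loop]
  · obtain rfl := e hi
    obtain rfl := e hi'
    have : t = (Relabeling.loopSymm L i i' hne hc).trans (s.loop i' i hne.symm hc.symm) :=
      relabelIso_injective ((cancel_epi (loopHom L i i' hne hc)).1
        (h.trans (relabel_comp_loop hG s i i' hne hc)))
    rw [this, relabel_comp_loop hD]

theorem edge_naturality (hD : D.Compatible) {L L' M M' : Label.{u}} {i : L.I} {i' : M.I}
    {hc : L.color i = M.color i'} {j : L'.I} {j' : M'.I} {hc' : L'.color j = M'.color j'}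
    (s : Relabeling L L') (s' : Relabeling M M')
    (t : Relabeling (L.edge M i i' hc) (L'.edge M' j j' hc'))
    (h : edgeHom L M i i' hc ≫ (relabelIso t).hom =
      ((relabelIso s).hom ⊗ₘ (relabelIso s').hom) ≫ edgeHom L' M' j j' hc') :
    D.edge L M i i' hc ≫ (D.relabel t).hom =
      ((D.relabel s).hom ⊗ₘ (D.relabel s').hom) ≫ D.edge L' M' j j' hc' := by
  have c := (contracts_edgeHom hc').iso_comp (tensorIso (relabelIso s) (relabelIso s'))
  rw [tensorIso_hom, ← h] at c
  rcases c.eq_or_swap ((contracts_edgeHom hc).comp_iso (relabelIso t)) with ⟨hi, hi'⟩ | ⟨hi, hi'⟩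
  · have e : s i = j := (s.equiv.symm_apply_eq.1 (Sum.inl_injective hi).symm).symm
    have e' : s' i' = j' := (s'.equiv.symm_apply_eq.1 (Sum.inr_injective hi').symm).symm
    obtain rfl := e
    obtain rfl := e'
    have : t = s.edge s' i i' hc := relabelIso_injective
      ((cancel_epi (edgeHom L M i i' hc)).1
        (h.trans (tautological_compatible.relabel_edge s s' i i' hc).symm))
    rw [this, hD.relabel_edge]
  · exact absurd hi Sum.inl_ne_inr

/-- The case in which the isomorphism exchanges the two corollas; here the symmetry of the edge
gluing enters. -/
theorem edge_naturality_swap (hD : D.Compatible) {L L' M M' : Label.{u}} {i : L.I} {i' : M.I}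
    {hc : L.color i = M.color i'} {j : L'.I} {j' : M'.I} {hc' : L'.color j = M'.color j'}
    (s : Relabeling L M') (s' : Relabeling M L')
    (t : Relabeling (L.edge M i i' hc) (L'.edge M' j j' hc'))
    (h : edgeHom L M i i' hc ≫ (relabelIso t).hom =
      (((relabelIso s).hom ⊗ₘ (relabelIso s').hom) ≫ (β_ (corolla M') (corolla L')).hom) ≫
        edgeHom L' M' j j' hc') :
    D.edge L M i i' hc ≫ (D.relabel t).hom =
      (((D.relabel s).hom ⊗ₘ (D.relabel s').hom) ≫ (β_ (D.obj M') (D.obj L')).hom) ≫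
        D.edge L' M' j j' hc' := by
  have c := (contracts_edgeHom hc').iso_comp
    (tensorIso (relabelIso s) (relabelIso s') ≪≫ β_ (corolla M') (corolla L'))
  rw [Iso.trans_hom, tensorIso_hom, ← h] at c
  rcases c.eq_or_swap ((contracts_edgeHom hc).comp_iso (relabelIso t)) with ⟨hi, hi'⟩ | ⟨hi, hi'⟩
  · exact absurd hi Sum.inl_ne_inr
  · have e : s i = j' := (s.equiv.symm_apply_eq.1 (Sum.inl_injective hi).symm).symm
    have e' : s' i' = j := (s'.equiv.symm_apply_eq.1 (Sum.inr_injective hi').symm).symm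
    obtain rfl := e
    obtain rfl := e'
    have : t = (s.edge s' i i' hc).trans (Relabeling.edgeSymm M' L' _ _ (s.map_color s' hc)) :=
      relabelIso_injective ((cancel_epi (edgeHom L M i i' hc)).1
        (h.trans (braid_comp_edge tautological_compatible s s' i i' hc)))
    rw [this, braid_comp_edge hD]

/-- Contracted flags mark the corollas that take part in an elementary contraction, so an
isomorphism compatible with contractions cannot confuse them with the remaining ones. -/
theorem exists_flag_of_atom {a b : LabelTree.{u}} (g : Atom a b) (v : a.graph.V) :
    ∃ f : a.graph.F, a.graph.bd f = v ∧ Hom.ghost (g.eval tautological) f ≠ f := by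
  cases g with
  | loop L i i' hne hc => exact ⟨i, rfl, fun e => hne (e.symm.trans (ghost_loopHom hne hc).1)⟩
  | edge L M i i' hc =>
    rcases v with v | v
    · exact ⟨Sum.inl i, rfl, fun e => Sum.inl_ne_inr (e.symm.trans (ghost_edgeHom hc).1)⟩
    · exact ⟨Sum.inr i', rfl, fun e => Sum.inl_ne_inr ((ghost_edgeHom hc).2.symm.trans e)⟩

/-- A loop cannot be matched with an edge because the numbers of vertices differ. Between edges, the
isomorphism keeps or exchanges the two corollas. Only the relabeling and symmetry relations are
involved, not the commutation of two gluings. -/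
theorem atom_naturality (hD : D.Compatible) {a b a' b' : LabelTree.{u}} (g : Atom a b)
    (g' : Atom a' b') (x : Word a a') (y : Word b b')
    (h : g.eval tautological ≫ y.hom = x.hom ≫ g'.eval tautological) :
    g.eval D ≫ y.eval D = x.eval D ≫ g'.eval D := by
  have hG := tautological_compatible.{u}
  cases g with
  | loop L i i' hne hc =>
    cases g' with
    | loop L' j j' hne' hc' =>
      obtain ⟨s, hs, hs'⟩ := eval_eq_relabel hD x
      obtain ⟨t, ht, ht'⟩ := eval_eq_relabel hD y
      rw [hs, ht] at h
      rw [hs', ht']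
      exact loop_naturality hD s t h
    | edge L' M' j j' hc' =>
      exact absurd ((bijective_onV (x.iso hG)).2 (Sum.inl PUnit.unit)) fun ⟨_, e⟩ =>
        absurd ((bijective_onV (x.iso hG)).2 (Sum.inr PUnit.unit)) fun ⟨_, e'⟩ =>
          Sum.inl_ne_inr (e.symm.trans e')
  | edge L M i i' hc =>
    have hne : Hom.onV x.hom (Sum.inl PUnit.unit) ≠ Hom.onV x.hom (Sum.inr PUnit.unit) :=
      (bijective_onV (x.iso hG)).1.ne Sum.inl_ne_inr
    cases g' with
    | loop L' j j' hne' hc' => exact absurd rfl hne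
    | edge L' M' j j' hc' =>
      obtain ⟨t, ht, ht'⟩ := eval_eq_relabel hD y
      rcases hl : Hom.onV x.hom (Sum.inl PUnit.unit) with k | k <;>
        rcases hr : Hom.onV x.hom (Sum.inr PUnit.unit) with l | l
      · exact absurd (hl.trans hr.symm) hne
      · obtain ⟨f, g, e1, e2⟩ := eval_eq_tensor hD x (fun _ => ⟨k, hl⟩) (fun _ => ⟨l, hr⟩)
        obtain ⟨s, hf, hf'⟩ := eval_eq_relabel hD f
        obtain ⟨s', hg, hg'⟩ := eval_eq_relabel hD g
        have e3 : x.hom = (relabelIso s).hom ⊗ₘ (relabelIso s').hom :=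
          e1.trans (congrArg₂ (fun x y => x ⊗ₘ y) hf hg)
        have e4 : x.eval D = (D.relabel s).hom ⊗ₘ (D.relabel s').hom :=
          e2.trans (congrArg₂ (fun x y => x ⊗ₘ y) hf' hg')
        have e5 := edge_naturality hD s s' t
          ((congrArg (fun y => edgeHom L M i i' hc ≫ y) ht).symm.trans
            (h.trans (congrArg (fun x => x ≫ edgeHom L' M' j j' hc') e3)))
        exact (congrArg (fun y => D.edge L M i i' hc ≫ y) ht').trans
          (e5.trans (congrArg (fun x => x ≫ D.edge L' M' j j' hc') e4).symm)
      · obtain ⟨f, g, e1, e2⟩ := eval_eq_tensor hD (x.comp (.braid (.leaf L') (.leaf M')))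
          (fun _ => ⟨k, congrArg (Hom.onV (β_ (corolla L') (corolla M')).hom) hl⟩)
          (fun _ => ⟨l, congrArg (Hom.onV (β_ (corolla L') (corolla M')).hom) hr⟩)
        obtain ⟨s, hf, hf'⟩ := eval_eq_relabel hD f
        obtain ⟨s', hg, hg'⟩ := eval_eq_relabel hD g
        have e3 : x.hom = ((relabelIso s).hom ⊗ₘ (relabelIso s').hom) ≫
            (β_ (corolla M') (corolla L')).hom :=
          eq_comp_braiding (e1.trans (congrArg₂ (fun x y => x ⊗ₘ y) hf hg))
        have e4 : x.eval D = ((D.relabel s).hom ⊗ₘ (D.relabel s').hom) ≫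
            (β_ (D.obj M') (D.obj L')).hom :=
          eq_comp_braiding (e2.trans (congrArg₂ (fun x y => x ⊗ₘ y) hf' hg'))
        have e5 := edge_naturality_swap hD s s' t
          ((congrArg (fun y => edgeHom L M i i' hc ≫ y) ht).symm.trans
            (h.trans (congrArg (fun x => x ≫ edgeHom L' M' j j' hc') e3)))
        exact (congrArg (fun y => D.edge L M i i' hc ≫ y) ht').trans
          (e5.trans (congrArg (fun x => x ≫ D.edge L' M' j j' hc') e4).symm)
      · exact absurd (hl.trans hr.symm) hne

end atom

/-! ### Uniqueness of the value of a single contraction -/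

section single

theorem comp_step_comm {C : Type w} [Category.{v} C] [MonoidalCategory C] {A B A' B' R R' : C}
    {g : A ⟶ B} {g' : A' ⟶ B'} {x : A ⟶ A'} {y : B ⟶ B'} {z z' : R ⟶ R'} (h : g ≫ y = x ≫ g')
    (hz : z' = z) : (g ⊗ₘ 𝟙 R) ≫ (y ⊗ₘ z') = (x ⊗ₘ z) ≫ (g' ⊗ₘ 𝟙 R') := by
  rw [tensorHom_comp_tensorHom, tensorHom_comp_tensorHom, h, hz, Category.id_comp, Category.comp_id]

theorem step_comm_inv {C : Type w} [Category.{v} C] {X Y X' Y' : C} (i : X ≅ X') (j : Y ≅ Y')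
    {g : X ⟶ Y} {g' : X' ⟶ Y'} (h : g ≫ j.hom = i.hom ≫ g') : g' ≫ j.inv = i.inv ≫ g := by
  rw [Iso.comp_inv_eq, Category.assoc, h, Iso.inv_hom_id_assoc]

theorem step_comm_of_eq {C : Type w} [Category.{v} C] {S T X Y X' Y' : C} (e : S ≅ X) (e' : S ≅ X')
    (f : Y ≅ T) (f' : Y' ≅ T) {g : X ⟶ Y} {g' : X' ⟶ Y'} :
    e.hom ≫ g ≫ f.hom = e'.hom ≫ g' ≫ f'.hom ↔
      g ≫ f.hom ≫ f'.inv = (e.inv ≫ e'.hom) ≫ g' := by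
  rw [Category.assoc, Iso.eq_inv_comp, ← Category.assoc, ← Category.assoc, ← Category.assoc,
    ← Category.assoc (e.hom ≫ g), Iso.comp_inv_eq]

/-- Every vertex of `a` carries a contracted flag; by commutativity its counterpart is contracted as
well, and hence lies over `a'`. -/
theorem exists_onV_inl {a b r a' b' r' : LabelTree.{u}} (g : Atom a b) (g' : Atom a' b')
    (x : (a.node r).graph ≅ (a'.node r').graph) (y : (b.node r).graph ≅ (b'.node r').graph)
    (h : g.step tautological r ≫ y.hom = x.hom ≫ g'.step tautological r') (v : a.graph.V) :
    ∃ v', Hom.onV x.hom (Sum.inl v) = Sum.inl v' := by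
  obtain ⟨f, rfl, hf⟩ := exists_flag_of_atom g v
  obtain ⟨f', hf'⟩ := (bijective_onF x).2 (Sum.inl f)
  have e : Hom.ghost (g.step tautological r ≫ y.hom) (Sum.inl f) ≠ Sum.inl f := by
    exact fun e => hf (Sum.inl_injective
      ((ghost_comp_of_right (g.step tautological r) y.hom (ghost_iso y) (Sum.inl f)).symm.trans e))
  have e' := Hom.bd_onF x.hom f'
  rw [hf'] at e'
  rcases f' with f' | f'
  · exact ⟨_, e'⟩
  · have e₂ : Hom.ghost (x.hom ≫ g'.step tautological r') (Hom.onF x.hom (Sum.inr f')) =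
        Hom.onF x.hom (Sum.inr f') := ghost_comp_onF _ _ _
    rw [hf', ← h] at e₂
    exact absurd e₂ e

variable {C : Type w} [Category.{v} C] [MonoidalCategory C] [SymmetricCategory C]
  {D : GluingData.{u} C}

/-- The word `x` matches contracted corollas with contracted ones and, by the same argument for its
inverse, spectators with spectators. So `x` and `y` are tensor products, the equation of graph
morphisms splits, and its parts are `atom_naturality` and coherence. -/
theorem step_naturality (hD : D.Compatible) {a b r a' b' r' : LabelTree.{u}} (g : Atom a b)
    (g' : Atom a' b') (x : Word (a.node r) (a'.node r')) (y : Word (b.node r) (b'.node r'))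
    (h : g.step tautological r ≫ y.hom = x.hom ≫ g'.step tautological r') :
    g.step D r ≫ y.eval D = x.eval D ≫ g'.step D r' := by
  have hG := tautological_compatible.{u}
  have hx := exists_onV_inl g g' (x.iso hG) (y.iso hG) h
  have hx' : ∀ w : r.graph.V, ∃ w', Hom.onV x.hom (Sum.inr w) = Sum.inr w' := by
    intro w
    rcases hw : Hom.onV x.hom (Sum.inr w) with v | v
    · obtain ⟨v', hv'⟩ := exists_onV_inl g' g (x.iso hG).symm (y.iso hG).symm
        (step_comm_inv (x.iso hG) (y.iso hG) h) v
      have := onV_inv_onV (x.iso hG) (Sum.inr w)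
      exact absurd (hv'.symm.trans ((congrArg (Hom.onV x.inv.hom) hw.symm).trans this))
        Sum.inl_ne_inr
    · exact ⟨v, rfl⟩
  have hV : ∀ v, Hom.onV y.hom (Hom.onV (g.step tautological r) v) =
      Hom.onV (g'.step tautological r') (Hom.onV x.hom v) :=
    fun v => congrFun (congrArg Hom.onV h) v
  have hy : ∀ v : b.graph.V, ∃ v', Hom.onV y.hom (Sum.inl v) = Sum.inl v' := by
    intro v
    obtain ⟨v, rfl⟩ := Hom.onV_surj (g.eval tautological) v
    obtain ⟨v', hv'⟩ := hx v
    exact ⟨_, (hV (Sum.inl v)).trans (congrArg (Hom.onV (g'.step tautological r')) hv')⟩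
  have hy' : ∀ w : r.graph.V, ∃ w', Hom.onV y.hom (Sum.inr w) = Sum.inr w' := by
    intro w
    obtain ⟨w', hw'⟩ := hx' w
    exact ⟨_, (hV (Sum.inr w)).trans (congrArg (Hom.onV (g'.step tautological r')) hw')⟩
  obtain ⟨x₁, x₂, e1, e2⟩ := eval_eq_tensor hD x hx hx'
  obtain ⟨y₁, y₂, e3, e4⟩ := eval_eq_tensor hD y hy hy'
  have e5 : (g.eval tautological ≫ y₁.hom) ⊗ₘ (𝟙 r.graph ≫ y₂.hom) =
      (x₁.hom ≫ g'.eval tautological) ⊗ₘ (x₂.hom ≫ 𝟙 r'.graph) :=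
    (tensorHom_comp_tensorHom _ _ _ _).symm.trans
      (((congrArg (fun z => g.step tautological r ≫ z) e3).symm.trans
        (h.trans (congrArg (fun z => z ≫ g'.step tautological r') e1))).trans
          (tensorHom_comp_tensorHom _ _ _ _))
  obtain ⟨e6, e7⟩ := tensor_injective e5
  rw [Category.id_comp, Category.comp_id] at e7
  exact (congrArg (fun z => g.step D r ≫ z) e4).trans
    ((comp_step_comm (atom_naturality hD g g' x₁ y₁ e6) (Word.eval_eq hD e7)).trans
      (congrArg (fun z => z ≫ g'.step D r') e2).symm)

namespace Chain

variable {s t : LabelTree.{u}} {h h' : s.graph ⟶ t.graph} {φ φ' : s.eval D ⟶ t.eval D}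

theorem zero_unique (hD : D.Compatible) (c : Chain D 0 s t h φ) (c' : Chain D 0 s t h φ') :
    φ = φ' := by
  cases c with
  | word f =>
  -- The case distinction on the second chain needs a variable as index in place of `f.hom`.
  generalize hk : f.hom = k at c'
  cases c' with
  | word f' => exact Word.eval_eq hD hk

theorem exists_of_one (c : Chain D 1 s t h φ) :
    ∃ (a b r : LabelTree.{u}) (e : Word s (a.node r)) (g : Atom a b) (f : Word (b.node r) t),
      h = e.hom ≫ g.step tautological r ≫ f.hom ∧ φ = e.eval D ≫ g.step D r ≫ f.eval D := by
  cases c with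
  | step e g c =>
  cases c with
  | word f => exact ⟨_, _, _, e, g, f, rfl, rfl⟩

/-- Moving the words before and after the contraction to one side turns the equality of two
factorizations into a commutative square between two contractions. -/
theorem one_unique (hD : D.Compatible) (c : Chain D 1 s t h φ) (c' : Chain D 1 s t h φ') :
    φ = φ' := by
  have hG := tautological_compatible.{u}
  obtain ⟨a, b, r, e, g, f, rfl, rfl⟩ := c.exists_of_one
  obtain ⟨a', b', r', e', g', f', h1, rfl⟩ := c'.exists_of_one
  exact (step_comm_of_eq (e.iso hD) (e'.iso hD) (f.iso hD) (f'.iso hD)).2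
    (step_naturality hD g g' (e.inv.comp e') (f.comp f'.inv)
      ((step_comm_of_eq (e.iso hG) (e'.iso hG) (f.iso hG) (f'.iso hG)).1 h1))

end Chain

end single

/-! ### Confluence -/

section extraction

theorem exists_flag_inl {τ σ ρ : Graph.{u}} (w : τ ≅ σ ⊗ ρ) {f : τ.F} {a : σ.V}
    (h : Hom.onV w.hom (τ.bd f) = Sum.inl a) :
    ∃ y : σ.F, Hom.onF w.hom (Sum.inl y) = f ∧ σ.bd y = a := by
  obtain ⟨y, rfl⟩ := (bijective_onF w).2 f
  have e := (Hom.bd_onF w.hom y).symm.trans h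
  rcases y with y | y
  · exact ⟨y, rfl, Sum.inl_injective e⟩
  · exact absurd e Sum.inr_ne_inl

theorem exists_flag_inr {τ σ ρ : Graph.{u}} (w : τ ≅ σ ⊗ ρ) {f : τ.F}
    (h : ∀ a, Hom.onV w.hom (τ.bd f) ≠ Sum.inl a) :
    ∃ y : ρ.F, Hom.onF w.hom (Sum.inr y) = f := by
  obtain ⟨y, rfl⟩ := (bijective_onF w).2 f
  have e := Hom.bd_onF w.hom y
  rcases y with y | y
  · exact absurd e (h _)
  · exact ⟨y, rfl⟩

theorem exists_flag_inl_inl {τ σ : Graph.{u}} {f : (τ ⊗ σ).F} {a : τ.V}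
    (h : (τ ⊗ σ).bd f = Sum.inl a) : ∃ y : τ.F, f = Sum.inl y ∧ τ.bd y = a := by
  rcases f with f | f
  · exact ⟨f, rfl, Sum.inl_injective h⟩
  · exact absurd h Sum.inr_ne_inl

theorem exists_flag_inl_inr {τ σ : Graph.{u}} {f : (τ ⊗ σ).F} {a : σ.V}
    (h : (τ ⊗ σ).bd f = Sum.inr a) : ∃ y : σ.F, f = Sum.inr y ∧ σ.bd y = a := by
  rcases f with f | f
  · exact absurd h Sum.inl_ne_inr
  · exact ⟨f, rfl, Sum.inr_injective h⟩

theorem exists_extract_one (s : LabelTree.{u}) (v : s.graph.V) :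
    ∃ (L : Label.{u}) (r : LabelTree.{u}) (w : Word s ((LabelTree.leaf L).node r)),
      Hom.onV w.hom v = Sum.inl PUnit.unit :=
  ⟨_, _, s.extract v, s.onV_extract v⟩

/-- The new vertex is extracted from the remainder only, so the vertices already collected in `a`
stay in place. -/
theorem exists_extract_snd (s : LabelTree.{u}) {a r : LabelTree.{u}} (w : Word s (a.node r))
    (v : s.graph.V) (hv : ∀ b, Hom.onV w.hom v ≠ Sum.inl b) :
    ∃ (L : Label.{u}) (r' : LabelTree.{u}) (w' : Word s ((a.node (.leaf L)).node r')),
      Hom.onV w'.hom v = Sum.inl (Sum.inr PUnit.unit) ∧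
      ∀ x b, Hom.onV w.hom x = Sum.inl b → Hom.onV w'.hom x = Sum.inl (Sum.inl b) := by
  rcases hx : Hom.onV w.hom v with x | x
  · exact absurd hx (hv x)
  · refine ⟨_, _, w.comp ((Word.tensor (.id a) (r.extract x)).comp (.assocInv _ _ _)), ?_, ?_⟩
    · exact (congrArg (Hom.onV ((Word.tensor (.id a) (r.extract x)).comp (.assocInv _ _ _)).hom)
        hx).trans (congrArg (fun y => Hom.onV (Word.assocInv a (.leaf (r.lab x)) (r.rem x)).hom
          (Sum.inr y)) (r.onV_extract x))
    · intro y b hy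
      exact congrArg (Hom.onV ((Word.tensor (.id a) (r.extract x)).comp (.assocInv _ _ _)).hom) hy

theorem exists_extract_two (s : LabelTree.{u}) {v v' : s.graph.V} (hne : v' ≠ v) :
    ∃ (L M : Label.{u}) (r : LabelTree.{u})
      (w : Word s (((LabelTree.leaf L).node (.leaf M)).node r)),
      Hom.onV w.hom v = Sum.inl (Sum.inl PUnit.unit) ∧
      Hom.onV w.hom v' = Sum.inl (Sum.inr PUnit.unit) := by
  obtain ⟨L, r, w, hw⟩ := exists_extract_one s v
  obtain ⟨M, r', w', h, h'⟩ := exists_extract_snd s w v' fun b e =>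
    hne ((bijective_onV (w.iso tautological_compatible)).1 (e.trans hw.symm))
  exact ⟨L, M, r', w', h' _ _ hw, h⟩

theorem exists_extract_three (s : LabelTree.{u}) {v v' v'' : s.graph.V} (h₁ : v' ≠ v)
    (h₂ : v'' ≠ v) (h₃ : v'' ≠ v') :
    ∃ (L M N : Label.{u}) (r : LabelTree.{u})
      (w : Word s ((((LabelTree.leaf L).node (.leaf M)).node (.leaf N)).node r)),
      Hom.onV w.hom v = Sum.inl (Sum.inl (Sum.inl PUnit.unit)) ∧
      Hom.onV w.hom v' = Sum.inl (Sum.inl (Sum.inr PUnit.unit)) ∧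
      Hom.onV w.hom v'' = Sum.inl (Sum.inr PUnit.unit) := by
  obtain ⟨L, M, r, w, hw, hw'⟩ := exists_extract_two s h₁
  have hi := (bijective_onV (w.iso tautological_compatible)).1
  obtain ⟨N, r', w', h, h'⟩ := exists_extract_snd s w v'' fun b e => by
    rcases b with b | b
    · exact h₂ (hi (e.trans hw.symm))
    · exact h₃ (hi (e.trans hw'.symm))
  exact ⟨L, M, N, r', w', h' _ _ hw, h' _ _ hw', h⟩

/-- Every pair of flags of the same colour can be contracted. -/
theorem exists_atom (s : LabelTree.{u}) {p p' : s.graph.F} (hne : p ≠ p')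
    (hc : s.graph.color p = s.graph.color p') :
    ∃ (a b r : LabelTree.{u}) (e : Word s (a.node r)) (g : Atom a b) (x x' : a.graph.F),
      Hom.onF e.hom (Sum.inl x) = p ∧ Hom.onF e.hom (Sum.inl x') = p' ∧
      Contracts (g.eval tautological) x x' ∧
      ∀ f, s.graph.bd f ≠ s.graph.bd p → s.graph.bd f ≠ s.graph.bd p' →
        ∃ y, Hom.onF e.hom (Sum.inr y) = f := by
  have hG := tautological_compatible.{u}
  by_cases hv : s.graph.bd p' = s.graph.bd p
  · obtain ⟨L, r, e, he⟩ := exists_extract_one s (s.graph.bd p)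
    obtain ⟨i, rfl, -⟩ := exists_flag_inl (e.iso hG) he
    obtain ⟨i', rfl, -⟩ := exists_flag_inl (e.iso hG) ((congrArg (Hom.onV e.hom) hv).trans he)
    have hne' : i ≠ i' := fun e => hne (by rw [e])
    have hc' : L.color i = L.color i' :=
      (Hom.color_onF e.hom (Sum.inl i)).symm.trans (hc.trans (Hom.color_onF e.hom (Sum.inl i')))
    refine ⟨_, _, r, e, .loop L i i' hne' hc', i, i', rfl, rfl, contracts_loopHom hne' hc', ?_⟩
    intro f hf _
    exact exists_flag_inr (e.iso hG) fun a h =>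
      hf ((bijective_onV (e.iso hG)).1 (h.trans he.symm))
  · obtain ⟨L, M, r, e, he, he'⟩ := exists_extract_two s hv
    obtain ⟨y, rfl, hy⟩ := exists_flag_inl (e.iso hG) he
    obtain ⟨i, rfl, -⟩ := exists_flag_inl_inl hy
    obtain ⟨y', rfl, hy'⟩ := exists_flag_inl (e.iso hG) he'
    obtain ⟨i', rfl, -⟩ := exists_flag_inl_inr hy'
    have hc' : L.color i = M.color i' :=
      (Hom.color_onF e.hom (Sum.inl (Sum.inl i))).symm.trans
        (hc.trans (Hom.color_onF e.hom (Sum.inl (Sum.inr i'))))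
    refine ⟨_, _, r, e, .edge L M i i' hc', Sum.inl i, Sum.inr i', rfl, rfl,
      contracts_edgeHom hc', ?_⟩
    intro f hf hf'
    exact exists_flag_inr (e.iso hG) fun a h => by
      rcases a with a | a
      · exact hf ((bijective_onV (e.iso hG)).1 (h.trans he.symm))
      · exact hf' ((bijective_onV (e.iso hG)).1 (h.trans he'.symm))

end extraction

/-! ### Existence of chains, commuting contractions, and uniqueness of values -/

section confluence

variable {C : Type w} [Category.{v} C] [MonoidalCategory C]

theorem comp_tensor_id {X Y Z : C} (f : X ⟶ Y) (g : Y ⟶ Z) (W : C) :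
    (f ≫ g) ⊗ₘ 𝟙 W = (f ⊗ₘ 𝟙 W) ≫ (g ⊗ₘ 𝟙 W) := by
  rw [tensorHom_comp_tensorHom, Category.comp_id]

theorem tensor_eq_comp' {X Y X' Y' : C} (f : X ⟶ Y) (g : X' ⟶ Y') :
    f ⊗ₘ g = (𝟙 X ⊗ₘ g) ≫ (f ⊗ₘ 𝟙 Y') := by
  rw [tensorHom_comp_tensorHom, Category.id_comp, Category.comp_id]

variable [SymmetricCategory C] {D : GluingData.{u} C}

theorem Chain.loop (D : GluingData.{u} C) (L : Label.{u}) (i i' : L.I) (hne : i ≠ i')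
    (hc : L.color i = L.color i') :
    Chain D 1 (.leaf L) (.leaf (L.loop i i' hne hc)) (loopHom L i i' hne hc)
      (D.loop L i i' hne hc) :=
  Chain.atom (.loop L i i' hne hc)

theorem Chain.edge (D : GluingData.{u} C) (L M : Label.{u}) (i : L.I) (i' : M.I)
    (hc : L.color i = M.color i') :
    Chain D 1 (.node (.leaf L) (.leaf M)) (.leaf (L.edge M i i' hc)) (edgeHom L M i i' hc)
      (D.edge L M i i' hc) :=
  Chain.atom (.edge L M i i' hc)

theorem Chain.relabel (D : GluingData.{u} C) {L M : Label.{u}} (s : Relabeling L M) :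
    Chain D 0 (.leaf L) (.leaf M) (relabelIso s).hom (D.relabel s).hom :=
  Chain.word (.relabel s)

theorem exists_chain_one (D : GluingData.{u} C) (s : LabelTree.{u}) {p p' : s.graph.F} (hne : p ≠ p')
    (hc : s.graph.color p = s.graph.color p') :
    ∃ (u : LabelTree.{u}) (k : s.graph ⟶ u.graph) (κ : s.eval D ⟶ u.eval D),
      Chain D 1 s u k κ ∧ Contracts k p p' := by
  obtain ⟨a, b, r, e, g, x, x', rfl, rfl, c, -⟩ := exists_atom s hne hc
  exact ⟨_, _, _, ((Chain.atom g).tensor_id r).word_comp e,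
    (c.tensor_left r.graph).iso_comp (e.iso tautological_compatible)⟩

/-- If nothing is contracted, the morphism is an isomorphism and hence a word. Otherwise contracting
one of its pairs first leaves a morphism with fewer flags in its source. -/
theorem Chain.exists_chain_of_card (D : GluingData.{u} C) (n : ℕ) :
    ∀ {s t : LabelTree.{u}} (h : s.graph ⟶ t.graph), Nat.card s.graph.F = n →
      ∃ m φ, Chain D m s t h φ := by
  induction n using Nat.strong_induction_on with
  | _ n ih =>
  intro s t h hn
  by_cases hh : ∀ f, Hom.ghost h f = f
  · have := isIso_of_ghost h hh s.j_graph t.j_graph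
    obtain ⟨f, hf⟩ := Word.exists_hom_eq (asIso h)
    exact ⟨0, f.eval D, (Chain.word f).of_eq hf.symm rfl⟩
  · push Not at hh
    obtain ⟨p, hp⟩ := hh
    obtain ⟨u, k, κ, c, ck⟩ := exists_chain_one D s hp.symm (Hom.color_ghost h p).symm
    obtain ⟨m, rfl⟩ := exists_factor u.j_graph h k (ck.ghost_eq_of_ne rfl)
    have := c.card_eq
    obtain ⟨l, φ, d⟩ := ih _ (by omega) m rfl
    exact ⟨_, _, c.comp d⟩

/-- Every morphism is a composition of structural words and elementary contractions. -/
theorem Chain.exists_chain (D : GluingData.{u} C) {s t : LabelTree.{u}} (h : s.graph ⟶ t.graph) :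
    ∃ n φ, Chain D n s t h φ :=
  Chain.exists_chain_of_card D _ h rfl

theorem Chain.exists_contracts {s t : LabelTree.{u}} {h : s.graph ⟶ t.graph}
    {φ : s.eval D ⟶ t.eval D} (c : Chain D 1 s t h φ) : ∃ p p', Contracts h p p' := by
  obtain ⟨a, b, r, e, g, f, rfl, -⟩ := c.exists_of_one
  have hg : ∃ p p', Contracts (g.eval tautological) p p' := by
    cases g with
    | loop L i i' hne hc => exact ⟨_, _, contracts_loopHom hne hc⟩
    | edge L M i i' hc => exact ⟨_, _, contracts_edgeHom hc⟩
  obtain ⟨p, p', cg⟩ := hg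
  exact ⟨_, _, ((cg.tensor_left r.graph).comp_iso (f.iso tautological_compatible)).iso_comp
    (e.iso tautological_compatible)⟩

/-- `h` has a chain with value `φ` which first contracts `p`, `p'` and then performs `n` further
contractions. -/
def Starts (D : GluingData.{u} C) (n : ℕ) (s t : LabelTree.{u}) (h : s.graph ⟶ t.graph)
    (φ : s.eval D ⟶ t.eval D) (p p' : s.graph.F) : Prop :=
  ∃ (u : LabelTree.{u}) (k : s.graph ⟶ u.graph) (κ : s.eval D ⟶ u.eval D) (h' : u.graph ⟶ t.graph)
    (φ' : u.eval D ⟶ t.eval D), Chain D 1 s u k κ ∧ Contracts k p p' ∧ Chain D n u t h' φ' ∧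
      h = k ≫ h' ∧ φ = κ ≫ φ'

theorem Chain.exists_starts {n : ℕ} {s t : LabelTree.{u}} {h : s.graph ⟶ t.graph}
    {φ : s.eval D ⟶ t.eval D} (c : Chain D (n + 1) s t h φ) : ∃ p p', Starts D n s t h φ p p' := by
  cases c with
  | @step _ _ a b r _ h' φ' e g c =>
    have d := ((Chain.atom (D := D) g).tensor_id r).word_comp e
    obtain ⟨p, p', hp⟩ := d.exists_contracts
    exact ⟨p, p', _, _, _, h', φ', d, hp, c, (Category.assoc _ _ _).symm,
      (Category.assoc _ _ _).symm⟩

namespace Starts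

variable {n m : ℕ} {s t r : LabelTree.{u}} {h : s.graph ⟶ t.graph} {φ φ' : s.eval D ⟶ t.eval D}
  {p p' : s.graph.F}

theorem symm (c : Starts D n s t h φ p p') : Starts D n s t h φ p' p := by
  obtain ⟨u, k, κ, h', φ', c, ck, d, e, e'⟩ := c
  exact ⟨u, k, κ, h', φ', c, ck.symm, d, e, e'⟩

theorem word_comp (w : Word r s) (c : Starts D n s t h φ p p') :
    Starts D n r t (w.hom ≫ h) (w.eval D ≫ φ) (Hom.onF w.hom p) (Hom.onF w.hom p') := by
  obtain ⟨u, k, κ, h', φ', c, ck, d, rfl, rfl⟩ := c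
  exact ⟨u, _, _, h', φ', c.word_comp w, ck.iso_comp (w.iso tautological_compatible), d,
    (Category.assoc _ _ _).symm, (Category.assoc _ _ _).symm⟩

theorem tensor_id (c : Starts D n s t h φ p p') (r : LabelTree.{u}) :
    Starts D n (s.node r) (t.node r) (h ⊗ₘ 𝟙 r.graph) (φ ⊗ₘ 𝟙 (r.eval D)) (Sum.inl p)
      (Sum.inl p') := by
  obtain ⟨u, k, κ, h', φ', c, ck, d, rfl, rfl⟩ := c
  exact ⟨u.node r, _, _, _, _, c.tensor_id r, ck.tensor_left r.graph, d.tensor_id r,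
    comp_tensor_id _ _ _, comp_tensor_id _ _ _⟩

theorem comp (c : Starts D n s t h φ p p') {k : t.graph ⟶ r.graph} {ψ : t.eval D ⟶ r.eval D}
    (d : Chain D m t r k ψ) : Starts D (n + m) s r (h ≫ k) (φ ≫ ψ) p p' := by
  obtain ⟨u, k, κ, h', φ', c, ck, d', rfl, rfl⟩ := c
  exact ⟨u, _, _, _, _, c, ck, d'.comp d, Category.assoc _ _ _, Category.assoc _ _ _⟩

theorem chain (c : Starts D n s t h φ p p') : Chain D (n + 1) s t h φ := by
  obtain ⟨u, k, κ, h', φ', c, ck, d, rfl, rfl⟩ := c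
  rw [Nat.add_comm]
  exact c.comp d

theorem contracts (c : Starts D n s t h φ p p') : p ≠ p' ∧ Hom.ghost h p = p' := by
  obtain ⟨u, k, κ, h', φ', c, ck, d, rfl, rfl⟩ := c
  exact ⟨ck.ne, ghost_comp_of_ne k h' ck.ghost_eq ck.ne.symm⟩

/-- Two contractions of the same pair differ by an isomorphism, that is, by a word. Absorbed into
the first step of one chain and the remainder of the other, it leaves uniqueness for length one and
the hypothesis for length `n`. -/
theorem unique (hD : D.Compatible) (ih : ∀ {s t : LabelTree.{u}} {h : s.graph ⟶ t.graph}
    {φ φ' : s.eval D ⟶ t.eval D}, Chain D n s t h φ → Chain D n s t h φ' → φ = φ')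
    (c : Starts D n s t h φ p p') (c' : Starts D n s t h φ' p p') : φ = φ' := by
  obtain ⟨u, k, κ, k', κ', c, ck, d, e, rfl⟩ := c
  obtain ⟨u₂, k₂, κ₂, k₂', κ₂', c₂, ck₂, d₂, rfl, rfl⟩ := c'
  obtain ⟨i, rfl⟩ := ck.exists_iso ck₂ u.j_graph u₂.j_graph
  obtain ⟨f, hf⟩ := Word.exists_hom_eq i
  rw [Category.assoc] at e
  have e₁ := (cancel_epi k).1 e
  have e₂ := Chain.one_unique hD ((c.comp (.word f)).of_eq (by rw [hf]) rfl) c₂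
  have e₃ := ih d ((d₂.word_comp f).of_eq (by rw [hf, e₁]) rfl)
  rw [← e₂, e₃, Category.assoc]

end Starts

/-- The two pairs of flags can be contracted in any order, with the same value. -/
def Diamond (D : GluingData.{u} C) (s : LabelTree.{u}) (p p' q q' : s.graph.F) : Prop :=
  ∃ (z : LabelTree.{u}) (h : s.graph ⟶ z.graph) (φ : s.eval D ⟶ z.eval D),
    Starts D 1 s z h φ p p' ∧ Starts D 1 s z h φ q q'

namespace Diamond

variable {s r : LabelTree.{u}} {p p' q q' : s.graph.F}

theorem symm_left (c : Diamond D s p p' q q') : Diamond D s p' p q q' := by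
  obtain ⟨z, h, φ, c, d⟩ := c
  exact ⟨z, h, φ, c.symm, d⟩

theorem symm_right (c : Diamond D s p p' q q') : Diamond D s p p' q' q := by
  obtain ⟨z, h, φ, c, d⟩ := c
  exact ⟨z, h, φ, c, d.symm⟩

theorem swap (c : Diamond D s p p' q q') : Diamond D s q q' p p' := by
  obtain ⟨z, h, φ, c, d⟩ := c
  exact ⟨z, h, φ, d, c⟩

theorem word_comp (w : Word r s) (c : Diamond D s p p' q q') : Diamond D r (Hom.onF w.hom p)
    (Hom.onF w.hom p') (Hom.onF w.hom q) (Hom.onF w.hom q') := by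
  obtain ⟨z, h, φ, c, d⟩ := c
  exact ⟨z, _, _, c.word_comp w, d.word_comp w⟩

theorem tensor_id (c : Diamond D s p p' q q') (r : LabelTree.{u}) :
    Diamond D (s.node r) (Sum.inl p) (Sum.inl p') (Sum.inl q) (Sum.inl q') := by
  obtain ⟨z, h, φ, c, d⟩ := c
  exact ⟨z.node r, _, _, c.tensor_id r, d.tensor_id r⟩

/-- The interchange law for tensor products; no relation between gluing maps is needed. -/
theorem disjoint {s' u u' : LabelTree.{u}} {k : s.graph ⟶ u.graph} {κ : s.eval D ⟶ u.eval D}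
    {k' : s'.graph ⟶ u'.graph} {κ' : s'.eval D ⟶ u'.eval D} {x x' : s'.graph.F}
    (c : Chain D 1 s u k κ) (ck : Contracts k p p') (d : Chain D 1 s' u' k' κ')
    (dk : Contracts k' x x') :
    Diamond D (s.node s') (Sum.inl p) (Sum.inl p') (Sum.inr x) (Sum.inr x') :=
  ⟨u.node u', k ⊗ₘ k', κ ⊗ₘ κ',
    ⟨_, _, _, _, _, c.tensor_id s', ck.tensor_left _, d.id_tensor u, tensor_eq_comp _ _,
      tensor_eq_comp _ _⟩,
    ⟨_, _, _, _, _, d.id_tensor s, dk.tensor_right _, c.tensor_id u',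
      tensor_eq_comp' _ _, tensor_eq_comp' _ _⟩⟩

/-- In this and the next three lemmas, a relation for `D` and the same relation for `tautological`
together make one diamond: the two sides are the two orders of contraction. -/
theorem loop_loop (hD : D.Compatible) (L : Label.{u}) (i₁ i₁' i₂ i₂' : L.I) (h₁ : i₁ ≠ i₁')
    (h₂ : i₂ ≠ i₂') (a : i₁ ≠ i₂) (b : i₁ ≠ i₂') (c : i₁' ≠ i₂) (d : i₁' ≠ i₂')
    (hc₁ : L.color i₁ = L.color i₁') (hc₂ : L.color i₂ = L.color i₂') :
    Diamond D (.leaf L) i₁ i₁' i₂ i₂' :=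
  ⟨_, _, _,
    ⟨_, _, _, _, _, Chain.loop D L i₁ i₁' h₁ hc₁, contracts_loopHom h₁ hc₁,
      Chain.loop D _ _ _ _ _, (tautological_compatible.loop_loop L _ _ _ _ h₁ h₂ a b c d hc₁ hc₂),
      (hD.loop_loop L _ _ _ _ h₁ h₂ a b c d hc₁ hc₂)⟩,
    ⟨_, _, _, _, _, Chain.loop D L i₂ i₂' h₂ hc₂, contracts_loopHom h₂ hc₂,
      (Chain.loop D _ _ _ _ _).comp (.relabel D _), rfl, rfl⟩⟩

theorem loop_edge (hD : D.Compatible) (L M : Label.{u}) (i₁ i₁' i₂ : L.I) (i₂' : M.I)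
    (h₁ : i₁ ≠ i₁') (a : i₁ ≠ i₂) (c : i₁' ≠ i₂) (hc₁ : L.color i₁ = L.color i₁')
    (hc₂ : L.color i₂ = M.color i₂') :
    Diamond D ((LabelTree.leaf L).node (.leaf M)) (Sum.inl i₁) (Sum.inl i₁') (Sum.inl i₂)
      (Sum.inr i₂') :=
  ⟨_, _, _,
    ⟨_, _, _, _, _, (Chain.loop D L i₁ i₁' h₁ hc₁).tensor_id (.leaf M),
      (contracts_loopHom h₁ hc₁).tensor_left _, Chain.edge D _ _ _ _ _,
      tautological_compatible.loop_edge L M _ _ _ _ h₁ a c hc₁ hc₂,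
      hD.loop_edge L M _ _ _ _ h₁ a c hc₁ hc₂⟩,
    ⟨_, _, _, _, _, Chain.edge D L M i₂ i₂' hc₂, contracts_edgeHom hc₂,
      (Chain.loop D _ _ _ _ _).comp (.relabel D _), rfl, rfl⟩⟩

theorem edge_loop (hD : D.Compatible) (L M : Label.{u}) (i₁ i₂ : L.I) (i₁' i₂' : M.I)
    (a : i₁ ≠ i₂) (a' : i₁' ≠ i₂') (hc₁ : L.color i₁ = M.color i₁')
    (hc₂ : L.color i₂ = M.color i₂') :
    Diamond D ((LabelTree.leaf L).node (.leaf M)) (Sum.inl i₁) (Sum.inr i₁') (Sum.inl i₂)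
      (Sum.inr i₂') :=
  ⟨_, _, _,
    ⟨_, _, _, _, _, Chain.edge D L M i₁ i₁' hc₁, contracts_edgeHom hc₁,
      (Chain.loop D _ _ _ _ _).comp (.relabel D _), rfl, rfl⟩,
    ⟨_, _, _, _, _, Chain.edge D L M i₂ i₂' hc₂, contracts_edgeHom hc₂,
      Chain.loop D _ _ _ _ _, tautological_compatible.edge_loop L M _ _ _ _ a a' hc₁ hc₂,
      hD.edge_loop L M _ _ _ _ a a' hc₁ hc₂⟩⟩

theorem edge_edge (hD : D.Compatible) (L M N : Label.{u}) (i₁ : L.I) (i₁' i₂ : M.I) (i₂' : N.I)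
    (a : i₁' ≠ i₂) (hc₁ : L.color i₁ = M.color i₁') (hc₂ : M.color i₂ = N.color i₂') :
    Diamond D (((LabelTree.leaf L).node (.leaf M)).node (.leaf N)) (Sum.inl (Sum.inl i₁))
      (Sum.inl (Sum.inr i₁')) (Sum.inl (Sum.inr i₂)) (Sum.inr i₂') :=
  ⟨_, _, _,
    ⟨_, _, _, _, _, (Chain.edge D L M i₁ i₁' hc₁).tensor_id (.leaf N),
      (contracts_edgeHom hc₁).tensor_left _,
      (Chain.edge D _ _ _ _ _).comp (.relabel D _), rfl, rfl⟩,
    ⟨_, _, _, _, _, ((Chain.edge D M N i₂ i₂' hc₂).id_tensor (.leaf L)).word_comp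
      (.assoc _ _ _), ((contracts_edgeHom hc₂).tensor_right (corolla L)).iso_comp
        (α_ (corolla L) (corolla M) (corolla N)),
      Chain.edge D _ _ _ _ _,
      (tautological_compatible.edge_edge L M N _ _ _ _ a hc₁ hc₂).trans
        (Category.assoc _ _ _).symm,
      (hD.edge_edge L M N _ _ _ _ a hc₁ hc₂).trans (Category.assoc _ _ _).symm⟩⟩

end Diamond

/-- Two disjoint pairs of flags, each of which can be contracted. -/
structure DisjointPairs (τ : Graph.{u}) (p p' q q' : τ.F) : Prop where
  ne_left : p ≠ p'
  ne_right : q ≠ q'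
  ne₁ : p ≠ q
  ne₂ : p ≠ q'
  ne₃ : p' ≠ q
  ne₄ : p' ≠ q'
  color_left : τ.color p = τ.color p'
  color_right : τ.color q = τ.color q'

namespace DisjointPairs

theorem symm_left {τ : Graph.{u}} {p p' q q' : τ.F} (c : DisjointPairs τ p p' q q') :
    DisjointPairs τ p' p q q' :=
  ⟨c.ne_left.symm, c.ne_right, c.ne₃, c.ne₄, c.ne₁, c.ne₂, c.color_left.symm, c.color_right⟩

theorem symm_right {τ : Graph.{u}} {p p' q q' : τ.F} (c : DisjointPairs τ p p' q q') :
    DisjointPairs τ p p' q' q :=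
  ⟨c.ne_left, c.ne_right.symm, c.ne₂, c.ne₁, c.ne₄, c.ne₃, c.color_left, c.color_right.symm⟩

theorem of_injective {τ σ : Graph.{u}} (f : σ.F → τ.F) (hc : ∀ x, τ.color (f x) = σ.color x)
    {p p' q q' : σ.F} (c : DisjointPairs τ (f p) (f p') (f q) (f q')) :
    DisjointPairs σ p p' q q' :=
  ⟨ne_of_apply_ne f c.ne_left, ne_of_apply_ne f c.ne_right, ne_of_apply_ne f c.ne₁,
    ne_of_apply_ne f c.ne₂, ne_of_apply_ne f c.ne₃, ne_of_apply_ne f c.ne₄,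
    (hc _).symm.trans (c.color_left.trans (hc _)), (hc _).symm.trans (c.color_right.trans (hc _))⟩

theorem of_onF {τ σ : Graph.{u}} (h : τ ⟶ σ) {p p' q q' : σ.F}
    (c : DisjointPairs τ (Hom.onF h p) (Hom.onF h p') (Hom.onF h q) (Hom.onF h q')) :
    DisjointPairs σ p p' q q' :=
  c.of_injective (Hom.onF h) (Hom.color_onF h)

theorem of_inl {τ σ : Graph.{u}} {p p' q q' : τ.F}
    (c : DisjointPairs (τ ⊗ σ) (Sum.inl p) (Sum.inl p') (Sum.inl q) (Sum.inl q')) :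
    DisjointPairs τ p p' q q' :=
  of_injective (τ := τ ⊗ σ) (σ := τ) Sum.inl (fun _ => rfl) c

/-- With `p` and `q` at a common vertex, the positions of `p'` and `q'` decide. Both at this vertex
give `loop_loop`, exactly one gives `loop_edge`, both at one other vertex give `edge_loop`, and two
different other vertices give `edge_edge`. The vertices concerned are moved to the front, and the
diamond of corollas is tensored with the rest. -/
theorem diamond_of_bd_eq (hD : D.Compatible) {s : LabelTree.{u}} {p p' q q' : s.graph.F}
    (c : DisjointPairs s.graph p p' q q') (hv : s.graph.bd q = s.graph.bd p) :
    Diamond D s p p' q q' := by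
  have hG := tautological_compatible.{u}
  by_cases v₁ : s.graph.bd p' = s.graph.bd p
  · by_cases v₂ : s.graph.bd q' = s.graph.bd p
    · obtain ⟨L, r, e, he⟩ := exists_extract_one s (s.graph.bd p)
      have key := fun f (hf : s.graph.bd f = s.graph.bd p) =>
        exists_flag_inl (e.iso hG) ((congrArg (Hom.onV e.hom) hf).trans he)
      obtain ⟨i₁, rfl, -⟩ := key p rfl
      obtain ⟨i₁', rfl, -⟩ := key p' v₁
      obtain ⟨i₂, rfl, -⟩ := key q hv
      obtain ⟨i₂', rfl, -⟩ := key q' v₂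
      have d := (c.of_onF e.hom).of_inl
      exact ((Diamond.loop_loop hD L i₁ i₁' i₂ i₂' d.ne_left d.ne_right d.ne₁ d.ne₂ d.ne₃ d.ne₄
        d.color_left d.color_right).tensor_id r).word_comp e
    · obtain ⟨L, M, r, e, he, he'⟩ := exists_extract_two s v₂
      have key := fun f (hf : s.graph.bd f = s.graph.bd p) =>
        exists_flag_inl (e.iso hG) ((congrArg (Hom.onV e.hom) hf).trans he)
      obtain ⟨y, rfl, h⟩ := key p rfl
      obtain ⟨i₁, rfl, -⟩ := exists_flag_inl_inl h
      obtain ⟨y, rfl, h⟩ := key p' v₁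
      obtain ⟨i₁', rfl, -⟩ := exists_flag_inl_inl h
      obtain ⟨y, rfl, h⟩ := key q hv
      obtain ⟨i₂, rfl, -⟩ := exists_flag_inl_inl h
      obtain ⟨y, rfl, h⟩ := exists_flag_inl (e.iso hG) he'
      obtain ⟨i₂', rfl, -⟩ := exists_flag_inl_inr h
      have d := (c.of_onF e.hom).of_inl
      exact ((Diamond.loop_edge hD L M i₁ i₁' i₂ i₂' (ne_of_apply_ne Sum.inl d.ne_left)
        (ne_of_apply_ne Sum.inl d.ne₁) (ne_of_apply_ne Sum.inl d.ne₃) d.color_left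
        d.color_right).tensor_id r).word_comp e
  · by_cases v₂ : s.graph.bd q' = s.graph.bd p
    · obtain ⟨L, M, r, e, he, he'⟩ := exists_extract_two s v₁
      have key := fun f (hf : s.graph.bd f = s.graph.bd p) =>
        exists_flag_inl (e.iso hG) ((congrArg (Hom.onV e.hom) hf).trans he)
      obtain ⟨y, rfl, h⟩ := key p rfl
      obtain ⟨i₁, rfl, -⟩ := exists_flag_inl_inl h
      obtain ⟨y, rfl, h⟩ := key q hv
      obtain ⟨i₂, rfl, -⟩ := exists_flag_inl_inl h
      obtain ⟨y, rfl, h⟩ := key q' v₂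
      obtain ⟨i₂', rfl, -⟩ := exists_flag_inl_inl h
      obtain ⟨y, rfl, h⟩ := exists_flag_inl (e.iso hG) he'
      obtain ⟨i₁', rfl, -⟩ := exists_flag_inl_inr h
      have d := (c.of_onF e.hom).of_inl
      exact ((Diamond.loop_edge hD L M i₂ i₂' i₁ i₁' (ne_of_apply_ne Sum.inl d.ne_right)
        (ne_of_apply_ne Sum.inl d.ne₁).symm (ne_of_apply_ne Sum.inl d.ne₂).symm d.color_right
        d.color_left).swap.tensor_id r).word_comp e
    · by_cases v₃ : s.graph.bd q' = s.graph.bd p'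
      · obtain ⟨L, M, r, e, he, he'⟩ := exists_extract_two s v₁
        obtain ⟨y, rfl, h⟩ := exists_flag_inl (e.iso hG) he
        obtain ⟨i₁, rfl, -⟩ := exists_flag_inl_inl h
        obtain ⟨y, rfl, h⟩ := exists_flag_inl (e.iso hG) ((congrArg (Hom.onV e.hom) hv).trans he)
        obtain ⟨i₂, rfl, -⟩ := exists_flag_inl_inl h
        obtain ⟨y, rfl, h⟩ := exists_flag_inl (e.iso hG) ((congrArg (Hom.onV e.hom) v₃).trans he')
        obtain ⟨i₂', rfl, -⟩ := exists_flag_inl_inr h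
        obtain ⟨y, rfl, h⟩ := exists_flag_inl (e.iso hG) he'
        obtain ⟨i₁', rfl, -⟩ := exists_flag_inl_inr h
        have d := (c.of_onF e.hom).of_inl
        exact ((Diamond.edge_loop hD L M i₁ i₂ i₁' i₂' (ne_of_apply_ne Sum.inl d.ne₁)
          (ne_of_apply_ne Sum.inr d.ne₄) d.color_left d.color_right).tensor_id r).word_comp e
      -- The common vertex becomes the middle corolla, as in `edge_edge`; the first pair is then
      -- read from `p'` to `p`.
      · obtain ⟨L, M, N, r, e, he, he', he''⟩ := exists_extract_three s (Ne.symm v₁) v₃ v₂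
        obtain ⟨y, rfl, h⟩ := exists_flag_inl (e.iso hG) ((congrArg (Hom.onV e.hom) hv).trans he')
        obtain ⟨y, rfl, h'⟩ := exists_flag_inl_inl h
        obtain ⟨i₂, rfl, -⟩ := exists_flag_inl_inr h'
        obtain ⟨y, rfl, h⟩ := exists_flag_inl (e.iso hG) he
        obtain ⟨y, rfl, h'⟩ := exists_flag_inl_inl h
        obtain ⟨i₁, rfl, -⟩ := exists_flag_inl_inl h'
        obtain ⟨y, rfl, h⟩ := exists_flag_inl (e.iso hG) he'
        obtain ⟨y, rfl, h'⟩ := exists_flag_inl_inl h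
        obtain ⟨i₁', rfl, -⟩ := exists_flag_inl_inr h'
        obtain ⟨y, rfl, h⟩ := exists_flag_inl (e.iso hG) he''
        obtain ⟨i₂', rfl, -⟩ := exists_flag_inl_inr h
        have d := (c.of_onF e.hom).of_inl
        exact ((Diamond.edge_edge hD L M N i₁ i₁' i₂ i₂'
          (ne_of_apply_ne (fun i => Sum.inl (Sum.inr i)) d.ne₁) d.color_left.symm
          d.color_right).symm_left.tensor_id r).word_comp e

/-- If the pairs share a vertex, exchanging flags within the pairs brings `p` and `q` to a common
one. If they share none, both flags of the second pair lie in the part untouched by the first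
contraction. -/
theorem diamond (hD : D.Compatible) {s : LabelTree.{u}} {p p' q q' : s.graph.F}
    (c : DisjointPairs s.graph p p' q q') : Diamond D s p p' q q' := by
  by_cases v₁ : s.graph.bd q = s.graph.bd p
  · exact c.diamond_of_bd_eq hD v₁
  by_cases v₂ : s.graph.bd q = s.graph.bd p'
  · exact (c.symm_left.diamond_of_bd_eq hD v₂).symm_left
  by_cases v₃ : s.graph.bd q' = s.graph.bd p
  · exact (c.symm_right.diamond_of_bd_eq hD v₃).symm_right
  by_cases v₄ : s.graph.bd q' = s.graph.bd p'
  · exact (c.symm_left.symm_right.diamond_of_bd_eq hD v₄).symm_left.symm_right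
  obtain ⟨a, b, r, e, g, x, x', rfl, rfl, cg, h⟩ := exists_atom s c.ne_left c.color_left
  obtain ⟨y, rfl⟩ := h q v₁ v₂
  obtain ⟨y', rfl⟩ := h q' v₃ v₄
  have d := c.of_onF e.hom
  obtain ⟨u, k, κ, ck, hk⟩ := exists_chain_one D r (ne_of_apply_ne Sum.inr d.ne_right) d.color_right
  exact (Diamond.disjoint (Chain.atom g) cg ck hk).word_comp e

end DisjointPairs

/-- After the first pair only one contraction is left, and it must be that of the second pair. Hence
any morphism that contracts both pairs factors through the diamond. -/
theorem Starts.ghost_ne {s t : LabelTree.{u}} {h : s.graph ⟶ t.graph} {φ : s.eval D ⟶ t.eval D}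
    {p p' q q' : s.graph.F} (c : Starts D 1 s t h φ p p') (hq : Hom.ghost h q = q') (hne : q ≠ q')
    (h₁ : q ≠ p) (h₂ : q ≠ p') (f : s.graph.F) (hf : Hom.ghost h f ≠ f) :
    f = p ∨ f = p' ∨ f = q ∨ f = q' := by
  obtain ⟨u, k, κ, h', φ', c, ck, d, rfl, rfl⟩ := c
  obtain ⟨x, x', hx⟩ := d.exists_contracts
  have key : ∀ f, f ≠ p → f ≠ p' → ∃ y, Hom.onF k y = f := fun f hp hp' => by
    by_contra hn
    exact (ck.eq_or f fun e => hn ((Hom.ghost_eq_self k f).1 e)).elim hp hp'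
  by_contra! hn
  obtain ⟨y, rfl⟩ := key f hn.1 hn.2.1
  obtain ⟨z, rfl⟩ := key q h₁ h₂
  rw [ghost_comp_onF] at hf
  rw [ghost_comp_onF] at hq
  subst hq
  have hy := hx.eq_or y (ne_of_apply_ne _ hf)
  have hz := hx.eq_or z (ne_of_apply_ne _ hne).symm
  have hyz : y ≠ z := ne_of_apply_ne _ hn.2.2.1
  have hyz' : y ≠ Hom.ghost h' z := ne_of_apply_ne _ hn.2.2.2
  rcases hy with rfl | rfl <;> rcases hz with rfl | rfl
  · exact hyz rfl
  · exact hyz' hx.symm.ghost_eq.symm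
  · exact hyz' hx.ghost_eq.symm
  · exact hyz rfl

/-- The value of a chain only depends on the morphism of graphs. -/
theorem Chain.unique_of_length (hD : D.Compatible) (n : ℕ) : ∀ {s t : LabelTree.{u}}
    {h : s.graph ⟶ t.graph} {φ φ' : s.eval D ⟶ t.eval D}, Chain D n s t h φ →
      Chain D n s t h φ' → φ = φ' := by
  induction n with
  | zero => exact fun c c' => c.zero_unique hD c'
  | succ n ih =>
    intro s t h φ φ' c c'
    obtain ⟨p, p', hp⟩ := c.exists_starts
    obtain ⟨q, q', hq⟩ := c'.exists_starts
    obtain ⟨np, gp⟩ := hp.contracts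
    obtain ⟨nq, gq⟩ := hq.contracts
    by_cases h₁ : q = p
    · subst h₁
      obtain rfl := gp.symm.trans gq
      exact hp.unique hD ih hq
    by_cases h₂ : q = p'
    · subst h₂
      obtain rfl := (ghost_symm h gp).symm.trans gq
      exact hp.unique hD ih hq.symm
    -- Both pairs are orbits of the same involution, and `q` lies outside the first one.
    have d : DisjointPairs s.graph p p' q q' :=
      ⟨np, nq, Ne.symm h₁, fun e => h₂ ((ghost_symm h gq).symm.trans
        ((congrArg (Hom.ghost h) e.symm).trans gp)), Ne.symm h₂,
        fun e => h₁ ((ghost_symm h gq).symm.trans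
          ((congrArg (Hom.ghost h) e.symm).trans (ghost_symm h gp))),
        (Hom.color_ghost h p).symm.trans (congrArg _ gp),
        (Hom.color_ghost h q).symm.trans (congrArg _ gq)⟩
    obtain ⟨z, k, κ, sp, sq⟩ := d.diamond hD
    have kp := sp.contracts.2
    have kq := sq.contracts.2
    -- The morphism of the diamond contracts only these two pairs, which `h` contracts as well.
    obtain ⟨m, rfl⟩ := exists_factor z.j_graph h k fun f hf => by
      rcases sp.ghost_ne kq nq h₁ h₂ f hf with hf | hf | hf | hf
      · exact ghost_eq_of_pair gp kp (.inl hf)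
      · exact ghost_eq_of_pair gp kp (.inr hf)
      · exact ghost_eq_of_pair gq kq (.inl hf)
      · exact ghost_eq_of_pair gq kq (.inr hf)
    -- Any chain for the remainder will do: its length is forced by the number of flags. Prolonged
    -- by it, the diamond starts with either pair, so its value agrees with that of each given
    -- chain.
    obtain ⟨l, μ, cm⟩ := Chain.exists_chain D m
    have e₁ := c.card_eq
    have e₂ := (sp.chain.comp cm).card_eq
    obtain rfl : n = 1 + l := by omega
    exact (hp.unique hD ih (sp.comp cm)).trans (hq.unique hD ih (sq.comp cm)).symm

theorem Chain.unique (hD : D.Compatible) {n m : ℕ} {s t : LabelTree.{u}} {h : s.graph ⟶ t.graph}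
    {φ φ' : s.eval D ⟶ t.eval D} (c : Chain D n s t h φ) (c' : Chain D m s t h φ') : φ = φ' := by
  have e₁ := c.card_eq
  have e₂ := c'.card_eq
  obtain rfl : n = m := by omega
  exact Chain.unique_of_length hD n c c'

end confluence

/-! ### The value of a morphism between disjoint unions of corollas -/

section value

variable {C : Type w} [Category.{v} C] [MonoidalCategory C] [SymmetricCategory C]
  (D : GluingData.{u} C)

/-- The value of a morphism between disjoint unions of corollas. -/
noncomputable def value {s t : LabelTree.{u}} (h : s.graph ⟶ t.graph) : s.eval D ⟶ t.eval D :=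
  (Chain.exists_chain D h).choose_spec.choose

theorem chain_value {s t : LabelTree.{u}} (h : s.graph ⟶ t.graph) :
    ∃ n, Chain D n s t h (value D h) :=
  ⟨_, (Chain.exists_chain D h).choose_spec.choose_spec⟩

variable {D}

theorem Chain.value_eq (hD : D.Compatible) {n : ℕ} {s t : LabelTree.{u}} {h : s.graph ⟶ t.graph}
    {φ : s.eval D ⟶ t.eval D} (c : Chain D n s t h φ) : value D h = φ :=
  (chain_value D h).choose_spec.unique hD c

theorem value_word (hD : D.Compatible) {s t : LabelTree.{u}} (f : Word s t) : value D f.hom = f.eval D :=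
  (Chain.word f).value_eq hD

theorem value_id (hD : D.Compatible) (s : LabelTree.{u}) : value D (𝟙 s.graph) = 𝟙 (s.eval D) :=
  value_word hD (.id s)

theorem value_comp (hD : D.Compatible) {s t r : LabelTree.{u}} (h : s.graph ⟶ t.graph) (k : t.graph ⟶ r.graph) :
    value D (h ≫ k) = value D h ≫ value D k :=
  ((chain_value D h).choose_spec.comp (chain_value D k).choose_spec).value_eq hD

theorem value_tensor (hD : D.Compatible) {s t s' t' : LabelTree.{u}} (h : s.graph ⟶ t.graph) (k : s'.graph ⟶ t'.graph) :
    value D (s := s.node s') (t := t.node t') (h ⊗ₘ k) = value D h ⊗ₘ value D k :=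
  ((chain_value D h).choose_spec.tensor (chain_value D k).choose_spec).value_eq hD

theorem isIso_value (hD : D.Compatible) {s t : LabelTree.{u}} (h : s.graph ⟶ t.graph) (hg : ∀ f, Hom.ghost h f = f) :
    IsIso (value D h) := by
  have := isIso_of_ghost h hg s.j_graph t.j_graph
  obtain ⟨f, hf⟩ := Word.exists_hom_eq (asIso h)
  rw [asIso_hom] at hf
  rw [← hf, value_word hD]
  exact f.isIso_eval hD

end value

/-! ### Presentations of graphs by disjoint unions of corollas -/

/-- A disjoint union of corollas with the same vertices and flags. -/
structure Presentation (X : FlagData.{u}) where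
  tree : LabelTree.{u}
  onV : tree.graph.V ≃ X.V
  onF : X.F ≃ tree.graph.F
  bd_onF : ∀ f, onV (tree.graph.bd (onF f)) = X.bd f
  genus_onV : ∀ v, X.genus (onV v) = tree.graph.genus v
  color_onF : ∀ f, tree.graph.color (onF f) = X.color f

namespace Presentation

section hom

variable {τ σ : Graph.{u}} (P : Presentation τ.toFlagData)

/-- The grafting of corollas given by a presentation. -/
def hom : P.tree.graph ⟶ τ where
  onV := P.onV
  onF := P.onF
  ghost := _root_.id
  onV_surj := P.onV.surjective
  onF_inj := P.onF.injective
  ghost_ghost _ := rfl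
  ghost_eq_self f := by simp
  bd_onF := P.bd_onF
  bd_ghost _ := rfl
  ghost_edge f hf := absurd (P.tree.j_graph f) hf
  onF_edge f hf := absurd (P.tree.j_graph _) hf
  color_onF := P.color_onF
  color_ghost _ := rfl
  connected a b h := by rw [P.onV.injective h]
  genus_eq v := by
    classical
    have := Fintype.ofFinite P.tree.graph.V
    have := Fintype.ofFinite P.tree.graph.F
    rw [Hom.genus_eq_iff]
    obtain ⟨a, rfl⟩ := P.onV.surjective v
    simp [P.genus_onV]

theorem ghost_hom (f : P.tree.graph.F) : Hom.ghost P.hom f = f := rfl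

theorem isGrafting_hom : IsGrafting P.hom := ⟨P.onV.bijective, P.onF.bijective⟩

/-- The grafting is bijective on vertices and flags without being invertible when `τ` has edges;
bijectivity suffices for cancellation, so lifts along it are unique. -/
instance : Mono P.hom where
  right_cancellation h k e := by
    refine hom_ext (fun v => P.onV.injective ?_) (fun f => ?_) fun f => ?_
    · exact congrFun (congrArg Hom.onV e) v
    · obtain ⟨f, rfl⟩ := P.onF.surjective f
      exact congrFun (congrArg Hom.onF e) f
    · rw [← ghost_comp_of_right h P.hom P.ghost_hom, e, ghost_comp_of_right k P.hom P.ghost_hom]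

/-- Morphisms from graphs without edges lift along the grafting of corollas. -/
def lift (hσ : ∀ f, σ.j f = f) (h : σ ⟶ τ) : σ ⟶ P.tree.graph where
  onV v := P.onV.symm (Hom.onV h v)
  onF f := Hom.onF h (P.onF.symm f)
  ghost := Hom.ghost h
  onV_surj := P.onV.symm.surjective.comp (Hom.onV_surj h)
  onF_inj := (Hom.onF_inj h).comp P.onF.symm.injective
  ghost_ghost := Hom.ghost_ghost h
  ghost_eq_self f := by
    rw [Hom.ghost_eq_self h]
    exact ⟨fun ⟨y, hy⟩ => ⟨P.onF y, by simp [hy]⟩, fun ⟨y, hy⟩ => ⟨_, hy⟩⟩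
  bd_onF f := by
    rw [Hom.bd_onF h, Equiv.symm_apply_eq, ← P.bd_onF, Equiv.apply_symm_apply]
  bd_ghost f := by rw [Hom.bd_ghost h]
  ghost_edge f hf := absurd (hσ f) hf
  onF_edge f hf := absurd (hσ _) hf
  color_onF f := by
    rw [Hom.color_onF h, ← P.color_onF, Equiv.apply_symm_apply]
  color_ghost := Hom.color_ghost h
  connected a b hab := Hom.connected h a b (P.onV.symm.injective hab)
  genus_eq v := by
    classical
    have := Fintype.ofFinite σ.V
    have := Fintype.ofFinite σ.F
    have e := (Hom.genus_eq_iff _ _ _ _).1 (Hom.genus_eq h (P.onV v))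
    rw [Hom.genus_eq_iff]
    simpa only [Equiv.symm_apply_eq, P.genus_onV] using e

theorem lift_hom (hσ : ∀ f, σ.j f = f) (h : σ ⟶ τ) : P.lift hσ h ≫ P.hom = h := by
  refine hom_ext (fun v => P.onV.apply_symm_apply _) (fun f => ?_) fun f => ?_
  · exact congrArg (Hom.onF h) (P.onF.symm_apply_apply f)
  · exact ghost_comp_of_right (P.lift hσ h) P.hom P.ghost_hom f

end hom

section list

variable (X : FlagData.{u})

/-- The label of a vertex. -/
def vertexLabel (v : X.V) : Label.{u} where
  genus := X.genus v
  I := {f // X.bd f = v}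
  color f := X.color f.1
  even := by
    have h := X.even v
    rwa [← Nat.card_congr (Equiv.subtypeSubtypeEquivSubtypeInter (fun f => X.bd f = v)
      fun f => X.color f = Color.R)] at h
  stable := X.stable v

/-- The formal tensor product of the labels of the vertices in a list. -/
def listTree : List X.V → LabelTree.{u}
  | [] => .unit
  | v :: l => .node (.leaf (vertexLabel X v)) (listTree l)

/-- The vertices of the disjoint union of corollas for a list of vertices. -/
noncomputable def listV : (l : List X.V) → (listTree X l).graph.V → X.V
  | [] => fun x => PEmpty.elim x
  | v :: l => Sum.elim (fun _ => v) (listV l)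

/-- The flags of the disjoint union of corollas for a list of vertices. -/
noncomputable def listF : (l : List X.V) → (listTree X l).graph.F → X.F
  | [] => fun x => PEmpty.elim x
  | _ :: l => Sum.elim (fun f => f.1) (listF l)

theorem listV_bd : (l : List X.V) → (f : (listTree X l).graph.F) →
    listV X l ((listTree X l).graph.bd f) = X.bd (listF X l f)
  | [], f => PEmpty.elim f
  | _ :: _, Sum.inl f => f.2.symm
  | _ :: l, Sum.inr f => listV_bd l f

theorem genus_listV : (l : List X.V) → (v : (listTree X l).graph.V) →
    X.genus (listV X l v) = (listTree X l).graph.genus v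
  | [], f => PEmpty.elim f
  | _ :: _, Sum.inl _ => rfl
  | _ :: l, Sum.inr v => genus_listV l v

theorem color_listF : (l : List X.V) → (f : (listTree X l).graph.F) →
    (listTree X l).graph.color f = X.color (listF X l f)
  | [], f => PEmpty.elim f
  | _ :: _, Sum.inl _ => rfl
  | _ :: l, Sum.inr f => color_listF l f

theorem listV_mem : (l : List X.V) → (v : (listTree X l).graph.V) → listV X l v ∈ l
  | [], f => PEmpty.elim f
  | _ :: _, Sum.inl _ => List.mem_cons_self
  | _ :: l, Sum.inr f => List.mem_cons_of_mem _ (listV_mem l f)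

theorem listV_injective : (l : List X.V) → l.Nodup → Function.Injective (listV X l)
  | [], _ => fun x => PEmpty.elim x
  | v :: l, h => by
    rw [List.nodup_cons] at h
    rintro (a | a) (b | b) e
    · rfl
    · exact absurd (listV_mem X l b) (by rw [show listV X l b = v from e.symm]; exact h.1)
    · exact absurd (listV_mem X l a) (by rw [show listV X l a = v from e]; exact h.1)
    · exact congrArg Sum.inr (listV_injective l h.2 e)

theorem listF_injective : (l : List X.V) → l.Nodup → Function.Injective (listF X l)
  | [], _ => fun x => PEmpty.elim x
  | v :: l, h => by
    rw [List.nodup_cons] at h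
    have key : ∀ (a : {f // X.bd f = v}) b, a.1 ≠ listF X l b := fun a b e =>
      h.1 (by rw [← a.2, e, ← listV_bd]; exact listV_mem X l _)
    rintro (a | a) (b | b) e
    · exact congrArg Sum.inl (Subtype.ext e)
    · exact absurd e (key a b)
    · exact absurd e.symm (key b a)
    · exact congrArg Sum.inr (listF_injective l h.2 e)

theorem exists_listV : (l : List X.V) → (v : X.V) → v ∈ l → ∃ a, listV X l a = v
  | [], _, h => absurd h List.not_mem_nil
  | w :: l, v, h => by
    rcases List.mem_cons.1 h with rfl | h
    · exact ⟨Sum.inl PUnit.unit, rfl⟩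
    · obtain ⟨a, ha⟩ := exists_listV l v h
      exact ⟨Sum.inr a, ha⟩

theorem exists_listF : (l : List X.V) → (f : X.F) → X.bd f ∈ l → ∃ a, listF X l a = f
  | [], _, h => absurd h List.not_mem_nil
  | w :: l, f, h => by
    rcases List.mem_cons.1 h with h | h
    · exact ⟨Sum.inl ⟨f, h⟩, rfl⟩
    · obtain ⟨a, ha⟩ := exists_listF l f h
      exact ⟨Sum.inr a, ha⟩

/-- Any enumeration of the vertices works, since values do not depend on the order of the factors up
to words. -/
theorem nonempty : Nonempty (Presentation X) := by
  have := Fintype.ofFinite X.V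
  let l := (Finset.univ : Finset X.V).toList
  have hl : l.Nodup := Finset.nodup_toList _
  have hm : ∀ v, v ∈ l := fun v => Finset.mem_toList.2 (Finset.mem_univ v)
  let eF := Equiv.ofBijective (listF X l)
    ⟨listF_injective X l hl, fun f => exists_listF X l f (hm _)⟩
  have key : ∀ f, listF X l (eF.symm f) = f := eF.apply_symm_apply
  exact ⟨⟨listTree X l, Equiv.ofBijective (listV X l)
    ⟨listV_injective X l hl, fun v => exists_listV X l v (hm v)⟩, eF.symm,
    fun f => (listV_bd X l _).trans (congrArg X.bd (key f)), genus_listV X l,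
    fun f => (color_listF X l _).trans (congrArg X.color (key f))⟩⟩

end list

/-- The presentation of a graph with a single vertex. -/
def ofUnique (τ : Graph.{u}) (v : τ.V) (hv : ∀ x, x = v) : Presentation τ.toFlagData where
  tree := .leaf (τ.label v hv)
  onV := ⟨fun _ => v, fun _ => PUnit.unit, fun _ => rfl, fun x => (hv x).symm⟩
  onF := Equiv.refl _
  bd_onF _ := (hv _).symm
  genus_onV _ := rfl
  color_onF _ := rfl

end Presentation

open scoped Classical in
/-- A choice of presentations. -/
noncomputable def FlagData.presentation (X : FlagData.{u}) : Presentation X :=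
  -- The choice depends on the flag data only, so graphs that differ in their edges have the same
  -- value. For a single vertex its own label is taken, so that the prescribed objects are obtained
  -- as equalities and not just up to isomorphism.
  if h : ∃ v : X.V, ∀ x, x = v then
    Presentation.ofUnique ⟨X, _root_.id, fun _ => rfl, fun _ => rfl⟩ h.choose h.choose_spec
  else (Presentation.nonempty X).some

theorem Graph.presentation_eq (τ : Graph.{u}) (v : τ.V) (hv : ∀ x, x = v) :
    τ.toFlagData.presentation = Presentation.ofUnique τ v hv := by
  have h : ∃ v : τ.V, ∀ x, x = v := ⟨v, hv⟩
  rw [FlagData.presentation, dif_pos h]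
  -- The presentation does not see the involution, so after identifying the chosen vertex with `v`
  -- the two sides coincide definitionally.
  have key : ∀ (v' : τ.V) (hv' : ∀ x, x = v'), v' = v → Presentation.ofUnique
      ⟨τ.toFlagData, _root_.id, fun _ => rfl, fun _ => rfl⟩ v' hv' =
      Presentation.ofUnique τ v hv := by
    rintro _ _ rfl
    rfl
  exact key _ h.choose_spec (hv _)

/-! ### The operad given by compatible gluing data -/

/-- The formal tensor product of the labels of the vertices of a graph. -/
noncomputable abbrev Graph.tree (τ : Graph.{u}) : LabelTree.{u} := τ.toFlagData.presentation.tree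

/-- The grafting of the corollas of the vertices of a graph. -/
noncomputable abbrev Graph.grafting (τ : Graph.{u}) : τ.tree.graph ⟶ τ :=
  Presentation.hom (τ := τ) τ.toFlagData.presentation

section operad

variable {C : Type w} [Category.{v} C] [MonoidalCategory C]

theorem comp_tensorHom_eq_whisker {X Y Z X' Y' : C} (f : X ⟶ Y) (g : Y ⟶ Z) (h : X' ⟶ Y') :
    (f ≫ g) ⊗ₘ h = (f ⊗ₘ h) ≫ g ▷ Y' := by
  rw [← tensorHom_id, tensorHom_comp_tensorHom, Category.comp_id]

theorem tensorHom_comp_eq_whisker {X Y Z X' Y' : C} (h : X' ⟶ Y') (f : X ⟶ Y) (g : Y ⟶ Z) :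
    h ⊗ₘ (f ≫ g) = (h ⊗ₘ f) ≫ Y' ◁ g := by
  rw [← id_tensorHom, tensorHom_comp_tensorHom, Category.comp_id]

theorem leftUnitor_comp {X Y : C} (f : X ⟶ Y) :
    (λ_ X).hom ≫ f = (𝟙 (𝟙_ C) ⊗ₘ f) ≫ (λ_ Y).hom := by
  simp

theorem rightUnitor_comp {X Y : C} (f : X ⟶ Y) :
    (ρ_ X).hom ≫ f = (f ⊗ₘ 𝟙 (𝟙_ C)) ≫ (ρ_ Y).hom := by
  simp

variable [SymmetricCategory C] (D : GluingData.{u} C)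

/-- The value of a morphism from a disjoint union of corollas. -/
noncomputable def Presentation.val {τ : Graph.{u}} (P : Presentation τ.toFlagData)
    (s : LabelTree.{u}) (h : s.graph ⟶ τ) : s.eval D ⟶ P.tree.eval D :=
  value D (P.lift s.j_graph h)

/-- The value of a morphism from a disjoint union of corollas. -/
noncomputable abbrev val (s : LabelTree.{u}) {τ : Graph.{u}} (h : s.graph ⟶ τ) :
    s.eval D ⟶ τ.tree.eval D :=
  Presentation.val D (τ := τ) τ.toFlagData.presentation s h

variable {D}

theorem value_val (hD : D.Compatible) {s t : LabelTree.{u}} (m : s.graph ⟶ t.graph) {τ : Graph.{u}}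
    (h : t.graph ⟶ τ) : value D m ≫ val D t h = val D s (m ≫ h) := by
  rw [val, val, Presentation.val, Presentation.val, ← value_comp hD]
  rfl

theorem word_val (hD : D.Compatible) {s t : LabelTree.{u}} (m : Word s t) {τ : Graph.{u}}
    (h : t.graph ⟶ τ) : m.eval D ≫ val D t h = val D s (m.hom ≫ h) := by
  rw [← value_word hD, value_val hD]

/-- Functoriality of the operad in disguise: a lift followed by the grafting is the original
morphism, so the inner grafting cancels. -/
theorem val_comp (hD : D.Compatible) (s : LabelTree.{u}) {τ σ : Graph.{u}} (h : s.graph ⟶ τ)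
    (k : τ ⟶ σ) : val D s h ≫ val D τ.tree (τ.grafting ≫ k) = val D s (h ≫ k) := by
  rw [val, Presentation.val, value_val hD, ← Category.assoc, Presentation.lift_hom]

theorem val_grafting (hD : D.Compatible) (τ : Graph.{u}) :
    val D τ.tree τ.grafting = 𝟙 (τ.tree.eval D) := by
  rw [← value_id hD, val, Presentation.val]
  congr 1
  rw [← cancel_mono (Graph.grafting τ), Presentation.lift_hom, Category.id_comp]

theorem isIso_val (hD : D.Compatible) (s : LabelTree.{u}) {τ : Graph.{u}} (h : s.graph ⟶ τ)
    (hg : ∀ f, Hom.ghost h f = f) : IsIso (val D s h) :=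
  isIso_value hD _ hg

theorem ghost_of_isGrafting {τ σ : Graph.{u}} {h : τ ⟶ σ} (hh : IsGrafting h) (f : τ.F) :
    Hom.ghost h f = f :=
  (Hom.ghost_eq_self h f).2 (hh.2.2 f)

variable (D) in
/-- The tensorator. -/
noncomputable def tensorator (τ σ : Graph.{u}) :
    τ.tree.eval D ⊗ σ.tree.eval D ⟶ (τ ⊗ σ).tree.eval D :=
  val D (τ.tree.node σ.tree) (τ.grafting ⊗ₘ σ.grafting)

/-- Together with `val_comp` and `word_val`, this reduces the axioms of a braided monoidal functor
to equations between morphisms out of disjoint unions of corollas. -/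
theorem val_tensorator (hD : D.Compatible) {s t : LabelTree.{u}} {τ σ : Graph.{u}}
    (h : s.graph ⟶ τ) (k : t.graph ⟶ σ) :
    (val D s h ⊗ₘ val D t k) ≫ tensorator D τ σ = val D (s.node t) (h ⊗ₘ k) := by
  have e := value_tensor hD (Presentation.lift (τ := τ) τ.toFlagData.presentation s.j_graph h)
    (Presentation.lift (τ := σ) σ.toFlagData.presentation t.j_graph k)
  refine (congrArg (fun x => x ≫ tensorator D τ σ) e.symm).trans
    ((value_val hD (s := s.node t) (t := τ.tree.node σ.tree) _ _).trans
      (congrArg (val D (s.node t)) ?_))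
  refine (tensorHom_comp_tensorHom _ _ _ _).trans ?_
  rw [Presentation.lift_hom, Presentation.lift_hom]

theorem tensorator_comp (hD : D.Compatible) {τ σ ρ : Graph.{u}} (k : τ ⊗ σ ⟶ ρ) :
    tensorator D τ σ ≫ val D (τ ⊗ σ).tree ((τ ⊗ σ).grafting ≫ k) =
      val D (τ.tree.node σ.tree) ((τ.grafting ⊗ₘ σ.grafting) ≫ k) :=
  val_comp hD (τ.tree.node σ.tree) _ k

/-- The functor given by compatible gluing data. -/
noncomputable def operadFunctor (hD : D.Compatible) : Graph.{u} ⥤ C where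
  obj τ := τ.tree.eval D
  map {τ _} h := val D τ.tree (τ.grafting ≫ h)
  map_id τ := by rw [Category.comp_id, val_grafting hD]
  map_comp {τ _ _} h k := by rw [val_comp hD, Category.assoc]

/-- The monoidal structure of the functor given by compatible gluing data. -/
noncomputable def operadCore (hD : D.Compatible) : (operadFunctor hD).CoreMonoidal where
  εIso := @asIso C _ (𝟙_ C) (Graph.tree (𝟙_ Graph.{u})|>.eval D)
    (val D .unit (τ := 𝟙_ Graph.{u}) (𝟙 _)) (isIso_val hD .unit _ fun f => PEmpty.elim f)
  μIso τ σ := @asIso C _ (τ.tree.eval D ⊗ σ.tree.eval D) ((τ ⊗ σ).tree.eval D)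
    (tensorator D τ σ) (isIso_val hD (τ.tree.node σ.tree) _ (by rintro (f | f) <;> rfl))
  μIso_hom_natural_left {τ σ} f ρ := by
    change val D τ.tree (τ.grafting ≫ f) ▷ ρ.tree.eval D ≫ tensorator D σ ρ =
      tensorator D τ ρ ≫ val D (τ ⊗ ρ).tree ((τ ⊗ ρ).grafting ≫ f ▷ ρ)
    rw [tensorator_comp hD, ← tensorHom_id, ← val_grafting hD, val_tensorator hD]
    exact congrArg (val D (τ.tree.node ρ.tree)) (comp_tensorHom_eq_whisker _ _ _)
  μIso_hom_natural_right {τ σ} ρ f := by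
    change ρ.tree.eval D ◁ val D τ.tree (τ.grafting ≫ f) ≫ tensorator D ρ σ =
      tensorator D ρ τ ≫ val D (ρ ⊗ τ).tree ((ρ ⊗ τ).grafting ≫ ρ ◁ f)
    rw [tensorator_comp hD, ← id_tensorHom, ← val_grafting hD, val_tensorator hD]
    exact congrArg (val D (ρ.tree.node τ.tree)) (tensorHom_comp_eq_whisker _ _ _)
  associativity τ σ ρ := by
    change tensorator D τ σ ▷ ρ.tree.eval D ≫ tensorator D (τ ⊗ σ) ρ ≫
      val D ((τ ⊗ σ) ⊗ ρ).tree (((τ ⊗ σ) ⊗ ρ).grafting ≫ (α_ τ σ ρ).hom) =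
      (α_ (τ.tree.eval D) (σ.tree.eval D) (ρ.tree.eval D)).hom ≫
        τ.tree.eval D ◁ tensorator D σ ρ ≫ tensorator D τ (σ ⊗ ρ)
    -- Both iterated tensorators are values of the threefold disjoint union of graftings, bracketed
    -- in the two ways; naturality of the associator of graphs compares them.
    have e₁ : tensorator D τ σ ▷ ρ.tree.eval D ≫ tensorator D (τ ⊗ σ) ρ =
        val D ((τ.tree.node σ.tree).node ρ.tree) ((τ.grafting ⊗ₘ σ.grafting) ⊗ₘ ρ.grafting) := by
      rw [← tensorHom_id, ← val_grafting hD]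
      exact val_tensorator hD (s := τ.tree.node σ.tree) _ _
    have e₂ : τ.tree.eval D ◁ tensorator D σ ρ ≫ tensorator D τ (σ ⊗ ρ) =
        val D (τ.tree.node (σ.tree.node ρ.tree)) (τ.grafting ⊗ₘ (σ.grafting ⊗ₘ ρ.grafting)) := by
      rw [← id_tensorHom, ← val_grafting hD]
      exact val_tensorator hD (t := σ.tree.node ρ.tree) _ _
    rw [reassoc_of% e₁, e₂]
    refine (val_comp hD ((τ.tree.node σ.tree).node ρ.tree) _ _).trans
      (Eq.trans ?_ (word_val hD (.assoc τ.tree σ.tree ρ.tree) _).symm)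
    exact congrArg (val D ((τ.tree.node σ.tree).node ρ.tree)) (associator_naturality _ _ _)
  left_unitality τ := by
    change (λ_ (τ.tree.eval D)).hom = val D .unit (τ := 𝟙_ Graph.{u}) (𝟙 _) ▷ τ.tree.eval D ≫
      tensorator D (𝟙_ Graph.{u}) τ ≫
        val D (𝟙_ Graph.{u} ⊗ τ).tree ((𝟙_ Graph.{u} ⊗ τ).grafting ≫ (λ_ τ).hom)
    have e₁ : val D .unit (τ := 𝟙_ Graph.{u}) (𝟙 _) ▷ τ.tree.eval D ≫
        tensorator D (𝟙_ Graph.{u}) τ =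
        val D (LabelTree.unit.node τ.tree) (τ := 𝟙_ Graph.{u} ⊗ τ)
          (𝟙 (𝟙_ Graph.{u}) ⊗ₘ τ.grafting) := by
      rw [← tensorHom_id, ← val_grafting hD]
      exact val_tensorator hD (s := .unit) _ _
    rw [reassoc_of% e₁]
    refine Eq.trans ?_ (val_comp hD (LabelTree.unit.node τ.tree) _ _).symm
    have e₂ := word_val hD (.leftUnitor τ.tree) τ.grafting
    rw [val_grafting hD] at e₂
    refine (Category.comp_id _).symm.trans (e₂.trans
      (congrArg (val D (LabelTree.unit.node τ.tree)) (leftUnitor_comp _)))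
  right_unitality τ := by
    change (ρ_ (τ.tree.eval D)).hom = τ.tree.eval D ◁ val D .unit (τ := 𝟙_ Graph.{u}) (𝟙 _) ≫
      tensorator D τ (𝟙_ Graph.{u}) ≫
        val D (τ ⊗ 𝟙_ Graph.{u}).tree ((τ ⊗ 𝟙_ Graph.{u}).grafting ≫ (ρ_ τ).hom)
    have e₁ : τ.tree.eval D ◁ val D .unit (τ := 𝟙_ Graph.{u}) (𝟙 _) ≫
        tensorator D τ (𝟙_ Graph.{u}) =
        val D (τ.tree.node LabelTree.unit) (τ := τ ⊗ 𝟙_ Graph.{u})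
          (τ.grafting ⊗ₘ 𝟙 (𝟙_ Graph.{u})) := by
      rw [← id_tensorHom, ← val_grafting hD]
      exact val_tensorator hD (t := .unit) _ _
    rw [reassoc_of% e₁]
    refine Eq.trans ?_ (val_comp hD (τ.tree.node LabelTree.unit) _ _).symm
    have e₂ := word_val hD (.rightUnitor τ.tree) τ.grafting
    rw [val_grafting hD] at e₂
    refine (Category.comp_id _).symm.trans (e₂.trans
      (congrArg (val D (τ.tree.node LabelTree.unit)) (rightUnitor_comp _)))

/-- The braided structure of the functor given by compatible gluing data. -/
noncomputable abbrev operadBraided (hD : D.Compatible) : (operadFunctor hD).Braided where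
  toMonoidal := (operadCore hD).toMonoidal
  braided τ σ := by
    change tensorator D τ σ ≫ val D (τ ⊗ σ).tree ((τ ⊗ σ).grafting ≫ (β_ τ σ).hom) =
      (β_ (τ.tree.eval D) (σ.tree.eval D)).hom ≫ tensorator D σ τ
    refine (tensorator_comp hD _).trans
      (Eq.trans ?_ (word_val hD (.braid τ.tree σ.tree) _).symm)
    exact congrArg (val D (τ.tree.node σ.tree)) (BraidedCategory.braiding_naturality _ _)

/-- The operad given by compatible gluing data. -/
noncomputable def operad (hD : D.Compatible) : SUSYOperad.{u} C where
  functor := operadFunctor hD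
  braided := operadBraided hD
  isIso_map {τ _} h hh := isIso_val hD τ.tree (τ.grafting ≫ h)
    fun f => (ghost_comp_of_right _ _ (ghost_of_isGrafting hh) f).trans rfl

end operad

/-! ### The constructed operad has the prescribed values -/

section extends_data

variable {C : Type w} [Category.{v} C] [MonoidalCategory C] [SymmetricCategory C]
  {D : GluingData.{u} C}

namespace Presentation

/-- Allows the chosen presentation to be replaced by the explicit one of a graph with a single
vertex, at the cost of a transport. -/
theorem val_congr {τ : Graph.{u}} {P Q : Presentation τ.toFlagData} (e : P = Q)
    (s : LabelTree.{u}) (h : s.graph ⟶ τ) :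
    P.val D s h = Q.val D s h ≫ eqToHom (congrArg (fun P => P.tree.eval D) e.symm) := by
  subst e
  simp

theorem val_hom_congr {τ σ : Graph.{u}} {P Q : Presentation τ.toFlagData} (e : P = Q)
    (R : Presentation σ.toFlagData) (h : τ ⟶ σ) :
    R.val D P.tree (P.hom ≫ h) =
      eqToHom (congrArg (fun P => P.tree.eval D) e) ≫ R.val D Q.tree (Q.hom ≫ h) := by
  subst e
  simp

theorem val_tensor_congr {τ σ ρ : Graph.{u}} {P Q : Presentation τ.toFlagData} (e : P = Q)
    {P' Q' : Presentation σ.toFlagData} (e' : P' = Q') (R : Presentation ρ.toFlagData)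
    (k : τ ⊗ σ ⟶ ρ) :
    R.val D (P.tree.node P'.tree) ((P.hom ⊗ₘ P'.hom) ≫ k) =
      (eqToHom (congrArg (fun P => P.tree.eval D) e) ⊗ₘ
        eqToHom (congrArg (fun P => P.tree.eval D) e')) ≫
      R.val D (Q.tree.node Q'.tree) ((Q.hom ⊗ₘ Q'.hom) ≫ k) := by
  subst e
  subst e'
  rw [eqToHom_refl, eqToHom_refl, id_tensorHom_id]
  exact (Category.id_comp _).symm

end Presentation

theorem Relabeling.onF_eq_symm {L M : Label.{u}} (s : Relabeling L M) {α : Type*} {f : M.I → α}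
    {g : L.I → α} (hs : ∀ i, f (s i) = g i) (x : M.I) : f x = g (s.equiv.symm x) := by
  rw [← hs]
  exact congrArg f (s.equiv.apply_symm_apply x).symm

theorem IsContraction.ghost_eq {τ σ : Graph.{u}} {h : τ ⟶ σ} {f f' : τ.F}
    (hh : IsContraction h f f') : Hom.ghost h f = f' := by
  rw [Hom.ghost_edge h f (by rw [hh.j_eq]; exact hh.ne.symm)
    fun hf => ((hh.mem_range f).1 hf).1 rfl, hh.j_eq]

theorem operad_obj (hD : D.Compatible) (τ : Graph.{u}) (v : τ.V) (hv : ∀ x, x = v) :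
    (operad hD).functor.obj τ = D.obj (τ.label v hv) :=
  congrArg (fun P => P.tree.eval D) (τ.presentation_eq v hv)

theorem operad_map (hD : D.Compatible) {τ σ : Graph.{u}} (v : τ.V) (hv : ∀ x, x = v) (w : σ.V)
    (hw : ∀ x, x = w) (h : τ ⟶ σ) :
    (operad hD).functor.map h = eqToHom (operad_obj hD τ v hv) ≫
      value D (s := .leaf (τ.label v hv)) (t := .leaf (σ.label w hw))
        ((Presentation.ofUnique σ w hw).lift (fun _ => rfl)
          ((Presentation.ofUnique τ v hv).hom ≫ h)) ≫ eqToHom (operad_obj hD σ w hw).symm :=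
  (Presentation.val_hom_congr (τ.presentation_eq v hv) _ h).trans
    (congrArg (fun x => eqToHom (operad_obj hD τ v hv) ≫ x)
      (Presentation.val_congr (σ.presentation_eq w hw) _ _))

/-- To compute the operad on a morphism between one-vertex graphs it is enough to exhibit a chain
with the same surviving flags and the same contracted pairs; independence of the chain does the
rest. -/
theorem operad_map_eq (hD : D.Compatible) {τ σ : Graph.{u}} (v : τ.V) (hv : ∀ x, x = v) (w : σ.V)
    (hw : ∀ x, x = w) (h : τ ⟶ σ) {φ : D.obj (τ.label v hv) ⟶ D.obj (σ.label w hw)}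
    {m : corolla (τ.label v hv) ⟶ corolla (σ.label w hw)} {n : ℕ}
    (c : Chain D n (.leaf (τ.label v hv)) (.leaf (σ.label w hw)) m φ)
    (hF : ∀ y, Hom.onF h y = Hom.onF m y)
    (hg : ∀ x, x ∉ Set.range (Hom.onF h) → Hom.ghost h x = Hom.ghost m x) :
    (operad hD).functor.map h = eqToHom (operad_obj hD τ v hv) ≫ φ ≫
      eqToHom (operad_obj hD σ w hw).symm := by
  refine (operad_map hD v hv w hw h).trans
    (congrArg (fun x => eqToHom (operad_obj hD τ v hv) ≫ x ≫ eqToHom (operad_obj hD σ w hw).symm)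
      ((congrArg (value D) ?_).trans (c.value_eq hD)))
  refine corolla_hom_ext hF fun x hx => Eq.trans ?_ (hg x hx)
  exact ghost_comp_onF (Presentation.ofUnique τ v hv).hom h x

theorem operad_map_iso (hD : D.Compatible) {τ σ : Graph.{u}} (v : τ.V) (hv : ∀ x, x = v) (w : σ.V)
    (hw : ∀ x, x = w) (h : τ ≅ σ) (s : Relabeling (τ.label v hv) (σ.label w hw))
    (hs : ∀ i : τ.F, Hom.onF h.hom (s i) = i) :
    (operad hD).functor.map h.hom = eqToHom (operad_obj hD τ v hv) ≫ (D.relabel s).hom ≫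
      eqToHom (operad_obj hD σ w hw).symm := by
  refine operad_map_eq hD v hv w hw h.hom (Chain.relabel D s) ?_ fun f hf => absurd ⟨s f, hs f⟩ hf
  exact s.onF_eq_symm (f := Hom.onF h.hom) (g := fun i => i) hs

theorem operad_map_grafting (hD : D.Compatible) (X : FlagData.{u}) (j j' : X.F → X.F)
    (hj : ∀ f, j (j f) = f) (hj' : ∀ f, j' (j' f) = f) (hc : ∀ f, X.color (j f) = X.color f)
    (hc' : ∀ f, X.color (j' f) = X.color f) (h : Graph.mk X j hj hc ⟶ Graph.mk X j' hj' hc')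
    (hV : Hom.onV h = id) (hF : Hom.onF h = id) :
    ∃ e : (operad hD).functor.obj (Graph.mk X j hj hc) =
        (operad hD).functor.obj (Graph.mk X j' hj' hc'),
      (operad hD).functor.map h = eqToHom e := by
  -- The two graphs share their flag data and hence their chosen presentation.
  refine ⟨rfl, ?_⟩
  refine (congrArg (value D) ?_).trans (value_id hD X.presentation.tree)
  rw [← cancel_mono (Graph.grafting (Graph.mk X j' hj' hc')), Presentation.lift_hom]
  refine hom_ext (fun v => ?_) (fun f => ?_) fun f => ?_
  · exact congrFun hV _
  · exact congrArg X.presentation.onF (congrFun hF f)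
  · refine (ghost_comp_of_right _ _ (fun f => ?_) f).trans
      (ghost_comp_of_right (𝟙 _) (Graph.grafting (Graph.mk X j' hj' hc')) (fun _ => rfl) f).symm
    exact (Hom.ghost_eq_self h f).2 ⟨f, congrFun hF f⟩

theorem operad_map_loop (hD : D.Compatible) {τ σ : Graph.{u}} (v : τ.V) (hv : ∀ x, x = v) (w : σ.V)
    (hw : ∀ x, x = w) (h : τ ⟶ σ) (f f' : τ.F) (hh : IsContraction h f f')
    (s : Relabeling ((τ.label v hv).loop f f' hh.ne hh.color) (σ.label w hw))
    (hs : ∀ i : {a : τ.F // a ≠ f ∧ a ≠ f'}, Hom.onF h (s i) = i.1) :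
    (operad hD).functor.map h = eqToHom (operad_obj hD τ v hv) ≫
      D.loop (τ.label v hv) f f' hh.ne hh.color ≫ (D.relabel s).hom ≫
      eqToHom (operad_obj hD σ w hw).symm := by
  refine (operad_map_eq hD v hv w hw h
    ((Chain.loop D (τ.label v hv) f f' hh.ne hh.color).comp (Chain.relabel D s))
    (s.onF_eq_symm (f := Hom.onF h) (g := Subtype.val) hs) fun x hx => ?_).trans
    (congrArg (fun x => eqToHom (operad_obj hD τ v hv) ≫ x) (Category.assoc _ _ _))
  have e : Hom.ghost (loopHom (τ.label v hv) f f' hh.ne hh.color ≫ (relabelIso s).hom) f = f' :=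
    ghost_comp_of_ne _ _ (ghost_loopHom hh.ne hh.color).1 hh.ne.symm
  have hx' : x = f ∨ x = f' := by
    by_contra! hn
    exact hx ⟨s ⟨x, hn⟩, hs ⟨x, hn⟩⟩
  rcases hx' with rfl | rfl
  · exact hh.ghost_eq.trans e.symm
  · exact (ghost_symm h hh.ghost_eq).trans (ghost_symm _ e).symm

theorem operad_map_edge (hD : D.Compatible) {τ₁ τ₂ τ σ : Graph.{u}} (v₁ : τ₁.V)
    (hv₁ : ∀ x, x = v₁) (v₂ : τ₂.V) (hv₂ : ∀ x, x = v₂) (w : σ.V) (hw : ∀ x, x = w)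
    (gr : τ₁ ⊗ τ₂ ⟶ τ) (_ : IsGrafting gr) (h : τ ⟶ σ) (x x' : τ.F) (hh : IsContraction h x x')
    (f : τ₁.F) (f' : τ₂.F) (hf : Hom.onF gr x = Sum.inl f) (hf' : Hom.onF gr x' = Sum.inr f')
    (hc : τ₁.color f = τ₂.color f')
    (s : Relabeling ((τ₁.label v₁ hv₁).edge (τ₂.label v₂ hv₂) f f' hc) (σ.label w hw))
    (hs : ∀ i : {a : τ₁.F ⊕ τ₂.F // a ≠ Sum.inl f ∧ a ≠ Sum.inr f'},
      Hom.onF gr (Hom.onF h (s i)) = i.1) :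
    Functor.LaxMonoidal.μ (operad hD).functor τ₁ τ₂ ≫ (operad hD).functor.map gr ≫
      (operad hD).functor.map h =
      (eqToHom (operad_obj hD τ₁ v₁ hv₁) ⊗ₘ eqToHom (operad_obj hD τ₂ v₂ hv₂)) ≫
      D.edge (τ₁.label v₁ hv₁) (τ₂.label v₂ hv₂) f f' hc ≫ (D.relabel s).hom ≫
      eqToHom (operad_obj hD σ w hw).symm := by
  rw [← Functor.map_comp]
  refine (tensorator_comp hD (gr ≫ h)).trans ((Presentation.val_tensor_congr
    (τ₁.presentation_eq v₁ hv₁) (τ₂.presentation_eq v₂ hv₂) _ (gr ≫ h)).trans ?_)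
  refine congrArg (fun x => _ ≫ x) ((Presentation.val_congr (σ.presentation_eq w hw) _ _).trans ?_)
  refine (congrArg (fun x => x ≫ eqToHom (operad_obj hD σ w hw).symm)
    ((congrArg (value D) ?_).trans (((Chain.edge D (τ₁.label v₁ hv₁) (τ₂.label v₂ hv₂) f f' hc).comp
      (Chain.relabel D s)).value_eq hD))).trans (Category.assoc _ _ _)
  have e₀ : ∀ x : τ₁.F ⊕ τ₂.F, Hom.onF ((Presentation.ofUnique τ₁ v₁ hv₁).hom ⊗ₘ
      (Presentation.ofUnique τ₂ v₂ hv₂).hom) x = x := by rintro (x | x) <;> rfl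
  refine corolla_hom_ext (fun y => ?_) fun z hz => ?_
  · exact (e₀ _).trans
      (s.onF_eq_symm (f := fun y => Hom.onF gr (Hom.onF h y)) (g := Subtype.val) hs y)
  · have e : Hom.ghost (edgeHom (τ₁.label v₁ hv₁) (τ₂.label v₂ hv₂) f f' hc ≫ (relabelIso s).hom)
        (Sum.inl f) = Sum.inr f' :=
      ghost_comp_of_ne _ _ (ghost_edgeHom (L := τ₁.label v₁ hv₁) (M := τ₂.label v₂ hv₂) hc).1
        Sum.inr_ne_inl
    have e' := ghost_comp_onF' ((Presentation.ofUnique τ₁ v₁ hv₁).hom ⊗ₘ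
      (Presentation.ofUnique τ₂ v₂ hv₂).hom) (gr ≫ h) (ghost_comp_onF' gr h hh.ghost_eq hf hf')
      rfl rfl
    have hz' : z = Sum.inl f ∨ z = Sum.inr f' := by
      by_contra! hn
      exact hz ⟨s ⟨z, hn⟩, (e₀ _).trans (hs ⟨z, hn⟩)⟩
    rcases hz' with rfl | rfl
    · exact e'.trans e.symm
    · exact (ghost_symm _ e').trans (ghost_symm _ e).symm

theorem operad_extends (hD : D.Compatible) : (operad hD).Extends D where
  obj_corolla := operad_obj hD
  map_iso := operad_map_iso hD
  map_grafting := operad_map_grafting hD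
  map_loop := operad_map_loop hD
  map_edge := operad_map_edge hD

end extends_data

/-! ### Comparison of an operad with its gluing data -/

section regraft

/-- The grafting which changes the involution of a graph. -/
def regraft (τ : Graph.{u}) (j : τ.F → τ.F) (hj : ∀ f, j (j f) = f)
    (hc : ∀ f, τ.color (j f) = τ.color f) (h : ∀ f, τ.j f ≠ f → j f = τ.j f) :
    τ ⟶ Graph.mk τ.toFlagData j hj hc where
  onV := id
  onF := id
  ghost := id
  onV_surj := Function.surjective_id
  onF_inj := Function.injective_id
  ghost_ghost _ := rfl
  ghost_eq_self f := by simp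
  bd_onF _ := rfl
  bd_ghost _ := rfl
  ghost_edge f _ hf := absurd ⟨f, rfl⟩ hf
  onF_edge := h
  color_onF _ := rfl
  color_ghost _ := rfl
  connected a b hab := by rw [show a = b from hab]
  genus_eq := Hom.genus_eq (𝟙 τ)

variable {τ σ : Graph.{u}}

/-- The graph obtained by grafting the pairs which are contracted by a morphism. -/
abbrev graft (k : τ ⟶ σ) : Graph.{u} :=
  ⟨τ.toFlagData, Hom.ghost k, Hom.ghost_ghost k, Hom.color_ghost k⟩

/-- The contraction of the grafted edges. -/
def contractGraft (k : τ ⟶ σ) : graft k ⟶ σ where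
  onV := Hom.onV (τ := τ) k
  onF := Hom.onF (τ := τ) k
  ghost := Hom.ghost (τ := τ) k
  onV_surj := Hom.onV_surj (τ := τ) k
  onF_inj := Hom.onF_inj (τ := τ) k
  ghost_ghost := Hom.ghost_ghost (τ := τ) k
  ghost_eq_self := Hom.ghost_eq_self (τ := τ) k
  bd_onF := Hom.bd_onF (τ := τ) k
  bd_ghost := Hom.bd_ghost (τ := τ) k
  ghost_edge _ _ _ := rfl
  onF_edge f hf := absurd (Hom.ghost_onF (τ := τ) k f) hf
  color_onF := Hom.color_onF (τ := τ) k
  color_ghost := Hom.color_ghost (τ := τ) k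
  connected := Hom.connected (τ := τ) k
  genus_eq := Hom.genus_eq (τ := τ) k

/-- The grafting of the pairs which are contracted by a morphism. -/
abbrev graftHom (hτ : ∀ f, τ.j f = f) (k : τ ⟶ σ) : τ ⟶ graft k :=
  regraft τ (Hom.ghost k) (Hom.ghost_ghost k) (Hom.color_ghost k) fun f hf => absurd (hτ f) hf

theorem isGrafting_graftHom (hτ : ∀ f, τ.j f = f) (k : τ ⟶ σ) : IsGrafting (graftHom hτ k) :=
  ⟨Function.bijective_id, Function.bijective_id⟩

/-- A virtual contraction of tails is a grafting followed by a contraction of genuine edges.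
`Extends` prescribes values only for the latter two, so this fixes the values on the tautological
contractions. -/
theorem graftHom_contractGraft (hτ : ∀ f, τ.j f = f) (k : τ ⟶ σ) :
    graftHom hτ k ≫ contractGraft k = k :=
  hom_ext (fun _ => rfl) (fun _ => rfl) fun f =>
    ghost_comp_onF (graftHom hτ k) (contractGraft k) f

theorem Contracts.isContraction {k : τ ⟶ σ} {f f' : τ.F} (c : Contracts k f f')
    (hσ : ∀ f, σ.j f = f) : IsContraction (contractGraft k) f f' where
  ne := c.ne
  j_eq := c.ghost_eq
  mem_range x := by
    refine (Hom.ghost_eq_self k x).symm.trans ⟨fun e => ⟨?_, ?_⟩, fun e => ?_⟩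
    · rintro rfl
      exact c.ne (e.symm.trans c.ghost_eq)
    · rintro rfl
      exact c.ne (c.symm.ghost_eq.symm.trans e)
    · by_contra hx
      exact (c.eq_or x hx).elim e.1 e.2
  j_onF y := by
    rw [hσ]
    exact (Hom.ghost_onF k y).symm

end regraft

/-! ### Values of an arbitrary extension on elementary contractions -/

section values

open Functor.LaxMonoidal Functor.OplaxMonoidal

variable {C : Type w} [Category.{v} C] [MonoidalCategory C] [SymmetricCategory C]
  {D : GluingData.{u} C} {O : SUSYOperad.{u} C}

namespace SUSYOperad.Extends

/-- The value of `O` on a corolla. -/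
theorem obj_eq (hO : O.Extends D) (L : Label.{u}) : O.functor.obj (corolla L) = D.obj L :=
  hO.obj_corolla (corolla L) PUnit.unit fun _ => rfl

theorem map_relabelIso (hO : O.Extends D) {L M : Label.{u}} (s : Relabeling L M) :
    O.functor.map (relabelIso s).hom =
      eqToHom (hO.obj_eq L) ≫ (D.relabel s).hom ≫ eqToHom (hO.obj_eq M).symm :=
  hO.map_iso (τ := corolla L) (σ := corolla M) PUnit.unit (fun _ => rfl) PUnit.unit (fun _ => rfl)
    (relabelIso s) s s.equiv.symm_apply_apply

/-- Here the compatibility of `D` is not yet available; the identity relabeling is handled by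
functoriality of `O`. -/
theorem relabel_refl (hO : O.Extends D) (L : Label.{u}) :
    (D.relabel (Relabeling.refl L)).hom = 𝟙 (D.obj L) := by
  have e := hO.map_relabelIso (Relabeling.refl L)
  rw [show (relabelIso (Relabeling.refl L)).hom = 𝟙 (corolla L) from rfl,
    CategoryTheory.Functor.map_id] at e
  rw [← cancel_epi (eqToHom (hO.obj_eq L)), ← cancel_mono (eqToHom (hO.obj_eq L).symm),
    Category.assoc, ← e]
  simp

theorem map_graftHom (hO : O.Extends D) {τ σ : Graph.{u}} (hτ : ∀ f, τ.j f = f) (k : τ ⟶ σ) :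
    ∃ e, O.functor.map (graftHom hτ k) = eqToHom e :=
  hO.map_grafting τ.toFlagData τ.j (Hom.ghost k) τ.j_j _ τ.color_j _ (graftHom hτ k) rfl rfl

theorem map_loopHom (hO : O.Extends D) (L : Label.{u}) (i i' : L.I) (hne : i ≠ i')
    (hc : L.color i = L.color i') :
    O.functor.map (loopHom L i i' hne hc) =
      eqToHom (hO.obj_eq L) ≫ D.loop L i i' hne hc ≫ eqToHom (hO.obj_eq _).symm := by
  have hτ : ∀ f, (corolla L).j f = f := fun _ => rfl
  obtain ⟨e, he⟩ := hO.map_graftHom hτ (loopHom L i i' hne hc)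
  have h := hO.map_loop (τ := graft (loopHom L i i' hne hc)) (σ := corolla (L.loop i i' hne hc))
    PUnit.unit (fun _ => rfl) PUnit.unit (fun _ => rfl) (contractGraft (loopHom L i i' hne hc)) i i'
    ((contracts_loopHom hne hc).isContraction fun _ => rfl)
    (Relabeling.refl (L.loop i i' hne hc)) fun _ => rfl
  rw [← graftHom_contractGraft hτ (loopHom L i i' hne hc), Functor.map_comp, he, h]
  erw [hO.relabel_refl (L.loop i i' hne hc), Category.id_comp, eqToHom_trans_assoc]
  rfl

theorem map_edgeHom (hO : O.Extends D) (L M : Label.{u}) (i : L.I) (i' : M.I)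
    (hc : L.color i = M.color i') :
    μ O.functor (corolla L) (corolla M) ≫ O.functor.map (edgeHom L M i i' hc) =
      (eqToHom (hO.obj_eq L) ⊗ₘ eqToHom (hO.obj_eq M)) ≫ D.edge L M i i' hc ≫
        eqToHom (hO.obj_eq _).symm := by
  have hτ : ∀ f, (corolla L ⊗ corolla M).j f = f := by rintro (f | f) <;> rfl
  have h := hO.map_edge (τ₁ := corolla L) (τ₂ := corolla M) (τ := graft (edgeHom L M i i' hc))
    (σ := corolla (L.edge M i i' hc)) PUnit.unit (fun _ => rfl) PUnit.unit (fun _ => rfl)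
    PUnit.unit (fun _ => rfl) (graftHom hτ (edgeHom L M i i' hc)) (isGrafting_graftHom _ _)
    (contractGraft (edgeHom L M i i' hc)) (Sum.inl i) (Sum.inr i')
    ((contracts_edgeHom hc).isContraction fun _ => rfl) i i' rfl rfl hc
    (Relabeling.refl (L.edge M i i' hc)) fun _ => rfl
  rw [← graftHom_contractGraft hτ (edgeHom L M i i' hc), Functor.map_comp]
  refine h.trans ?_
  erw [hO.relabel_refl (L.edge M i i' hc), Category.id_comp]
  rfl

/-- The comparison of the value of gluing data with the value of an operad. -/
noncomputable def comparison (hO : O.Extends D) : (s : LabelTree.{u}) →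
    (s.eval D ≅ O.functor.obj s.graph)
  | .unit => Functor.Monoidal.εIso O.functor
  | .leaf L => eqToIso (hO.obj_eq L).symm
  | .node s t => (hO.comparison s ⊗ᵢ hO.comparison t) ≪≫ Functor.Monoidal.μIso O.functor _ _

end SUSYOperad.Extends

end values

/-! ### Structural morphisms under a braided monoidal functor -/

section monoidal_functor

open Functor.LaxMonoidal

theorem inv_comp_map {C : Type w} [Category.{v} C] (F : Graph.{u} ⥤ C) {X Y : C} {A B : Graph.{u}} (i : X ≅ Y)
    (j : A ≅ B) {m : X ⟶ F.obj A} {n : Y ⟶ F.obj B} (e : i.hom ≫ n = m ≫ F.map j.hom) : i.inv ≫ m = n ≫ F.map j.inv := by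
  rw [Iso.inv_comp_eq, ← Category.assoc, e, Category.assoc, ← F.map_comp, j.hom_inv_id, F.map_id,
    Category.comp_id]

theorem comp_eqToHom_of_eq {C : Type w} [Category.{v} C] {X Y X' Y' : C} {p : X = X'} {q : Y = Y'}
    {x : X ⟶ Y} {φ : X' ⟶ Y'} (e : x = eqToHom p ≫ φ ≫ eqToHom q.symm) :
    φ ≫ eqToHom q.symm = eqToHom p.symm ≫ x := by
  rw [e, eqToHom_trans_assoc, eqToHom_refl, Category.id_comp]

theorem comp_eqToHom_of_tensor_eq {C : Type w} [Category.{v} C] [MonoidalCategory C]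
    {X Y X' Y' Z Z' : C} {p : X = X'} {q : Y = Y'} {r : Z = Z'} {x : X ⊗ Y ⟶ Z} {φ : X' ⊗ Y' ⟶ Z'}
    (e : x = (eqToHom p ⊗ₘ eqToHom q) ≫ φ ≫ eqToHom r.symm) :
    φ ≫ eqToHom r.symm = (eqToHom p.symm ⊗ₘ eqToHom q.symm) ≫ x := by
  rw [e, tensorHom_comp_tensorHom_assoc, eqToHom_trans, eqToHom_trans, eqToHom_refl, eqToHom_refl,
    id_tensorHom_id, Category.id_comp]

variable {C : Type w} [Category.{v} C] [MonoidalCategory C] [SymmetricCategory C]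
  (F : Graph.{u} ⥤ C) [F.Braided]

theorem tensor_mu {X X' Y Y' : C} {A A' B B' : Graph.{u}} {f : X ⟶ Y} {g : X' ⟶ Y'} {h : A ⟶ B}
    {k : A' ⟶ B'} {m : X ⟶ F.obj A} {m' : X' ⟶ F.obj A'} {n : Y ⟶ F.obj B} {n' : Y' ⟶ F.obj B'}
    (e : f ≫ n = m ≫ F.map h) (e' : g ≫ n' = m' ≫ F.map k) :
    (f ⊗ₘ g) ≫ (n ⊗ₘ n') ≫ μ F B B' = ((m ⊗ₘ m') ≫ μ F A A') ≫ F.map (h ⊗ₘ k) := by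
  rw [Category.assoc, ← μ_natural, tensorHom_comp_tensorHom_assoc, tensorHom_comp_tensorHom_assoc,
    e, e']

theorem assoc_mu {X Y Z : C} {A B B' : Graph.{u}} (m : X ⟶ F.obj A) (n : Y ⟶ F.obj B)
    (p : Z ⟶ F.obj B') :
    (α_ X Y Z).hom ≫ (m ⊗ₘ ((n ⊗ₘ p) ≫ μ F B B')) ≫ μ F A (B ⊗ B') =
      ((((m ⊗ₘ n) ≫ μ F A B) ⊗ₘ p) ≫ μ F (A ⊗ B) B') ≫ F.map (α_ A B B').hom := by
  have e₁ : m ⊗ₘ ((n ⊗ₘ p) ≫ μ F B B') = (m ⊗ₘ (n ⊗ₘ p)) ≫ F.obj A ◁ μ F B B' := by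
    rw [← id_tensorHom, tensorHom_comp_tensorHom, Category.comp_id]
  have e₂ : ((m ⊗ₘ n) ≫ μ F A B) ⊗ₘ p = ((m ⊗ₘ n) ⊗ₘ p) ≫ μ F A B ▷ F.obj B' := by
    rw [← tensorHom_id, tensorHom_comp_tensorHom, Category.comp_id]
  rw [e₁, e₂, Category.assoc, Category.assoc, Category.assoc, associativity F A B B',
    associator_naturality_assoc]

theorem leftUnitor_mu {X : C} {A : Graph.{u}} (m : X ⟶ F.obj A) :
    (λ_ X).hom ≫ m = ((ε F ⊗ₘ m) ≫ μ F (𝟙_ Graph.{u}) A) ≫ F.map (λ_ A).hom := by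
  rw [← leftUnitor_naturality, left_unitality F A, MonoidalCategory.tensorHom_def', Category.assoc,
    Category.assoc]

theorem rightUnitor_mu {X : C} {A : Graph.{u}} (m : X ⟶ F.obj A) :
    (ρ_ X).hom ≫ m = ((m ⊗ₘ ε F) ≫ μ F A (𝟙_ Graph.{u})) ≫ F.map (ρ_ A).hom := by
  rw [← rightUnitor_naturality, right_unitality F A, MonoidalCategory.tensorHom_def, Category.assoc,
    Category.assoc]

theorem braid_mu {X Y : C} {A B : Graph.{u}} (m : X ⟶ F.obj A) (n : Y ⟶ F.obj B) :
    (β_ X Y).hom ≫ (n ⊗ₘ m) ≫ μ F B A = ((m ⊗ₘ n) ≫ μ F A B) ≫ F.map (β_ A B).hom := by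
  rw [Category.assoc, Functor.LaxBraided.braided, BraidedCategory.braiding_naturality_assoc]

end monoidal_functor

section comparison

open Functor.LaxMonoidal

variable {C : Type w} [Category.{v} C] [MonoidalCategory C] [SymmetricCategory C]
  {D : GluingData.{u} C} {O : SUSYOperad.{u} C}

namespace SUSYOperad.Extends

/-- Relabelings are covered by `map_iso`; all other constructors are covered by the axioms of a
braided monoidal functor. -/
theorem comparison_word (hO : O.Extends D) {s t : LabelTree.{u}} (f : Word s t) :
    f.eval D ≫ (hO.comparison t).hom = (hO.comparison s).hom ≫ O.functor.map f.hom := by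
  induction f with
  | id s =>
    exact (Category.id_comp _).trans ((congrArg (fun x => (hO.comparison s).hom ≫ x) (O.functor.map_id _)).trans
        (Category.comp_id _)).symm
  | comp f g hf hg =>
    refine (Category.assoc _ _ _).trans ((congrArg (fun x => f.eval D ≫ x) hg).trans ?_)
    rw [← Category.assoc, hf, Category.assoc, ← Functor.map_comp]
    rfl
  | tensor f g hf hg => exact tensor_mu O.functor hf hg
  | assoc s t r => exact assoc_mu O.functor _ _ _
  | assocInv s t r =>
    exact inv_comp_map O.functor (α_ _ _ _) (α_ s.graph t.graph r.graph) (assoc_mu O.functor _ _ _)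
  | leftUnitor s => exact leftUnitor_mu O.functor _
  | leftUnitorInv s => exact inv_comp_map O.functor (λ_ _) (λ_ s.graph) (leftUnitor_mu O.functor _)
  | rightUnitor s => exact rightUnitor_mu O.functor _
  | rightUnitorInv s => exact inv_comp_map O.functor (ρ_ _) (ρ_ s.graph) (rightUnitor_mu O.functor _)
  | braid s t => exact braid_mu O.functor _ _
  | @relabel L M s => exact comp_eqToHom_of_eq (q := hO.obj_eq _) (hO.map_relabelIso s)

theorem comparison_atom (hO : O.Extends D) {a b : LabelTree.{u}} (g : Atom a b) :
    g.eval D ≫ (hO.comparison b).hom =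
      (hO.comparison a).hom ≫ O.functor.map (g.eval tautological) := by
  cases g with
  | loop L i i' hne hc => exact comp_eqToHom_of_eq (q := hO.obj_eq _) (hO.map_loopHom L i i' hne hc)
  | edge L M i i' hc =>
    exact (comp_eqToHom_of_tensor_eq (r := hO.obj_eq _) (hO.map_edgeHom L M i i' hc)).trans
      (Category.assoc _ _ _).symm

/-- The value of a chain is conjugate to the value of `O` on its graph morphism. Both the relations
for `D` and the comparison of two extensions rest on this. -/
theorem comparison_chain (hO : O.Extends D) {n : ℕ} {s t : LabelTree.{u}} {h : s.graph ⟶ t.graph}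
    {φ : s.eval D ⟶ t.eval D} (c : Chain D n s t h φ) :
    φ ≫ (hO.comparison t).hom = (hO.comparison s).hom ≫ O.functor.map h := by
  induction c with
  | word f => exact hO.comparison_word f
  | @step n s a b r t h φ e g c ih =>
    have e₁ : g.step D r ≫ (hO.comparison (b.node r)).hom =
        (hO.comparison (a.node r)).hom ≫ O.functor.map (g.step tautological r) :=
      tensor_mu O.functor (hO.comparison_atom g)
        ((Category.id_comp _).trans ((congrArg (fun x => (hO.comparison r).hom ≫ x)
          (O.functor.map_id _)).trans (Category.comp_id _)).symm)
    rw [Functor.map_comp, Functor.map_comp, Category.assoc, Category.assoc, ih,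
      ← reassoc_of% hO.comparison_word e, reassoc_of% e₁]

/-- The relations between the gluing maps follow from the relations between contractions. -/
theorem chain_unique (hO : O.Extends D) {n m : ℕ} {s t : LabelTree.{u}} {h h' : s.graph ⟶ t.graph}
    {φ φ' : s.eval D ⟶ t.eval D} (c : Chain D n s t h φ) (c' : Chain D m s t h' φ')
    (e : h = h') : φ = φ' := by
  rw [← cancel_mono (hO.comparison t).hom, hO.comparison_chain c, hO.comparison_chain c', e]

/-- Each relation compares two chains whose graph morphisms agree by the tautological relation. -/
theorem compatible (hO : O.Extends D) : D.Compatible where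
  relabel_trans s t := hO.chain_unique (Chain.relabel D (s.trans t))
    ((Chain.relabel D s).comp (Chain.relabel D t)) (tautological_compatible.relabel_trans s t)
  loop_symm L i i' hne hc := hO.chain_unique
    ((Chain.loop D L i i' hne hc).comp (Chain.relabel D (Relabeling.loopSymm L i i' hne hc)))
    (Chain.loop D L i' i hne.symm hc.symm) (tautological_compatible.loop_symm L i i' hne hc)
  edge_symm L M i i' hc := hO.chain_unique
    ((Chain.edge D L M i i' hc).comp (Chain.relabel D (Relabeling.edgeSymm L M i i' hc)))
    ((Chain.edge D M L i' i hc.symm).word_comp (.braid (.leaf L) (.leaf M)))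
    (tautological_compatible.edge_symm L M i i' hc)
  relabel_loop s i i' hne hc := hO.chain_unique
    ((Chain.loop D _ i i' hne hc).comp (Chain.relabel D (s.loop i i' hne hc)))
    ((Chain.loop D _ (s i) (s i') _ _).word_comp (.relabel s))
    (tautological_compatible.relabel_loop s i i' hne hc)
  relabel_edge s t i i' hc := hO.chain_unique
    ((Chain.edge D _ _ i i' hc).comp (Chain.relabel D (s.edge t i i' hc)))
    ((Chain.edge D _ _ (s i) (t i') _).word_comp (.tensor (.relabel s) (.relabel t)))
    (tautological_compatible.relabel_edge s t i i' hc)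
  loop_loop L i₁ i₁' i₂ i₂' h₁ h₂ a b c d hc₁ hc₂ := hO.chain_unique
    ((Chain.loop D L i₂ i₂' h₂ hc₂).comp ((Chain.loop D _ _ _ _ _).comp (Chain.relabel D _)))
    ((Chain.loop D L i₁ i₁' h₁ hc₁).comp (Chain.loop D _ _ _ _ _))
    (tautological_compatible.loop_loop L i₁ i₁' i₂ i₂' h₁ h₂ a b c d hc₁ hc₂)
  loop_edge L M i₁ i₁' i₂ i₂' h₁ a c hc₁ hc₂ := hO.chain_unique
    ((Chain.edge D L M i₂ i₂' hc₂).comp ((Chain.loop D _ _ _ _ _).comp (Chain.relabel D _)))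
    (((Chain.loop D L i₁ i₁' h₁ hc₁).tensor_id (.leaf M)).comp (Chain.edge D _ _ _ _ _))
    (tautological_compatible.loop_edge L M i₁ i₁' i₂ i₂' h₁ a c hc₁ hc₂)
  edge_loop L M i₁ i₂ i₁' i₂' a a' hc₁ hc₂ := hO.chain_unique
    ((Chain.edge D L M i₁ i₁' hc₁).comp ((Chain.loop D _ _ _ _ _).comp (Chain.relabel D _)))
    ((Chain.edge D L M i₂ i₂' hc₂).comp (Chain.loop D _ _ _ _ _))
    (tautological_compatible.edge_loop L M i₁ i₂ i₁' i₂' a a' hc₁ hc₂)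
  edge_edge L M N i₁ i₁' i₂ i₂' a hc₁ hc₂ := hO.chain_unique
    (((Chain.edge D L M i₁ i₁' hc₁).tensor_id (.leaf N)).comp
      ((Chain.edge D _ _ _ _ _).comp (Chain.relabel D _)))
    ((((Chain.edge D M N i₂ i₂' hc₂).id_tensor (.leaf L)).comp (Chain.edge D _ _ _ _ _)).word_comp
      (.assoc (.leaf L) (.leaf M) (.leaf N)))
    (tautological_compatible.edge_edge L M N i₁ i₁' i₂ i₂' a hc₁ hc₂)

end SUSYOperad.Extends

end comparison

/-! ### Uniqueness of the operad -/

section uniqueness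

open Functor.LaxMonoidal

variable {C : Type w} [Category.{v} C] [MonoidalCategory C] [SymmetricCategory C]
  {D : GluingData.{u} C} {O O' : SUSYOperad.{u} C}

theorem tensorHom_comp_mu (F : Graph.{u} ⥤ C) [F.Braided] {X X' : C} {A A' B B' : Graph.{u}}
    (m : X ⟶ F.obj A) (m' : X' ⟶ F.obj A') (h : A ⟶ B) (k : A' ⟶ B') :
    ((m ≫ F.map h) ⊗ₘ (m' ≫ F.map k)) ≫ μ F B B' = ((m ⊗ₘ m') ≫ μ F A A') ≫ F.map (h ⊗ₘ k) := by
  rw [Category.assoc, ← μ_natural, tensorHom_comp_tensorHom_assoc]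

namespace SUSYOperad.Extends

/-- This grafting is an isomorphism of corollas with identity relabeling followed by a change of
involution, and `O` sends both to transports. -/
theorem map_ofUnique_hom (hO : O.Extends D) (τ : Graph.{u}) (v : τ.V) (hv : ∀ x, x = v) :
    ∃ e, O.functor.map (Presentation.ofUnique τ v hv).hom = eqToHom e := by
  let σ : Graph.{u} := ⟨τ.toFlagData, id, fun _ => rfl, fun _ => rfl⟩
  let i : corolla (τ.label v hv) ≅ σ :=
    isoOfEquiv (Presentation.ofUnique τ v hv).onV (Equiv.refl _) (fun _ => (hv _).symm)
      (fun _ => rfl) (fun _ => rfl) (fun _ => rfl)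
  have e₁ := hO.map_iso (τ := corolla (τ.label v hv)) (σ := σ) PUnit.unit (fun _ => rfl) v hv i
    (Relabeling.refl (τ.label v hv)) fun _ => rfl
  let r : σ ⟶ τ := regraft σ τ.j τ.j_j τ.color_j fun f hf => absurd rfl hf
  obtain ⟨e, e₂⟩ := hO.map_grafting τ.toFlagData id τ.j (fun _ => rfl) τ.j_j (fun _ => rfl)
    τ.color_j r rfl rfl
  have e₃ : (Presentation.ofUnique τ v hv).hom = i.hom ≫ r :=
    hom_ext (fun _ => rfl) (fun _ => rfl) fun f => (ghost_comp_onF i.hom r f).symm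
  have e₄ : O.functor.map i.hom = eqToHom ((hO.obj_eq (τ.label v hv)).trans
      (hO.obj_corolla σ v hv).symm) := by
    refine e₁.trans ?_
    erw [hO.relabel_refl (τ.label v hv), Category.id_comp, eqToHom_trans]
  exact ⟨_, (congrArg O.functor.map e₃).trans ((O.functor.map_comp i.hom r).trans
    ((congrArg₂ (fun x y => x ≫ y) e₄ e₂).trans (eqToHom_trans _ _)))⟩

/-- The comparison of the value of a disjoint union of corollas with the value of an operad on
a graph with the same vertices. -/
noncomputable def compare (hO : O.Extends D) {τ : Graph.{u}} (P : Presentation τ.toFlagData) :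
    P.tree.eval D ⟶ O.functor.obj τ :=
  (hO.comparison P.tree).hom ≫ O.functor.map P.hom

theorem isIso_compare (hO : O.Extends D) {τ : Graph.{u}} (P : Presentation τ.toFlagData) :
    IsIso (hO.compare P) := by
  have := O.isIso_map P.hom P.isGrafting_hom
  exact IsIso.comp_isIso

theorem compare_congr (hO : O.Extends D) {τ : Graph.{u}} {P Q : Presentation τ.toFlagData}
    (e : P = Q) :
    hO.compare P = eqToHom (congrArg (fun P => P.tree.eval D) e) ≫ hO.compare Q := by
  subst e
  simp

theorem compare_ofUnique (hO : O.Extends D) (τ : Graph.{u}) (v : τ.V) (hv : ∀ x, x = v) :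
    hO.compare (Presentation.ofUnique τ v hv) = eqToHom (hO.obj_corolla τ v hv).symm := by
  obtain ⟨e, he⟩ := hO.map_ofUnique_hom τ v hv
  exact (congrArg (fun x => eqToHom (hO.obj_eq (τ.label v hv)).symm ≫ x) he).trans
    (eqToHom_trans _ _)

/-- Specialized to suitable disjoint unions, this yields the naturality of `operadIso` and its
compatibility with unit and tensorator. -/
theorem val_compare (hO : O.Extends D) {τ : Graph.{u}} (P : Presentation τ.toFlagData)
    (s : LabelTree.{u}) (h : s.graph ⟶ τ) :
    P.val D s h ≫ hO.compare P = (hO.comparison s).hom ≫ O.functor.map h := by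
  rw [Presentation.val, compare, ← Category.assoc,
    hO.comparison_chain (chain_value D _).choose_spec, Category.assoc, ← Functor.map_comp,
    Presentation.lift_hom]

/-- The isomorphism from the operad given by compatible gluing data to any operad with these
gluing data. -/
noncomputable def operadIso (hD : D.Compatible) (hO : O.Extends D) :
    (operad hD).functor ≅ O.functor :=
  NatIso.ofComponents
    (fun τ => @asIso C _ ((operad hD).functor.obj τ) (O.functor.obj τ)
      (hO.compare (τ := τ) τ.toFlagData.presentation) (hO.isIso_compare _))
    fun {τ σ} h => (hO.val_compare (τ := σ) σ.toFlagData.presentation τ.tree (τ.grafting ≫ h)).trans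
      ((congrArg (fun x => _ ≫ x) (O.functor.map_comp _ _)).trans (Category.assoc _ _ _).symm)

theorem isMonoidal_operadIso (hD : D.Compatible) (hO : O.Extends D) :
    NatTrans.IsMonoidal (hO.operadIso hD).hom where
  unit := (hO.val_compare (τ := 𝟙_ Graph.{u}) (FlagData.presentation _) .unit (𝟙 _)).trans
    ((congrArg (fun x => ε O.functor ≫ x) (O.functor.map_id _)).trans (Category.comp_id _))
  tensor τ σ := (hO.val_compare (τ := τ ⊗ σ) (FlagData.presentation _) (τ.tree.node σ.tree)
    (τ.grafting ⊗ₘ σ.grafting)).trans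
      (tensorHom_comp_mu O.functor (hO.comparison τ.tree).hom (hO.comparison σ.tree).hom
        τ.grafting σ.grafting).symm

theorem operadIso_app_of_unique (hD : D.Compatible) (hO : O.Extends D) (τ : Graph.{u}) (v : τ.V)
    (hv : ∀ x, x = v) : (hO.operadIso hD).hom.app τ =
      eqToHom ((operad_obj hD τ v hv).trans (hO.obj_corolla τ v hv).symm) := by
  refine (hO.compare_congr (τ.presentation_eq v hv)).trans ?_
  rw [hO.compare_ofUnique]
  exact eqToHom_trans _ _

/-- Induction on the formal tensor product: monoidality handles the unit and the nodes, the
normalization on corollas handles the leaves. -/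
theorem comparison_app (hO : O.Extends D) (hO' : O'.Extends D) (θ : O.functor ⟶ O'.functor)
    [NatTrans.IsMonoidal θ] (hθ : ∀ (τ : Graph.{u}) (v : τ.V) (hv : ∀ x, x = v),
      θ.app τ = eqToHom ((hO.obj_corolla τ v hv).trans (hO'.obj_corolla τ v hv).symm)) :
    ∀ s : LabelTree.{u}, (hO.comparison s).hom ≫ θ.app s.graph = (hO'.comparison s).hom
  | .unit => NatTrans.IsMonoidal.unit (τ := θ)
  | .leaf L => (congrArg (fun x => eqToHom (hO.obj_eq L).symm ≫ x)
      (hθ (corolla L) PUnit.unit fun _ => rfl)).trans (eqToHom_trans _ _)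
  | .node s t => by
    have hs := hO.comparison_app hO' θ hθ s
    have ht := hO.comparison_app hO' θ hθ t
    refine (Category.assoc _ _ _).trans
      ((congrArg (fun x => _ ≫ x) (NatTrans.IsMonoidal.tensor (τ := θ) s.graph t.graph)).trans ?_)
    refine (Category.assoc _ _ _).symm.trans (congrArg (fun x => x ≫ _) ?_)
    exact (tensorHom_comp_tensorHom _ _ _ _).trans (congrArg₂ (fun x y => x ⊗ₘ y) hs ht)

/-- A monoidal transformation is determined by its values on corollas. -/
theorem hom_ext_corolla (hO : O.Extends D) (hO' : O'.Extends D) (θ η : O.functor ⟶ O'.functor)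
    [NatTrans.IsMonoidal θ] [NatTrans.IsMonoidal η]
    (hθ : ∀ (τ : Graph.{u}) (v : τ.V) (hv : ∀ x, x = v),
      θ.app τ = eqToHom ((hO.obj_corolla τ v hv).trans (hO'.obj_corolla τ v hv).symm))
    (hη : ∀ (τ : Graph.{u}) (v : τ.V) (hv : ∀ x, x = v),
      η.app τ = eqToHom ((hO.obj_corolla τ v hv).trans (hO'.obj_corolla τ v hv).symm)) :
    θ = η := by
  ext τ
  have := hO.isIso_compare (τ := τ) τ.toFlagData.presentation
  -- Naturality along the grafting, which `O` inverts, moves both transformations to a disjoint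
  -- union of corollas, where they agree.
  rw [← cancel_epi (hO.compare (τ := τ) τ.toFlagData.presentation), compare, Category.assoc,
    Category.assoc, θ.naturality, η.naturality, ← Category.assoc, ← Category.assoc,
    hO.comparison_app hO' θ hθ, hO.comparison_app hO' η hη]

end SUSYOperad.Extends

end uniqueness

end SUSY

theorem mainTheorem2 {C : Type w} [Category.{v} C] [MonoidalCategory C] [SymmetricCategory C]
    (D : SUSY.GluingData.{u} C) :
    (∃ (O : SUSY.SUSYOperad.{u} C) (hO : O.Extends D),
      ∀ (O' : SUSY.SUSYOperad.{u} C) (hO' : O'.Extends D),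
        ∃! θ : O.functor ≅ O'.functor, NatTrans.IsMonoidal θ.hom ∧
          ∀ (τ : SUSY.Graph.{u}) (v : τ.V) (hv : ∀ x, x = v),
            θ.hom.app τ =
              eqToHom ((hO.obj_corolla τ v hv).trans (hO'.obj_corolla τ v hv).symm)) ↔
      D.Compatible := by
  -- Necessity uses only that some extension exists, not that it is unique.
  refine ⟨fun ⟨_, hO, _⟩ => hO.compatible, fun hD => ⟨SUSY.operad hD, SUSY.operad_extends hD, ?_⟩⟩
  intro O' hO'
  have := hO'.isMonoidal_operadIso hD
  refine ⟨hO'.operadIso hD, ⟨this, hO'.operadIso_app_of_unique hD⟩, fun θ ⟨h₁, h₂⟩ => ?_⟩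
  exact Iso.ext ((SUSY.operad_extends hD).hom_ext_corolla hO' _ _ h₂
    (hO'.operadIso_app_of_unique hD))
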